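/- Let $I$ be a finite set and $A=(a_{ij})_{i,j\in I}$ an indecomposable symmetrizable generalized Cartan matrix. Let $\mathfrak g$ be the derived Kac–Moody algebra of $A$: the complex Lie algebra with generators $e_i,f_i,h_i$ ($i\in I$) and relations $[h_i,h_j]=0$, $[h_i,e_j]=a_{ij}e_j$, $[h_i,f_j]=-a_{ij}f_j$, $[e_i,f_j]=\delta_{ij}h_i$ for $i,j\in I$, and $\mathrm{ad}(e_i)^{1-a_{ij}}(e_j)=\mathrm{ad}(f_i)^{1-a_{ij}}(f_j)=0$ for $i\neq j$. Put $\mathfrak h=\sum_{i}\mathbb C h_i$ and let $\mathfrak n^-$ be the Lie subalgebra generated by all $f_i$. Let the Weyl group, generated by the simple reflections $r_i$, act on the root lattice $Q=\bigoplus_i\mathbb Z\alpha_i$ by $r_i(\alpha_j)=\alpha_j-a_{ij}\alpha_i$. Let $X\subseteq I$ be such that $A_X=(a_{ij})_{i,j\in X}$ is of finite type (all principal minors are positive), let $W_X=\langle r_i\rangle_{i\in X}$ and let $w_X$ be the longest element of $W_X$. Let $\tau$ be a permutation of $I$ with $\tau^2=\mathrm{id}$ and $a_{\tau(i)\tau(j)}=a_{ij}$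 for all $i,j$, such that $-w_X(\alpha_i)=\alpha_{\tau(i)}$ for all $i\in X$. Let $\theta$ act on $Q$ by $\theta(\alpha_j)=-w_X(\alpha_{\tau(j)})$, and assume that $(X,\tau)$ is a generalized Satake diagram: for all $i\in X$ and $j\in I\setminus X$, if $\theta(\alpha_j)=-(\alpha_i+\alpha_j)$ then $a_{ji}\neq-1$. Define the linear automorphism $\theta$ of $\mathfrak g$ by $\theta=\mathrm{Ad}(m_{i_1})\cdots\mathrm{Ad}(m_{i_\ell})\,\tau\,\omega$, where $w_X=r_{i_1}\cdots r_{i_\ell}$ is any reduced expression, $\mathrm{Ad}(m_i)=\exp(\mathrm{ad}\,e_i)\exp(-\mathrm{ad}\,f_i)\exp(\mathrm{ad}\,e_i)$, $\tau$ is the Lie algebra automorphism with $e_i\mapsto e_{\tau(i)}$, $f_i\mapsto f_{\tau(i)}$, $h_i\mapsto h_{\tau(i)}$, and $\omega$ is the Chevalley involution $e_i\mapsto-f_i$, $f_i\mapsto-e_i$, $h_i\mapsto-h_i$. Let $\mathfrak h^\theta=\{x\in\mathfrak h:\theta(x)=x\}$ and let $\mathfrak n^+_X$ be the Lie subalgebra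 generated by the $e_i$ with $i\in X$. A component of $X$ is a subset $Y\subseteq X$ with $a_{ik}=0$ for all $i\in Y$, $k\in X\setminus Y$. For $j\in I\setminus X$ let $X(j)$ be the smallest component of $X$ containing every $i\in X$ with $a_{ij}\ne0$. Let $\boldsymbol c=(c_j)_{j\in I\setminus X}$ be nonzero complex numbers such that, for all $j\in I\setminus X$, $$a_{j,\tau(j)}=0\ \text{ and }\ X(j)=\emptyset\quad\Longrightarrow\quad c_j=c_{\tau(j)}.$$ Put $g_i=f_i$ for $i\in X$ and $g_i=f_i+c_i\theta(f_i)$ for $i\in I\setminus X$, and let $\mathfrak k_{\boldsymbol c}$ be the Lie subalgebra of $\mathfrak g$ generated by $\mathfrak n^+_X$, $\mathfrak h^\theta$ and all $g_i$, $i\in I$. For a nonempty word $\boldsymbol i=(i_1,\dots,i_\ell)$ in $I$ put $f_{\boldsymbol i}=\mathrm{ad}(f_{i_1})\cdots\mathrm{ad}(f_{i_{\ell-1}})(f_{i_\ell})$ and $g_{\boldsymbol i}=\mathrm{ad}(g_{i_1})\cdots\mathrm{ad}(g_{i_{\ell-1}})(g_{i_\ell})$. Let $\mathcal J$ be any set of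 nonempty words such that $(f_{\boldsymbol j})_{\boldsymbol j\in\mathcal J}$ is a basis of $\mathfrak n^-$. Then, as vector spaces, $$\mathfrak k_{\boldsymbol c}=\mathfrak n^+_X\oplus\mathfrak h^\theta\oplus\bigoplus_{\boldsymbol j\in\mathcal J}\mathbb C\,g_{\boldsymbol j},$$ and $g_{\boldsymbol j}\neq0$ for every $\boldsymbol j\in\mathcal J$. -/

import Mathlib

noncomputable section

namespace KacMoody

/-! ### Generalized Cartan matrices -/

section CartanData

variable {I : Type*} [Fintype I] [DecidableEq I]

/-- `A` is a generalized Cartan matrix which is symmetrizable. -/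
structure IsSymmetrizableGCM (A : Matrix I I ℤ) : Prop where
  diag : ∀ i, A i i = 2
  offDiag : ∀ i j, i ≠ j → A i j ≤ 0
  symmetrizable : ∃ d : I → ℚ, (∀ i, 0 < d i) ∧ ∀ i j, d i * A i j = d j * A j i

/-- No proper nonempty subset of the nodes is disconnected from its complement. -/
def IsIndecomposable (A : Matrix I I ℤ) : Prop :=
  ∀ Y : Finset I, Y.Nonempty → Y ≠ Finset.univ → ∃ i ∈ Y, ∃ j ∉ Y, A i j ≠ 0

/-- The submatrix `A_X` is of finite type: all its principal minors are positive. -/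
def IsFiniteType (A : Matrix I I ℤ) (X : Finset I) : Prop :=
  ∀ Y ⊆ X, 0 < (A.submatrix (fun i : Y => (i : I)) (fun i : Y => (i : I))).det

/-- `σ` is a diagram automorphism of `A`. -/
def IsDiagramAut (A : Matrix I I ℤ) (σ : Equiv.Perm I) : Prop :=
  ∀ i j, A (σ i) (σ j) = A i j

/-! ### Components of a set of nodes -/

/-- `Y` is a (possibly empty or disconnected) component of `X`. -/
def IsComponent (A : Matrix I I ℤ) (X Y : Finset I) : Prop :=
  Y ⊆ X ∧ ∀ i ∈ Y, ∀ j ∈ X, j ∉ Y → A i j = 0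

/-- `X(j)`, the smallest component of `X` containing all `i ∈ X` with `a_{ij} ≠ 0`. -/
def neighbourComponent (A : Matrix I I ℤ) (X : Finset I) (j : I) : Set I :=
  {i | ∀ Y, IsComponent A X Y → (∀ k ∈ X, A k j ≠ 0 → k ∈ Y) → i ∈ Y}

/-! ### The root lattice and the Weyl group

The root lattice `Q = ⊕ ℤ α_i` is `I → ℤ`; the simple roots are its standard basis. -/

/-- The simple root `α_i`. -/
def simpleRoot (i : I) : I → ℤ := Pi.single i 1

/-- The simple reflection `r_i : μ ↦ μ - μ(h_i) α_i`, so that `r_i α_j = α_j - a_{ij} α_i`. -/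
def simpleReflection (A : Matrix I I ℤ) (i : I) : Module.End ℤ (I → ℤ) :=
  LinearMap.id - ((LinearMap.proj i).comp A.mulVecLin).smulRight (simpleRoot i)

/-- The product `r_{i_1} r_{i_2} ⋯ r_{i_ℓ}` of a word `(i_1, …, i_ℓ)`. The Weyl group is the set
of all such products, `W_X` the set of those with letters in `X`. -/
def weylProd (A : Matrix I I ℤ) (l : List I) : Module.End ℤ (I → ℤ) :=
  (l.map (simpleReflection A)).prod

/-- A word is reduced if its product is not the product of a shorter word. -/
def IsReducedWord (A : Matrix I I ℤ) (l : List I) : Prop :=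
  ∀ l' : List I, weylProd A l' = weylProd A l → l.length ≤ l'.length

/-- `l` is a reduced expression of the longest element `w_X` of `W_X`. -/
def IsLongestWord (A : Matrix I I ℤ) (X : Finset I) (l : List I) : Prop :=
  (∀ i ∈ l, i ∈ X) ∧ IsReducedWord A l ∧
    ∀ l' : List I, (∀ i ∈ l', i ∈ X) → IsReducedWord A l' → l'.length ≤ l.length

/-- The action of `θ = - w_X τ` on the root lattice, `l` being an expression of `w_X`. -/
def thetaRoot (A : Matrix I I ℤ) (τ : Equiv.Perm I) (l : List I) : Module.End ℤ (I → ℤ) :=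
  -(weylProd A l ∘ₗ LinearMap.funLeft ℤ ℤ τ.symm)

/-- `(X, τ)` is a generalized Satake diagram; since `A_X` is of finite type, `w_X` exists and is
unique, so the clauses about it are stated for its reduced expressions `l`. -/
structure IsGeneralizedSatake (A : Matrix I I ℤ) (X : Finset I) (τ : Equiv.Perm I) : Prop where
  finiteType : IsFiniteType A X
  diagramAut : IsDiagramAut A τ
  involutive : ∀ i, τ (τ i) = i
  neg_longest : ∀ l, IsLongestWord A X l →
    ∀ i ∈ X, -(weylProd A l (simpleRoot i)) = simpleRoot (τ i)
  no_obstruction : ∀ l, IsLongestWord A X l → ∀ i ∈ X, ∀ j ∉ X,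
    thetaRoot A τ l (simpleRoot j) = -(simpleRoot i + simpleRoot j) → A j i ≠ -1

end CartanData

/-! ### The derived Kac-Moody algebra -/

section Algebra

variable {I : Type*} [DecidableEq I] (A : Matrix I I ℤ)

/-- The derived Kac-Moody Lie algebra of `A` over `ℂ`, given by the Chevalley generators and the
Serre presentation. -/
abbrev KM := Matrix.ToLieAlgebra ℂ A

/-- The projection from the free Lie algebra on the Chevalley generators. -/
def proj : FreeLieAlgebra ℂ (CartanMatrix.Generators I) →ₗ⁅ℂ⁆ KM A where
  toLinearMap := (LieSubmodule.Quotient.mk' (CartanMatrix.Relations.toIdeal ℂ A)).toLinearMap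
  map_lie' := by intro x y; rfl

/-- The generator `e_i`. -/
def e (i : I) : KM A := proj A (FreeLieAlgebra.of ℂ (.E i))

/-- The generator `f_i`. -/
def f (i : I) : KM A := proj A (FreeLieAlgebra.of ℂ (.F i))

/-- The generator `h_i`. -/
def h (i : I) : KM A := proj A (FreeLieAlgebra.of ℂ (.H i))

theorem proj_surjective : Function.Surjective (proj A) :=
  LieSubmodule.Quotient.surjective_mk' _

theorem proj_eq_zero {x : FreeLieAlgebra ℂ (CartanMatrix.Generators I)}
    (hx : x ∈ CartanMatrix.Relations.toSet ℂ A) : proj A x = 0 :=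
  (LieSubmodule.Quotient.mk_eq_zero (N := CartanMatrix.Relations.toIdeal ℂ A)).2
    (LieSubmodule.subset_lieSpan hx)

theorem map_ad_pow {L L' : Type*} [LieRing L] [LieAlgebra ℂ L] [LieRing L'] [LieAlgebra ℂ L']
    (ψ : L →ₗ⁅ℂ⁆ L') (x y : L) (n : ℕ) :
    ψ (((LieAlgebra.ad ℂ L x) ^ n) y) = ((LieAlgebra.ad ℂ L' (ψ x)) ^ n) (ψ y) := by
  induction n with
  | zero => simp
  | succ n ih => simp [pow_succ', ih]

theorem lie_h_h (i j : I) : ⁅h A i, h A j⁆ = 0 := by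
  have := proj_eq_zero A (x := CartanMatrix.Relations.HH ℂ (i, j))
    (by simp [CartanMatrix.Relations.toSet])
  simpa [CartanMatrix.Relations.HH, h] using this

theorem lie_e_f_same (i : I) : ⁅e A i, f A i⁆ = h A i := by
  have := proj_eq_zero A (x := CartanMatrix.Relations.EF ℂ (i, i))
    (Or.inl (Or.inl (Or.inl (Or.inl (Or.inr ⟨_, rfl⟩)))))
  simpa [CartanMatrix.Relations.EF, e, f, h, sub_eq_zero] using this

theorem lie_e_f_ne {i j : I} (hij : i ≠ j) : ⁅e A i, f A j⁆ = 0 := by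
  have := proj_eq_zero A (x := CartanMatrix.Relations.EF ℂ (i, j))
    (Or.inl (Or.inl (Or.inl (Or.inl (Or.inr ⟨_, rfl⟩)))))
  simpa [CartanMatrix.Relations.EF, e, f, hij] using this

theorem lie_h_e (i j : I) : ⁅h A i, e A j⁆ = A i j • e A j := by
  have := proj_eq_zero A (x := CartanMatrix.Relations.HE ℂ A (i, j))
    (Or.inl (Or.inl (Or.inl (Or.inr ⟨_, rfl⟩))))
  simpa [CartanMatrix.Relations.HE, e, h, sub_eq_zero] using this

theorem lie_h_f (i j : I) : ⁅h A i, f A j⁆ = -(A i j • f A j) := by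
  have := proj_eq_zero A (x := CartanMatrix.Relations.HF ℂ A (i, j))
    (Or.inl (Or.inl (Or.inr ⟨_, rfl⟩)))
  simpa [CartanMatrix.Relations.HF, f, h, add_eq_zero_iff_eq_neg] using this

theorem serre_e (i j : I) :
    ((LieAlgebra.ad ℂ (KM A) (e A i)) ^ (-A i j).toNat) ⁅e A i, e A j⁆ = 0 := by
  have := proj_eq_zero A (x := CartanMatrix.Relations.adE ℂ A (i, j))
    (Or.inl (Or.inr ⟨_, rfl⟩))
  simpa only [CartanMatrix.Relations.adE, e, Function.uncurry, Function.comp, map_ad_pow,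
    LieHom.map_lie] using this

theorem serre_f (i j : I) :
    ((LieAlgebra.ad ℂ (KM A) (f A i)) ^ (-A i j).toNat) ⁅f A i, f A j⁆ = 0 := by
  have := proj_eq_zero A (x := CartanMatrix.Relations.adF ℂ A (i, j))
    (Or.inr ⟨_, rfl⟩)
  simpa only [CartanMatrix.Relations.adF, f, Function.uncurry, Function.comp, map_ad_pow,
    LieHom.map_lie] using this

/-- A Lie subalgebra containing the Chevalley generators is everything. -/
theorem mem_of_generators (S : LieSubalgebra ℂ (KM A)) (he : ∀ i, e A i ∈ S) (hf : ∀ i, f A i ∈ S)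
    (hh : ∀ i, h A i ∈ S) (x : KM A) : x ∈ S := by
  let ψ : FreeLieAlgebra ℂ (CartanMatrix.Generators I) →ₗ⁅ℂ⁆ S :=
    FreeLieAlgebra.lift ℂ fun g => match g with
      | .H i => ⟨h A i, hh i⟩
      | .E i => ⟨e A i, he i⟩
      | .F i => ⟨f A i, hf i⟩
  have hψ : S.incl.comp ψ = proj A := by
    apply FreeLieAlgebra.hom_ext
    rintro (i | i | i) <;> simp [ψ, e, f, h]
  obtain ⟨y, rfl⟩ := proj_surjective A x
  rw [← hψ]
  exact (ψ y).2

/-- The universal property of the Serre presentation. -/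
def lift {L : Type*} [LieRing L] [LieAlgebra ℂ L] (e' f' h' : I → L)
    (hhh : ∀ i j, ⁅h' i, h' j⁆ = 0)
    (hef : ∀ i, ⁅e' i, f' i⁆ = h' i)
    (hef' : ∀ i j, i ≠ j → ⁅e' i, f' j⁆ = 0)
    (hhe : ∀ i j, ⁅h' i, e' j⁆ = A i j • e' j)
    (hhf : ∀ i j, ⁅h' i, f' j⁆ = -(A i j • f' j))
    (hse : ∀ i j, ((LieAlgebra.ad ℂ L (e' i)) ^ (-A i j).toNat) ⁅e' i, e' j⁆ = 0)
    (hsf : ∀ i j, ((LieAlgebra.ad ℂ L (f' i)) ^ (-A i j).toNat) ⁅f' i, f' j⁆ = 0) :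
    KM A →ₗ⁅ℂ⁆ L :=
  let ψ : FreeLieAlgebra ℂ (CartanMatrix.Generators I) →ₗ⁅ℂ⁆ L :=
    FreeLieAlgebra.lift ℂ fun g => match g with
      | .H i => h' i
      | .E i => e' i
      | .F i => f' i
  have hψ : CartanMatrix.Relations.toIdeal ℂ A ≤ ψ.ker := by
    refine LieSubmodule.lieSpan_le.2 ?_
    rintro x (((((⟨⟨i, j⟩, rfl⟩ | ⟨⟨i, j⟩, rfl⟩) | ⟨⟨i, j⟩, rfl⟩) | ⟨⟨i, j⟩, rfl⟩) |
      ⟨⟨i, j⟩, rfl⟩) | ⟨⟨i, j⟩, rfl⟩)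
    · simp [CartanMatrix.Relations.HH, ψ, hhh]
    · by_cases hij : i = j
      · subst hij
        simp [CartanMatrix.Relations.EF, ψ, hef]
      · simp [CartanMatrix.Relations.EF, ψ, hij, hef' i j hij]
    · simp [CartanMatrix.Relations.HE, ψ, hhe]
    · simp [CartanMatrix.Relations.HF, ψ, hhf]
    · simpa [CartanMatrix.Relations.adE, ψ, map_ad_pow] using hse i j
    · simpa [CartanMatrix.Relations.adF, ψ, map_ad_pow] using hsf i j
  { toLinearMap := Submodule.liftQ (CartanMatrix.Relations.toIdeal ℂ A).toSubmodule
      (ψ : FreeLieAlgebra ℂ (CartanMatrix.Generators I) →ₗ[ℂ] L) hψ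
    map_lie' := by
      intro x y
      obtain ⟨x, rfl⟩ := proj_surjective A x
      obtain ⟨y, rfl⟩ := proj_surjective A y
      exact ψ.map_lie x y }

theorem ad_neg_pow {L : Type*} [LieRing L] [LieAlgebra ℂ L] {x y : L} {n : ℕ}
    (hxy : ((LieAlgebra.ad ℂ L x) ^ n) y = 0) : ((LieAlgebra.ad ℂ L (-x)) ^ n) y = 0 := by
  rw [map_neg, neg_pow]
  rcases neg_one_pow_eq_or (Module.End ℂ L) n with hn | hn <;> simp [hn, hxy]

/-- The Chevalley involution: `e_i ↦ -f_i`, `f_i ↦ -e_i`, `h_i ↦ -h_i`. -/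
def chevalley : KM A →ₗ⁅ℂ⁆ KM A :=
  lift A (fun i => -f A i) (fun i => -e A i) (fun i => -h A i)
    (by intro i j; simp [lie_h_h])
    (by intro i; rw [neg_lie, lie_neg, neg_neg, ← lie_skew, lie_e_f_same])
    (by intro i j hij; rw [neg_lie, lie_neg, neg_neg, ← lie_skew, lie_e_f_ne A hij.symm, neg_zero])
    (by intro i j; simp [lie_h_f])
    (by intro i j; simp [lie_h_e])
    (by intro i j; exact ad_neg_pow (by simpa using serre_f A i j))
    (by intro i j; exact ad_neg_pow (by simpa using serre_e A i j))

/-- The automorphism of the Kac-Moody algebra induced by a diagram automorphism `σ`: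
`e_i ↦ e_{σ(i)}`, `f_i ↦ f_{σ(i)}`, `h_i ↦ h_{σ(i)}`. -/
def diagramHom (σ : Equiv.Perm I) (hσ : IsDiagramAut A σ) : KM A →ₗ⁅ℂ⁆ KM A :=
  lift A (fun i => e A (σ i)) (fun i => f A (σ i)) (fun i => h A (σ i))
    (by intro i j; exact lie_h_h A _ _)
    (by intro i; exact lie_e_f_same A _)
    (by intro i j hij; exact lie_e_f_ne A (fun H => hij (σ.injective H)))
    (by intro i j; rw [← hσ i j]; exact lie_h_e A _ _)
    (by intro i j; rw [← hσ i j]; exact lie_h_f A _ _)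
    (by intro i j; rw [← hσ i j]; exact serre_e A _ _)
    (by intro i j; rw [← hσ i j]; exact serre_f A _ _)

/-! ### Exponentials of locally nilpotent endomorphisms -/

/-- `exp(D) = ∑ Dⁿ / n!` for a locally nilpotent endomorphism `D`: on each vector the sum has only
finitely many nonzero terms. -/
def expLocNilp {V : Type*} [AddCommGroup V] [Module ℂ V] (D : Module.End ℂ V)
    (hD : ∀ x, ∃ n : ℕ, (D ^ n) x = 0) : Module.End ℂ V :=
  have hfin : ∀ x, (Function.support fun n : ℕ => ((n.factorial : ℂ)⁻¹) • (D ^ n) x).Finite := by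
    intro x
    obtain ⟨n, hn⟩ := hD x
    refine (Set.finite_lt_nat n).subset fun m hm => ?_
    by_contra hlt
    obtain ⟨k, rfl⟩ := Nat.exists_eq_add_of_le (not_lt.1 hlt)
    apply hm
    simp [add_comm n k, pow_add, hn]
  { toFun := fun x => ∑ᶠ n : ℕ, ((n.factorial : ℂ)⁻¹) • (D ^ n) x
    map_add' := by
      intro x y
      rw [← finsum_add_distrib (hfin x) (hfin y)]
      simp
    map_smul' := by
      intro c x
      rw [RingHom.id_apply, smul_finsum' c (hfin x)]
      refine finsum_congr fun n => ?_
      rw [map_smul, smul_comm] }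

theorem ad_e_locNilp (i : I) (x : KM A) : ∃ n : ℕ, ((LieAlgebra.ad ℂ (KM A) (e A i)) ^ n) x = 0 := by
  have hh : ∀ j, h A j ∈ LieSubalgebra.engel ℂ (e A i) := by
    intro j
    refine (LieSubalgebra.mem_engel_iff ℂ _ _).2 ⟨2, ?_⟩
    rw [pow_two, Module.End.mul_apply, LieAlgebra.ad_apply, LieAlgebra.ad_apply,
      ← lie_skew _ (h A j), lie_h_e]
    simp
  refine (LieSubalgebra.mem_engel_iff ℂ _ _).1
    (mem_of_generators A (LieSubalgebra.engel ℂ (e A i)) ?_ ?_ hh x)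
  · intro j
    exact (LieSubalgebra.mem_engel_iff ℂ _ _).2 ⟨(-A i j).toNat + 1, by
      simpa [pow_succ] using serre_e A i j⟩
  · intro j
    by_cases hij : i = j
    · subst hij
      obtain ⟨n, hn⟩ := (LieSubalgebra.mem_engel_iff ℂ _ _).1 (hh i)
      exact (LieSubalgebra.mem_engel_iff ℂ _ _).2 ⟨n + 1, by simpa [pow_succ, lie_e_f_same] using hn⟩
    · exact (LieSubalgebra.mem_engel_iff ℂ _ _).2 ⟨1, by simpa using lie_e_f_ne A hij⟩

theorem ad_f_locNilp (i : I) (x : KM A) : ∃ n : ℕ, ((LieAlgebra.ad ℂ (KM A) (f A i)) ^ n) x = 0 := by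
  have hh : ∀ j, h A j ∈ LieSubalgebra.engel ℂ (f A i) := by
    intro j
    refine (LieSubalgebra.mem_engel_iff ℂ _ _).2 ⟨2, ?_⟩
    rw [pow_two, Module.End.mul_apply, LieAlgebra.ad_apply, LieAlgebra.ad_apply,
      ← lie_skew _ (h A j), lie_h_f]
    simp
  refine (LieSubalgebra.mem_engel_iff ℂ _ _).1
    (mem_of_generators A (LieSubalgebra.engel ℂ (f A i)) ?_ ?_ hh x)
  · intro j
    by_cases hij : j = i
    · subst hij
      obtain ⟨n, hn⟩ := (LieSubalgebra.mem_engel_iff ℂ _ _).1 (hh j)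
      refine (LieSubalgebra.mem_engel_iff ℂ _ _).2 ⟨n + 1, ?_⟩
      rw [pow_succ, Module.End.mul_apply, LieAlgebra.ad_apply, ← lie_skew, lie_e_f_same, map_neg, hn,
        neg_zero]
    · refine (LieSubalgebra.mem_engel_iff ℂ _ _).2 ⟨1, ?_⟩
      rw [pow_one, LieAlgebra.ad_apply, ← lie_skew, lie_e_f_ne A hij, neg_zero]
  · intro j
    exact (LieSubalgebra.mem_engel_iff ℂ _ _).2 ⟨(-A i j).toNat + 1, by
      simpa [pow_succ] using serre_f A i j⟩

theorem ad_neg_f_locNilp (i : I) (x : KM A) :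
    ∃ n : ℕ, ((LieAlgebra.ad ℂ (KM A) (-f A i)) ^ n) x = 0 :=
  (ad_f_locNilp A i x).imp fun _ hn => ad_neg_pow hn

/-- `Ad(m_i) = exp(ad e_i) exp(ad (-f_i)) exp(ad e_i)`. -/
def AdM (i : I) : Module.End ℂ (KM A) :=
  expLocNilp (LieAlgebra.ad ℂ (KM A) (e A i)) (ad_e_locNilp A i) *
    expLocNilp (LieAlgebra.ad ℂ (KM A) (-f A i)) (ad_neg_f_locNilp A i) *
    expLocNilp (LieAlgebra.ad ℂ (KM A) (e A i)) (ad_e_locNilp A i)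

/-- `Ad(m_w) = Ad(m_{i_1}) ⋯ Ad(m_{i_ℓ})` for a reduced word `(i_1, …, i_ℓ)` of `w`. -/
def AdWord (l : List I) : Module.End ℂ (KM A) := (l.map (AdM A)).prod

/-- `θ = Ad(m_{w_X}) τ ω`, where `l` is a reduced expression of `w_X`. -/
def theta (τ : Equiv.Perm I) (hτ : IsDiagramAut A τ) (l : List I) : KM A →ₗ[ℂ] KM A :=
  AdWord A l ∘ₗ (diagramHom A τ hτ : KM A →ₗ[ℂ] KM A) ∘ₗ (chevalley A : KM A →ₗ[ℂ] KM A)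

/-! ### The subalgebras -/

/-- `𝔫⁻ = ⟨f_i⟩_{i ∈ I}`. -/
def nMinus : LieSubalgebra ℂ (KM A) := LieSubalgebra.lieSpan ℂ (KM A) (Set.range (f A))

/-- `𝔫⁺_X = ⟨e_i⟩_{i ∈ X}`. -/
def nPlus (X : Finset I) : LieSubalgebra ℂ (KM A) :=
  LieSubalgebra.lieSpan ℂ (KM A) (e A '' (X : Set I))

/-- The Cartan subalgebra `𝔥`, spanned by the `h_i`. -/
def cartan : Submodule ℂ (KM A) := Submodule.span ℂ (Set.range (h A))

/-- The fixed points `V^θ` of a linear map `θ` in a subspace `V`. -/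
def fixedIn {V : Type*} [AddCommGroup V] [Module ℂ V] (U : Submodule ℂ V) (θ : V →ₗ[ℂ] V) :
    Submodule ℂ V :=
  U ⊓ LinearMap.eqLocus θ LinearMap.id

/-- The generators `g_i`: `f_i` for `i ∈ X` and `f_i + c_i θ(f_i)` otherwise. -/
def gGen (X : Finset I) (θ : KM A →ₗ[ℂ] KM A) (c : I → ℂ) (i : I) : KM A :=
  if i ∈ X then f A i else f A i + c i • θ (f A i)

/-- `𝔨_c = ⟨𝔫⁺_X, 𝔥^θ, g_i (i ∈ I)⟩`. -/
def kSub (X : Finset I) (θ : KM A →ₗ[ℂ] KM A) (c : I → ℂ) : LieSubalgebra ℂ (KM A) :=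
  LieSubalgebra.lieSpan ℂ (KM A)
    ((nPlus A X : Set (KM A)) ∪ (fixedIn (cartan A) θ : Set (KM A)) ∪ Set.range (gGen A X θ c))

/-- The iterated bracket `[x_{i_1}, [x_{i_2}, …, [x_{i_{ℓ-1}}, x_{i_ℓ}]…]]` of a nonempty word
(the value at the empty word is irrelevant). -/
def iterBracket {L : Type*} [LieRing L] (x : I → L) : List I → L
  | [] => 0
  | [i] => x i
  | i :: j :: l => ⁅x i, iterBracket x (j :: l)⁆

/-- The family of subspaces `𝔫⁺_X`, `𝔥^θ` and `ℂ g_w` for `w ∈ J`. -/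
def summand (X : Finset I) (θ : KM A →ₗ[ℂ] KM A) (c : I → ℂ) (J : Set (List I)) :
    Fin 2 ⊕ J → Submodule ℂ (KM A) :=
  Sum.elim ![(nPlus A X).toSubmodule, fixedIn (cartan A) θ]
    fun w => Submodule.span ℂ {iterBracket (gGen A X θ c) w}

end Algebra

end KacMoody

end

/-! Independence and spanning rest on two different gradings.

Independence. For `j ∉ X` the weight of `θ(f_j)` is `α_{τ(j)} + γ_j`, with `γ_j ≥ 0` supported on
`X`. Measure weights by their total degree in the simple roots outside `X`. Then `g_j` is `f_j` plus
terms of larger outer degree, so the lowest component of `g_w` is `f_w`. A linear relation between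
the `g_w`, modulo `𝔫⁺_X + 𝔥`, therefore forces one between the `f_w` (`eq_zero_of_add_sum_eq_zero`).

Spanning. Filter by `𝔫⁺_X + 𝔥^θ` plus the brackets `g_w` with `w` of length at most `m`
(`kFiltration`). This filtration is multiplicative and its union contains `𝔨_c`. It suffices that
each linear relation between the `f_w` holds for the `g_w` up to lower filtration degree; then, by
induction on length, the words of `J` suffice (`kFiltration_le`). This needs two facts.

(1) Relations between the `f_w` come from the Serre relations (`sum_wordF_mem_serreSubmodule`). The
free associative algebra on the letters `f_i` carries operators `e_i`, `h_i` as in a Verma module of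
highest weight 0. The two-sided ideal of the Serre elements is stable, so the quotient is a module
over the Kac-Moody algebra, and a relation applied to the empty word lands in the ideal. To return
from associative to Lie elements, let `g_i t` act on `L[t] ⊕ ℂδ`, where `δ` is the Euler derivation:
a bracket of length `n` sends `δ` to `n g_w tⁿ`, and `n` is invertible. This replaces a
Poincaré-Birkhoff-Witt argument (`sum_iterBracket_mem`).

(2) The `g_i` satisfy the Serre relations up to lower filtration degree
(`serreElt_gGen_mem_kFiltration`). After expanding, most terms vanish because their weight has
coordinates of both signs (`eq_zero_of_mixed`) or is a proper multiple of a simple root, and terms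
of positive weight supported on `X` lie in `𝔫⁺_X`. The condition `c_j = c_{τ(j)}` is needed when the
Serre element is a combination of `h_j` and `h_{τ(j)}`. The generalized Satake condition excludes,
for `τ(i) = i ∉ X` and `j ∈ X`, a term of weight 0.

Weights cannot be defined by `𝔥` alone, since `A` may be singular; `rootSpace` uses the
endomorphisms scaling one pair `e_k, f_k` by `2` and `1/2`. The operators `Ad(m_i)` move these
spaces by `r_i`, and everything needed about `θ` is collected in `IsSatakeTheta`. -/

set_option linter.unusedSectionVars false

noncomputable section

namespace KacMoody

/-! ### Spans in Lie algebras and independent families of subspaces. -/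

section General

variable {L : Type*} [LieRing L] [LieAlgebra ℂ L]

/-- A subspace containing `S` and stable under `ad s` for `s ∈ S` contains the Lie subalgebra
generated by `S`. -/
theorem lieSpan_le_of_stable {S : Set L} {V : Submodule ℂ L} (hS : S ⊆ V)
    (hV : ∀ s ∈ S, ∀ v ∈ V, ⁅s, v⁆ ∈ V) : (LieSubalgebra.lieSpan ℂ L S).toSubmodule ≤ V := by
  have key : ∀ x ∈ LieSubalgebra.lieSpan ℂ L S, x ∈ V ∧ ∀ v ∈ V, ⁅x, v⁆ ∈ V := by
    intro x hx
    induction hx using LieSubalgebra.lieSpan_induction with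
    | mem x hx => exact ⟨hS hx, hV x hx⟩
    | zero => exact ⟨V.zero_mem, fun v _ => by simp⟩
    | add x y _ _ hx hy =>
      exact ⟨V.add_mem hx.1 hy.1, fun v hv => by
        rw [add_lie]; exact V.add_mem (hx.2 v hv) (hy.2 v hv)⟩
    | smul a x _ hx =>
      exact ⟨V.smul_mem a hx.1, fun v hv => by rw [smul_lie]; exact V.smul_mem a (hx.2 v hv)⟩
    | lie x y _ _ hx hy =>
      exact ⟨hx.2 y hy.1, fun v hv => by
        rw [lie_lie]; exact V.sub_mem (hx.2 _ (hy.2 v hv)) (hy.2 _ (hx.2 v hv))⟩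
  exact fun x hx => (key x hx).1

/-- To check that `ad x` maps a span into `V`, it suffices to check generators. -/
theorem lie_mem_of_mem_span {x : L} {s : Set L} {V : Submodule ℂ L}
    (hs : ∀ v ∈ s, ⁅x, v⁆ ∈ V) {v : L} (hv : v ∈ Submodule.span ℂ s) : ⁅x, v⁆ ∈ V := by
  have : Submodule.span ℂ s ≤ V.comap (LieAlgebra.ad ℂ L x) := Submodule.span_le.2 hs
  exact this hv

/-- Modulo the `E j` with `j ≠ k`, an element of the sum comes from `V k`, and independence kills
the remainder. It serves twice: to see that known elements exhaust a root space, and to read off the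
weight of `AdM A i x` from an eigenvalue. -/
theorem mem_of_mem_iSup_of_iSupIndep {M ι : Type*} [AddCommGroup M] [Module ℂ M]
    {E V : ι → Submodule ℂ M} (hE : iSupIndep E) (hV : ∀ k, V k ≤ E k) {y : M} (hy : y ∈ ⨆ k, V k)
    {k : ι} (hk : y ∈ E k) : y ∈ V k := by
  have hsplit : (⨆ j, V j) ≤ V k ⊔ ⨆ (j) (_ : j ≠ k), E j := by
    refine iSup_le fun j => ?_
    by_cases hj : j = k
    · subst hj; exact le_sup_left
    · exact le_sup_of_le_right (le_iSup₂_of_le j hj (hV j))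
  obtain ⟨a, ha, b, hb, hab⟩ := Submodule.mem_sup.1 (hsplit hy)
  have hb' : b ∈ E k := by
    rw [← add_sub_cancel_left a b, hab]
    exact (E k).sub_mem hk (hV k ha)
  have : b = 0 := by
    have := (Submodule.disjoint_def.1 (hE k)) b hb' hb
    exact this
  rw [← hab, this, add_zero]
  exact ha

end General

/-! ### Iterated brackets of words. -/

section IterBracket

variable {I : Type*} {L : Type*} [LieRing L]

theorem iterBracket_cons (x : I → L) (i : I) {w : List I} (hw : w ≠ []) :
    iterBracket x (i :: w) = ⁅x i, iterBracket x w⁆ := by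
  cases w with
  | nil => exact absurd rfl hw
  | cons j w => rfl

/-- Induction on nonempty words. -/
@[elab_as_elim]
theorem word_induction {p : ∀ w : List I, w ≠ [] → Prop} (single : ∀ i, p [i] (by simp))
    (cons : ∀ i w, (hw : w ≠ []) → p w hw → p (i :: w) (by simp)) (w : List I) (hw : w ≠ []) :
    p w hw := by
  induction w with
  | nil => exact absurd rfl hw
  | cons i w ih =>
    by_cases hw : w = []
    · subst hw; exact single i
    · exact cons i w hw (ih hw)

theorem map_iterBracket {L' : Type*} [LieRing L'] {ψ : L → L'}
    (h0 : ψ 0 = 0) (hψ : ∀ x y, ψ ⁅x, y⁆ = ⁅ψ x, ψ y⁆)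
    (x : I → L) (w : List I) : ψ (iterBracket x w) = iterBracket (fun i => ψ (x i)) w := by
  by_cases hw : w = []
  · subst hw; exact h0
  · induction w, hw using word_induction with
    | single i => rfl
    | cons i w hw ih => rw [iterBracket_cons _ _ hw, iterBracket_cons _ _ hw, hψ, ih]

theorem iterBracket_mem_lieSpan [LieAlgebra ℂ L] {x : I → L} {S : LieSubalgebra ℂ L} {w : List I}
    (hw : w ≠ []) (hx : ∀ i ∈ w, x i ∈ S) : iterBracket x w ∈ S := by
  induction w, hw using word_induction with
  | single i => exact hx i (by simp)
  | cons i w hw ih =>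
    rw [iterBracket_cons _ _ hw]
    exact S.lie_mem (hx i (by simp)) (ih fun j hj => hx j (by simp [hj]))

/-- The Lie subalgebra generated by `x i`, `i ∈ Y`, is spanned by iterated brackets. -/
theorem lieSpan_image_eq_span [LieAlgebra ℂ L] (x : I → L) (Y : Set I) :
    (LieSubalgebra.lieSpan ℂ L (x '' Y)).toSubmodule =
      Submodule.span ℂ (iterBracket x '' {w | w ≠ [] ∧ ∀ i ∈ w, i ∈ Y}) := by
  apply le_antisymm
  · refine lieSpan_le_of_stable ?_ ?_
    · rintro _ ⟨i, hi, rfl⟩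
      exact Submodule.subset_span ⟨[i], by simpa using hi, rfl⟩
    · rintro _ ⟨i, hi, rfl⟩ v hv
      refine lie_mem_of_mem_span ?_ hv
      rintro _ ⟨w, ⟨hw, hwY⟩, rfl⟩
      rw [← iterBracket_cons x i hw]
      refine Submodule.subset_span ⟨i :: w, ⟨by simp, ?_⟩, rfl⟩
      simpa using ⟨hi, hwY⟩
  · refine Submodule.span_le.2 ?_
    rintro _ ⟨w, ⟨hw, hwY⟩, rfl⟩
    exact iterBracket_mem_lieSpan hw fun i hi =>
      LieSubalgebra.subset_lieSpan ⟨i, hwY i hi, rfl⟩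

theorem lie_iterBracket_of_eigen [LieAlgebra ℂ L] {x : I → L} {t : L} {a : I → ℂ} (hx : ∀ i, ⁅t, x i⁆ = a i • x i)
    {w : List I} (hw : w ≠ []) : ⁅t, iterBracket x w⁆ = (w.map a).sum • iterBracket x w := by
  induction w, hw using word_induction with
  | single i => simpa [iterBracket] using hx i
  | cons i w hw ih =>
    rw [iterBracket_cons _ _ hw, leibniz_lie, hx, ih, smul_lie, lie_smul, ← add_smul]
    simp

/-- Moving `e'` inwards by the Leibniz rule leaves elements `h'`, which only rescale the rest of the
word. The hypotheses are abstract so that the roles of `e` and `f` can be exchanged. -/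
theorem lie_iterBracket_mem [LieAlgebra ℂ L] {e' f' h' : I → L} {a : I → I → ℂ}
    (hef : ∀ i j, ⁅e' i, f' j⁆ ∈ Submodule.span ℂ (Set.range h'))
    (hhf : ∀ i j, ⁅h' i, f' j⁆ = a i j • f' j) (i : I) {w : List I} (hw : w ≠ []) :
    ⁅e' i, iterBracket f' w⁆ ∈
      Submodule.span ℂ (Set.range h' ∪ iterBracket f' '' {w | w ≠ []}) := by
  set V := Submodule.span ℂ (Set.range h' ∪ iterBracket f' '' {w | w ≠ []})
  have hhV : ∀ t ∈ Submodule.span ℂ (Set.range h'), ∀ w : List I, w ≠ [] →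
      ⁅t, iterBracket f' w⁆ ∈ V := by
    intro t ht w hw
    rw [← lie_skew]
    refine V.neg_mem (lie_mem_of_mem_span ?_ ht)
    rintro _ ⟨k, rfl⟩
    rw [← lie_skew, lie_iterBracket_of_eigen (hhf k) hw]
    exact V.neg_mem (V.smul_mem _ (Submodule.subset_span (Or.inr ⟨w, hw, rfl⟩)))
  have hfV : ∀ j, ∀ v ∈ V, ⁅f' j, v⁆ ∈ V := by
    intro j v hv
    refine lie_mem_of_mem_span ?_ hv
    rintro _ (⟨k, rfl⟩ | ⟨w, hw, rfl⟩)
    · rw [← lie_skew, hhf]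
      exact V.neg_mem (V.smul_mem _ (Submodule.subset_span (Or.inr ⟨[j], by simp, rfl⟩)))
    · rw [← iterBracket_cons _ _ hw]
      exact Submodule.subset_span (Or.inr ⟨j :: w, by simp, rfl⟩)
  induction w, hw using word_induction with
  | single j =>
    exact Submodule.span_mono Set.subset_union_left (hef i j)
  | cons j w hw ih =>
    rw [iterBracket_cons _ _ hw, leibniz_lie]
    exact V.add_mem (hhV _ (hef i j) w hw) (hfV j _ ih)

theorem iterBracket_replicate (x : I → L) (j : I) (n : ℕ) :
    iterBracket x (List.replicate (n + 2) j) = 0 := by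
  induction n with
  | zero => simp [List.replicate, iterBracket]
  | succ n ih =>
    rw [List.replicate_succ, iterBracket_cons _ _ (by simp), ih, lie_zero]

end IterBracket

/-! ### Homomorphisms out of the Serre presentation. -/

section Homs

variable {I : Type*} [DecidableEq I] (A : Matrix I I ℤ)

section LiftLemmas

variable {A} {L : Type*} [LieRing L] [LieAlgebra ℂ L] {e' f' h' : I → L}
  (hhh : ∀ i j, ⁅h' i, h' j⁆ = 0)
  (hef : ∀ i, ⁅e' i, f' i⁆ = h' i)
  (hef' : ∀ i j, i ≠ j → ⁅e' i, f' j⁆ = 0)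
  (hhe : ∀ i j, ⁅h' i, e' j⁆ = A i j • e' j)
  (hhf : ∀ i j, ⁅h' i, f' j⁆ = -(A i j • f' j))
  (hse : ∀ i j, ((LieAlgebra.ad ℂ L (e' i)) ^ (-A i j).toNat) ⁅e' i, e' j⁆ = 0)
  (hsf : ∀ i j, ((LieAlgebra.ad ℂ L (f' i)) ^ (-A i j).toNat) ⁅f' i, f' j⁆ = 0)

theorem lift_e (i : I) : lift A e' f' h' hhh hef hef' hhe hhf hse hsf (e A i) = e' i :=
  FreeLieAlgebra.lift_of_apply ..

theorem lift_f (i : I) : lift A e' f' h' hhh hef hef' hhe hhf hse hsf (f A i) = f' i :=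
  FreeLieAlgebra.lift_of_apply ..

theorem lift_h (i : I) : lift A e' f' h' hhh hef hef' hhe hhf hse hsf (h A i) = h' i :=
  FreeLieAlgebra.lift_of_apply ..

end LiftLemmas

theorem chevalley_e (i : I) : chevalley A (e A i) = -f A i := lift_e ..

theorem chevalley_f (i : I) : chevalley A (f A i) = -e A i := lift_f ..

theorem chevalley_h (i : I) : chevalley A (h A i) = -h A i := lift_h ..

theorem diagramHom_e (σ : Equiv.Perm I) (hσ : IsDiagramAut A σ) (i : I) :
    diagramHom A σ hσ (e A i) = e A (σ i) := lift_e ..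

theorem diagramHom_f (σ : Equiv.Perm I) (hσ : IsDiagramAut A σ) (i : I) :
    diagramHom A σ hσ (f A i) = f A (σ i) := lift_f ..

theorem diagramHom_h (σ : Equiv.Perm I) (hσ : IsDiagramAut A σ) (i : I) :
    diagramHom A σ hσ (h A i) = h A (σ i) := lift_h ..

variable {A} in
theorem hom_ext {L : Type*} [LieRing L] [LieAlgebra ℂ L] {φ ψ : KM A →ₗ⁅ℂ⁆ L}
    (he : ∀ i, φ (e A i) = ψ (e A i)) (hf : ∀ i, φ (f A i) = ψ (f A i))
    (hh : ∀ i, φ (h A i) = ψ (h A i)) : φ = ψ := by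
  let S : LieSubalgebra ℂ (KM A) :=
    { LinearMap.eqLocus (φ : KM A →ₗ[ℂ] L) (ψ : KM A →ₗ[ℂ] L) with
      lie_mem' := by
        intro x y hx hy
        have hx' : φ x = ψ x := hx
        have hy' : φ y = ψ y := hy
        show φ ⁅x, y⁆ = ψ ⁅x, y⁆
        rw [LieHom.map_lie, LieHom.map_lie, hx', hy'] }
  ext x
  exact mem_of_generators A S he hf hh x

theorem lie_h_e_complex (i j : I) : ⁅h A i, e A j⁆ = (A i j : ℂ) • e A j := by
  rw [lie_h_e, Int.cast_smul_eq_zsmul]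

theorem lie_h_f_complex (i j : I) : ⁅h A i, f A j⁆ = (-A i j : ℂ) • f A j := by
  rw [lie_h_f, neg_smul, Int.cast_smul_eq_zsmul]

theorem lie_f_e (i j : I) : ⁅f A i, e A j⁆ = if i = j then -h A i else 0 := by
  rw [← lie_skew]
  split_ifs with hij
  · subst hij; rw [lie_e_f_same]
  · rw [lie_e_f_ne A (Ne.symm hij), neg_zero]

theorem lie_e_f (i j : I) : ⁅e A i, f A j⁆ = if i = j then h A i else 0 := by
  split_ifs with hij
  · subst hij; rw [lie_e_f_same]
  · rw [lie_e_f_ne A hij]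

theorem ad_smul_pow {L : Type*} [LieRing L] [LieAlgebra ℂ L] (a : ℂ) (x y : L) (n : ℕ) :
    ((LieAlgebra.ad ℂ L (a • x)) ^ n) y = a ^ n • ((LieAlgebra.ad ℂ L x) ^ n) y := by
  rw [map_smul, smul_pow, LinearMap.smul_apply]

end Homs

/-! ### The root space decomposition. -/

section Grading

variable {I : Type*} [Fintype I] [DecidableEq I] (A : Matrix I I ℤ)

/-- The endomorphism multiplying the root space of `β` by `2 ^ β k`. -/
def scale (k : I) : KM A →ₗ⁅ℂ⁆ KM A :=
  lift A (fun j => (2 : ℂ) ^ (simpleRoot j k) • e A j)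
    (fun j => (2 : ℂ) ^ (-simpleRoot j k) • f A j) (h A)
    (lie_h_h A)
    (by
      intro i
      rw [smul_lie, lie_smul, smul_smul, ← zpow_add₀ two_ne_zero, add_neg_cancel, zpow_zero,
        one_smul, lie_e_f_same])
    (by intro i j hij; rw [smul_lie, lie_smul, lie_e_f_ne A hij, smul_zero, smul_zero])
    (by intro i j; rw [lie_smul, lie_h_e, smul_comm])
    (by intro i j; rw [lie_smul, lie_h_f, smul_neg, smul_comm])
    (by
      intro i j
      rw [smul_lie, lie_smul, map_smul, map_smul, ad_smul_pow, serre_e, smul_zero, smul_zero,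
        smul_zero])
    (by
      intro i j
      rw [smul_lie, lie_smul, map_smul, map_smul, ad_smul_pow, serre_f, smul_zero, smul_zero,
        smul_zero])

/-- The root space of weight `β` (for `β = 0`: the Cartan subalgebra). -/
def rootSpace (β : I → ℤ) : Submodule ℂ (KM A) :=
  ⨅ k, Module.End.eigenspace (scale A k : KM A →ₗ[ℂ] KM A) ((2 : ℂ) ^ β k)

variable {A}

theorem mem_rootSpace {β : I → ℤ} {x : KM A} :
    x ∈ rootSpace A β ↔ ∀ k, scale A k x = (2 : ℂ) ^ β k • x := by
  simp [rootSpace, Submodule.mem_iInf]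

theorem lie_mem_rootSpace {β γ : I → ℤ} {x y : KM A} (hx : x ∈ rootSpace A β)
    (hy : y ∈ rootSpace A γ) : ⁅x, y⁆ ∈ rootSpace A (β + γ) := by
  rw [mem_rootSpace] at *
  intro k
  rw [LieHom.map_lie, hx, hy, smul_lie, lie_smul, smul_smul, ← zpow_add₀ two_ne_zero, Pi.add_apply]

variable (A) in
theorem e_mem_rootSpace (j : I) : e A j ∈ rootSpace A (simpleRoot j) :=
  mem_rootSpace.2 fun _ => lift_e ..

variable (A) in
theorem f_mem_rootSpace (j : I) : f A j ∈ rootSpace A (-simpleRoot j) :=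
  mem_rootSpace.2 fun _ => lift_f ..

variable (A) in
theorem h_mem_rootSpace (j : I) : h A j ∈ rootSpace A 0 :=
  mem_rootSpace.2 fun _ => by
    rw [Pi.zero_apply, zpow_zero, one_smul]; exact lift_h ..

theorem commute_scale (i j : I) :
    Commute (scale A i : KM A →ₗ[ℂ] KM A) (scale A j : KM A →ₗ[ℂ] KM A) := by
  have he : ∀ i k, scale A i (e A k) = (2 : ℂ) ^ simpleRoot k i • e A k := fun i k => lift_e ..
  have hf : ∀ i k, scale A i (f A k) = (2 : ℂ) ^ (-simpleRoot k i) • f A k := fun i k => lift_f ..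
  have hh : ∀ i k, scale A i (h A k) = h A k := fun i k => lift_h ..
  have : (scale A i).comp (scale A j) = (scale A j).comp (scale A i) := by
    refine hom_ext (fun k => ?_) (fun k => ?_) (fun k => ?_)
    · rw [LieHom.comp_apply, LieHom.comp_apply, he, he, map_smul, map_smul, he, he,
        smul_comm]
    · rw [LieHom.comp_apply, LieHom.comp_apply, hf, hf, map_smul, map_smul, hf, hf,
        smul_comm]
    · rw [LieHom.comp_apply, LieHom.comp_apply, hh, hh, hh]
  exact LinearMap.ext fun x => congrArg (fun φ : KM A →ₗ⁅ℂ⁆ KM A => φ x) this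

/-- As `2` is not a root of unity, a weight is determined by its system of eigenvalues under the
maps `scale A k`. -/
theorem two_zpow_injective :
    Function.Injective fun (β : I → ℤ) (k : I) => (2 : ℂ) ^ β k := by
  intro β γ hβγ
  funext k
  have h2 : ((2 : ℝ) : ℂ) ^ β k = ((2 : ℝ) : ℂ) ^ γ k := by simpa using congrFun hβγ k
  have h3 : (2 : ℝ) ^ β k = (2 : ℝ) ^ γ k := by exact_mod_cast h2
  exact zpow_right_injective₀ (by norm_num) (by norm_num) h3

theorem iSupIndep_rootSpace : iSupIndep (rootSpace A) := by
  have h1 := Module.End.independent_iInf_maxGenEigenspace_of_forall_mapsTo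
    (fun k => (scale A k : KM A →ₗ[ℂ] KM A))
    (fun i j φ => Module.End.mapsTo_maxGenEigenspace_of_comm (commute_scale j i) φ)
  have h2 := iSupIndep.comp h1 (two_zpow_injective (I := I))
  refine iSupIndep.mono h2 fun β => ?_
  refine iInf_mono fun k => ?_
  exact Module.End.eigenspace_le_maxGenEigenspace

/-- The weight of a word. -/
def wordWeight (w : List I) : I → ℤ := (w.map simpleRoot).sum

theorem wordWeight_cons (i : I) (w : List I) :
    wordWeight (i :: w) = simpleRoot i + wordWeight w := by
  simp [wordWeight]

theorem wordWeight_singleton (i : I) : wordWeight [i] = simpleRoot i := by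
  simp [wordWeight]

theorem wordWeight_apply (w : List I) (k : I) : wordWeight w k = w.count k := by
  induction w with
  | nil => simp [wordWeight]
  | cons i w ih =>
    rw [wordWeight_cons, Pi.add_apply, ih, List.count_cons, simpleRoot, Pi.single_apply]
    by_cases hik : i = k
    · subst hik; simp [add_comm]
    · simp [hik, Ne.symm hik]

theorem iterBracket_mem_rootSpace {x : I → KM A} (φ : (I → ℤ) →+ (I → ℤ))
    (hx : ∀ i, x i ∈ rootSpace A (φ (simpleRoot i))) {w : List I} (hw : w ≠ []) :
    iterBracket x w ∈ rootSpace A (φ (wordWeight w)) := by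
  induction w, hw using word_induction with
  | single i => rw [wordWeight_singleton]; exact hx i
  | cons i w hw ih =>
    rw [iterBracket_cons _ _ hw, wordWeight_cons, map_add]
    exact lie_mem_rootSpace (hx i) ih

theorem iterBracket_e_mem_rootSpace {w : List I} (hw : w ≠ []) :
    iterBracket (e A) w ∈ rootSpace A (wordWeight w) :=
  iterBracket_mem_rootSpace (AddMonoidHom.id _) (e_mem_rootSpace A) hw

theorem iterBracket_f_mem_rootSpace {w : List I} (hw : w ≠ []) :
    iterBracket (f A) w ∈ rootSpace A (-wordWeight w) :=
  iterBracket_mem_rootSpace (-AddMonoidHom.id _) (f_mem_rootSpace A) hw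

variable (A) in
/-- The monomials `e_w`, `h_i`, `f_w` of weight `μ`. -/
def monomials (μ : I → ℤ) : Set (KM A) :=
  {x | (∃ w, w ≠ [] ∧ wordWeight w = μ ∧ iterBracket (e A) w = x) ∨
    (μ = 0 ∧ x ∈ Set.range (h A)) ∨
    (∃ w, w ≠ [] ∧ -wordWeight w = μ ∧ iterBracket (f A) w = x)}

variable (A) in
-- Triangular decomposition: the span of the brackets of the `e_i`, the `h_i` and the brackets of
-- the `f_i` is stable under `ad` of every generator, hence is everything.
theorem iSup_span_monomials : ⨆ μ, Submodule.span ℂ (monomials A μ) = ⊤ := by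
  set V := ⨆ μ, Submodule.span ℂ (monomials A μ)
  have hm : ∀ μ, ∀ x ∈ monomials A μ, x ∈ V := fun μ x hx =>
    Submodule.mem_iSup_of_mem μ (Submodule.subset_span hx)
  have hVe : ∀ w, w ≠ [] → iterBracket (e A) w ∈ V :=
    fun w hw => hm _ _ (Or.inl ⟨w, hw, rfl, rfl⟩)
  have hVf : ∀ w, w ≠ [] → iterBracket (f A) w ∈ V :=
    fun w hw => hm _ _ (Or.inr (Or.inr ⟨w, hw, rfl, rfl⟩))
  have hVh : ∀ i, h A i ∈ V := fun i => hm 0 _ (Or.inr (Or.inl ⟨rfl, i, rfl⟩))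
  have hVe' : ∀ i, e A i ∈ V := fun i => hVe [i] (by simp)
  have hVf' : ∀ i, f A i ∈ V := fun i => hVf [i] (by simp)
  let S : Set (KM A) := Set.range (e A) ∪ Set.range (f A) ∪ Set.range (h A)
  have hspan : V = Submodule.span ℂ
      (iterBracket (e A) '' {w | w ≠ []} ∪ Set.range (h A) ∪
        iterBracket (f A) '' {w | w ≠ []}) := by
    apply le_antisymm
    · refine iSup_le fun μ => Submodule.span_mono ?_
      rintro x (⟨w, hw, -, rfl⟩ | ⟨-, hx⟩ | ⟨w, hw, -, rfl⟩)
      · exact Or.inl (Or.inl ⟨w, hw, rfl⟩)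
      · exact Or.inl (Or.inr hx)
      · exact Or.inr ⟨w, hw, rfl⟩
    · refine Submodule.span_le.2 ?_
      rintro x ((⟨w, hw, rfl⟩ | ⟨i, rfl⟩) | ⟨w, hw, rfl⟩)
      · exact hVe w hw
      · exact hVh i
      · exact hVf w hw
  have hef : ∀ i j, ⁅e A i, f A j⁆ ∈ Submodule.span ℂ (Set.range (h A)) := by
    intro i j
    rw [lie_e_f]
    split_ifs
    · exact Submodule.subset_span ⟨i, rfl⟩
    · exact Submodule.zero_mem _
  have hfe : ∀ i j, ⁅f A i, e A j⁆ ∈ Submodule.span ℂ (Set.range (h A)) := by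
    intro i j
    rw [lie_f_e]
    split_ifs
    · exact Submodule.neg_mem _ (Submodule.subset_span ⟨i, rfl⟩)
    · exact Submodule.zero_mem _
  have hS : (LieSubalgebra.lieSpan ℂ (KM A) S).toSubmodule ≤ V := by
    refine lieSpan_le_of_stable ?_ ?_
    · rintro x ((⟨i, rfl⟩ | ⟨i, rfl⟩) | ⟨i, rfl⟩)
      exacts [hVe' i, hVf' i, hVh i]
    · intro s hs v hv
      rw [hspan] at hv
      refine lie_mem_of_mem_span ?_ hv
      rintro x ((⟨w, hw, rfl⟩ | ⟨j, rfl⟩) | ⟨w, hw, rfl⟩) <;>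
      rcases hs with ((⟨i, rfl⟩ | ⟨i, rfl⟩) | ⟨i, rfl⟩)
      · rw [← iterBracket_cons _ _ hw]; exact hVe _ (by simp)
      · rw [hspan]
        refine Submodule.span_mono ?_ (lie_iterBracket_mem hfe (lie_h_e_complex A) i hw)
        rintro x (hx | hx)
        exacts [Or.inl (Or.inr hx), Or.inl (Or.inl hx)]
      · rw [lie_iterBracket_of_eigen (lie_h_e_complex A i) hw]
        exact V.smul_mem _ (hVe w hw)
      · rw [← lie_skew, lie_h_e_complex]
        exact V.neg_mem (V.smul_mem _ (hVe' i))
      · rw [← lie_skew, lie_h_f_complex]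
        exact V.neg_mem (V.smul_mem _ (hVf' i))
      · rw [lie_h_h]; exact V.zero_mem
      · rw [hspan]
        refine Submodule.span_mono ?_ (lie_iterBracket_mem hef (lie_h_f_complex A) i hw)
        rintro x (hx | hx)
        exacts [Or.inl (Or.inr hx), Or.inr hx]
      · rw [← iterBracket_cons _ _ hw]; exact hVf _ (by simp)
      · rw [lie_iterBracket_of_eigen (lie_h_f_complex A i) hw]
        exact V.smul_mem _ (hVf w hw)
  refine eq_top_iff.2 fun x _ => hS ?_
  refine mem_of_generators A _ (fun i => ?_) (fun i => ?_) (fun i => ?_) x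
  · exact LieSubalgebra.subset_lieSpan (Or.inl (Or.inl ⟨i, rfl⟩))
  · exact LieSubalgebra.subset_lieSpan (Or.inl (Or.inr ⟨i, rfl⟩))
  · exact LieSubalgebra.subset_lieSpan (Or.inr ⟨i, rfl⟩)

theorem span_monomials_le (μ : I → ℤ) : Submodule.span ℂ (monomials A μ) ≤ rootSpace A μ := by
  refine Submodule.span_le.2 ?_
  rintro x (⟨w, hw, rfl, rfl⟩ | ⟨rfl, i, rfl⟩ | ⟨w, hw, rfl, rfl⟩)
  · exact iterBracket_e_mem_rootSpace hw
  · exact h_mem_rootSpace A i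
  · exact iterBracket_f_mem_rootSpace hw

/-- The monomials span the whole algebra and each lies in one of the independent root spaces, so
those of weight `μ` already fill the root space of `μ`. -/
theorem rootSpace_eq_span (μ : I → ℤ) : rootSpace A μ = Submodule.span ℂ (monomials A μ) :=
  le_antisymm
    (fun x hx => mem_of_mem_iSup_of_iSupIndep iSupIndep_rootSpace span_monomials_le
      (by rw [iSup_span_monomials]; trivial) hx) (span_monomials_le μ)

theorem wordWeight_nonneg (w : List I) : 0 ≤ wordWeight w := by
  intro k
  rw [wordWeight_apply]
  exact Int.natCast_nonneg _

theorem wordWeight_eq_zero {w : List I} (hw : wordWeight w = 0) : w = [] := by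
  refine List.eq_nil_iff_forall_not_mem.2 fun k hk => ?_
  have := congrFun hw k
  rw [wordWeight_apply] at this
  have h2 := List.count_pos_iff.2 hk
  simp at this
  omega

/-- No monomial has a weight with coordinates of both signs. Most vanishing statements about Serre
elements reduce to this. -/
theorem eq_zero_of_mixed {μ : I → ℤ} {x : KM A} (hx : x ∈ rootSpace A μ) {i j : I} (hi : 0 < μ i)
    (hj : μ j < 0) : x = 0 := by
  rw [rootSpace_eq_span] at hx
  suffices monomials A μ = ∅ by simpa [this] using hx
  refine Set.eq_empty_iff_forall_notMem.2 ?_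
  rintro x (⟨w, hw, rfl, rfl⟩ | ⟨rfl, i, rfl⟩ | ⟨w, hw, rfl, rfl⟩)
  · exact absurd (wordWeight_nonneg w j) (not_le.2 hj)
  · exact absurd hi (lt_irrefl _)
  · have := wordWeight_nonneg w i
    simp at hi this
    omega

theorem mem_span_e_of_pos {μ : I → ℤ} {x : KM A} (hx : x ∈ rootSpace A μ) {i : I} (hi : 0 < μ i) :
    x ∈ Submodule.span ℂ (iterBracket (e A) '' {w | w ≠ [] ∧ wordWeight w = μ}) := by
  rw [rootSpace_eq_span] at hx
  refine Submodule.span_mono ?_ hx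
  rintro x (⟨w, hw, h1, rfl⟩ | ⟨rfl, -⟩ | ⟨w, hw, rfl, rfl⟩)
  · exact ⟨w, ⟨hw, h1⟩, rfl⟩
  · exact absurd hi (lt_irrefl _)
  · have := wordWeight_nonneg w i
    simp at hi this
    omega

theorem mem_span_f_of_neg {μ : I → ℤ} {x : KM A} (hx : x ∈ rootSpace A μ) {i : I} (hi : μ i < 0) :
    x ∈ Submodule.span ℂ (iterBracket (f A) '' {w | w ≠ [] ∧ -wordWeight w = μ}) := by
  rw [rootSpace_eq_span] at hx
  refine Submodule.span_mono ?_ hx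
  rintro x (⟨w, hw, rfl, rfl⟩ | ⟨rfl, -⟩ | ⟨w, hw, h1, rfl⟩)
  · exact absurd (wordWeight_nonneg w i) (not_le.2 hi)
  · exact absurd hi (lt_irrefl _)
  · exact ⟨w, ⟨hw, h1⟩, rfl⟩

theorem nPlus_eq_span (X : Finset I) : (nPlus A X).toSubmodule =
    Submodule.span ℂ (iterBracket (e A) '' {w | w ≠ [] ∧ ∀ i ∈ w, i ∈ (X : Set I)}) :=
  lieSpan_image_eq_span _ _

/-- Root vectors of positive weight supported on `X` belong to `𝔫⁺_X`. -/
theorem mem_nPlus_of_support {μ : I → ℤ} {x : KM A} (hx : x ∈ rootSpace A μ) {i : I} (hi : 0 < μ i)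
    {X : Finset I} (hX : ∀ k ∉ X, μ k = 0) : x ∈ nPlus A X := by
  have : x ∈ (nPlus A X).toSubmodule := by
    rw [nPlus_eq_span]
    refine Submodule.span_mono ?_ (mem_span_e_of_pos hx hi)
    refine Set.image_mono ?_
    rintro w ⟨hw, rfl⟩
    refine ⟨hw, fun k hk => ?_⟩
    by_contra hkX
    have h1 := hX k hkX
    rw [wordWeight_apply] at h1
    have h2 := List.count_pos_iff.2 hk
    omega
  exact this

/-- A word whose weight is a multiple of a simple root has only one letter. -/
theorem eq_replicate_of_wordWeight {w : List I} {j : I} (hw : ∀ k, k ≠ j → wordWeight w k = 0) :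
    w = List.replicate w.length j := by
  refine List.eq_replicate_iff.2 ⟨rfl, fun k hk => ?_⟩
  by_contra hkj
  have h1 := hw k hkj
  rw [wordWeight_apply] at h1
  have h2 := List.count_pos_iff.2 hk
  omega

theorem mem_rootSpace_simpleRoot {x : KM A} {j : I} (hx : x ∈ rootSpace A (simpleRoot j)) :
    ∃ a : ℂ, x = a • e A j := by
  have h1 := mem_span_e_of_pos hx (i := j) (by simp [simpleRoot])
  have h2 : x ∈ Submodule.span ℂ {e A j} := by
    refine Submodule.span_mono ?_ h1
    rintro _ ⟨w, ⟨hw, hwt⟩, rfl⟩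
    have h3 := eq_replicate_of_wordWeight (w := w) (j := j) (by
      intro k hk; rw [hwt]; simp [simpleRoot, hk])
    have h4 := congrFun hwt j
    rw [wordWeight_apply, h3, List.count_replicate_self] at h4
    have h5 : w.length = 1 := by simpa [simpleRoot] using h4
    rw [h3, h5]; rfl
  obtain ⟨a, ha⟩ := Submodule.mem_span_singleton.1 h2
  exact ⟨a, ha.symm⟩

theorem mem_rootSpace_neg_simpleRoot {x : KM A} {j : I} (hx : x ∈ rootSpace A (-simpleRoot j)) :
    ∃ a : ℂ, x = a • f A j := by
  have h1 := mem_span_f_of_neg hx (i := j) (by simp [simpleRoot])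
  have h2 : x ∈ Submodule.span ℂ {f A j} := by
    refine Submodule.span_mono ?_ h1
    rintro _ ⟨w, ⟨hw, hwt⟩, rfl⟩
    have hwt := neg_injective hwt
    have h3 := eq_replicate_of_wordWeight (w := w) (j := j) (by
      intro k hk; rw [hwt]; simp [simpleRoot, hk])
    have h4 := congrFun hwt j
    rw [wordWeight_apply, h3, List.count_replicate_self] at h4
    have h5 : w.length = 1 := by simpa [simpleRoot] using h4
    rw [h3, h5]; rfl
  obtain ⟨a, ha⟩ := Submodule.mem_span_singleton.1 h2
  exact ⟨a, ha.symm⟩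

/-- `kα_j` is not a root for `k ≥ 2`. -/
theorem eq_zero_of_two_le {μ : I → ℤ} {x : KM A} {j : I} (hx : x ∈ rootSpace A μ)
    (hμ : ∀ k, k ≠ j → μ k = 0) (hj : 2 ≤ μ j) : x = 0 := by
  have h1 := mem_span_e_of_pos hx (i := j) (by omega)
  have h2 : x ∈ Submodule.span ℂ {(0 : KM A)} := by
    refine Submodule.span_mono ?_ h1
    rintro _ ⟨w, ⟨hw, rfl⟩, rfl⟩
    have h3 := eq_replicate_of_wordWeight hμ
    rw [wordWeight_apply, h3, List.count_replicate_self] at hj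
    obtain ⟨n, hn⟩ := Nat.exists_eq_add_of_le' (show 2 ≤ w.length by omega)
    rw [h3, hn, iterBracket_replicate]; rfl
  simpa using h2

/-- `-kα_j` is not a root for `k ≥ 2`. -/
theorem eq_zero_of_le_neg_two {μ : I → ℤ} {x : KM A} {j : I} (hx : x ∈ rootSpace A μ)
    (hμ : ∀ k, k ≠ j → μ k = 0) (hj : μ j ≤ -2) : x = 0 := by
  have h1 := mem_span_f_of_neg hx (i := j) (by omega)
  have h2 : x ∈ Submodule.span ℂ {(0 : KM A)} := by
    refine Submodule.span_mono ?_ h1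
    rintro _ ⟨w, ⟨hw, rfl⟩, rfl⟩
    have h3 := eq_replicate_of_wordWeight (w := w) (j := j) (fun k hk => by simpa using hμ k hk)
    rw [Pi.neg_apply, wordWeight_apply, h3, List.count_replicate_self] at hj
    obtain ⟨n, hn⟩ := Nat.exists_eq_add_of_le' (show 2 ≤ w.length by omega)
    rw [h3, hn, iterBracket_replicate]; rfl
  simpa using h2

/-- The root space of `α_i + α_j` is spanned by `[e_j, e_i]`. -/
theorem mem_rootSpace_add {x : KM A} {i j : I} (hij : i ≠ j)
    (hx : x ∈ rootSpace A (simpleRoot i + simpleRoot j)) : ∃ a : ℂ, x = a • ⁅e A j, e A i⁆ := by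
  have h1 := mem_span_e_of_pos hx (i := i) (by simp [simpleRoot, hij])
  have h2 : x ∈ Submodule.span ℂ {⁅e A j, e A i⁆} := by
    refine (Submodule.span_le (p := Submodule.span ℂ {⁅e A j, e A i⁆}).2 ?_) h1
    rintro _ ⟨w, ⟨hw, hwt⟩, rfl⟩
    match w, hw, hwt with
    | [a], _, hwt =>
      exfalso
      rw [wordWeight_singleton] at hwt
      have hi := congrFun hwt i
      have hj := congrFun hwt j
      simp [simpleRoot, Pi.single_apply, hij, hij.symm] at hi hj
      exact hij (hi.trans hj.symm)
    | a :: b :: w, _, hwt =>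
      rw [wordWeight_cons] at hwt
      have hmem : a = i ∨ a = j := by
        by_contra! hne
        have h3 := congrFun hwt a
        have h4 := wordWeight_nonneg (b :: w) a
        simp [simpleRoot, hne.1, hne.2] at h3 h4
        omega
      have hone : ∀ c, wordWeight (b :: w) = simpleRoot c → b = c ∧ w = [] := by
        intro c hc
        rw [wordWeight_cons] at hc
        have h3 := congrFun hc b
        have h4 := wordWeight_nonneg w b
        have hbc : b = c := by
          by_contra hne
          simp [simpleRoot, hne] at h3 h4
          omega
        subst hbc
        exact ⟨rfl, wordWeight_eq_zero (by simpa using hc)⟩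
      rcases hmem with rfl | rfl
      · obtain ⟨rfl, rfl⟩ := hone j (by simpa using hwt)
        show ⁅e A a, e A b⁆ ∈ Submodule.span ℂ {⁅e A b, e A a⁆}
        rw [← lie_skew (e A a) (e A b)]
        exact Submodule.neg_mem (Submodule.span ℂ {⁅e A b, e A a⁆})
          (Submodule.mem_span_singleton_self ⁅e A b, e A a⁆)
      · obtain ⟨rfl, rfl⟩ := hone i (by rw [add_comm] at hwt; simpa using hwt)
        exact Submodule.mem_span_singleton_self _
  obtain ⟨a, ha⟩ := Submodule.mem_span_singleton.1 h2
  exact ⟨a, ha.symm⟩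

theorem sum_map_eq_mulVec (i : I) (w : List I) :
    (w.map fun j => (A i j : ℂ)).sum = ((A.mulVec (wordWeight w) i : ℤ) : ℂ) := by
  induction w with
  | nil => simp [wordWeight]
  | cons j w ih =>
    rw [wordWeight_cons, Matrix.mulVec_add, List.map_cons, List.sum_cons, ih, simpleRoot,
      Matrix.mulVec_single_one]
    simp

theorem lie_h_of_mem_rootSpace {μ : I → ℤ} {x : KM A} (hx : x ∈ rootSpace A μ) (i : I) :
    ⁅h A i, x⁆ = ((A.mulVec μ i : ℤ) : ℂ) • x := by
  rw [rootSpace_eq_span] at hx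
  induction hx using Submodule.span_induction with
  | mem x hx =>
    rcases hx with ⟨w, hw, rfl, rfl⟩ | ⟨rfl, j, rfl⟩ | ⟨w, hw, rfl, rfl⟩
    · rw [lie_iterBracket_of_eigen (lie_h_e_complex A i) hw, sum_map_eq_mulVec]
    · simp [lie_h_h]
    · rw [lie_iterBracket_of_eigen (lie_h_f_complex A i) hw, Matrix.mulVec_neg, Pi.neg_apply,
        Int.cast_neg, ← sum_map_eq_mulVec]
      congr 1
      induction w with
      | nil => simp
      | cons j w ih => by_cases hw' : w = [] <;> simp_all [add_comm]
  | zero => simp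
  | add x y _ _ hx hy => rw [lie_add, hx, hy, smul_add]
  | smul a x _ hx => rw [lie_smul, hx, smul_comm]

/-- Root spaces are spanned by monomials, so the effect of a homomorphism on weights is decided on
generators. -/
theorem map_mem_rootSpace (ψ : KM A →ₗ⁅ℂ⁆ KM A) (φ : (I → ℤ) →+ (I → ℤ))
    (he : ∀ i, ψ (e A i) ∈ rootSpace A (φ (simpleRoot i)))
    (hf : ∀ i, ψ (f A i) ∈ rootSpace A (-φ (simpleRoot i)))
    (hh : ∀ i, ψ (h A i) ∈ rootSpace A 0) {μ : I → ℤ} {x : KM A} (hx : x ∈ rootSpace A μ) :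
    ψ x ∈ rootSpace A (φ μ) := by
  rw [rootSpace_eq_span] at hx
  have : Submodule.span ℂ (monomials A μ) ≤
      (rootSpace A (φ μ)).comap (ψ : KM A →ₗ[ℂ] KM A) := by
    refine Submodule.span_le.2 ?_
    rintro x (⟨w, hw, rfl, rfl⟩ | ⟨rfl, j, rfl⟩ | ⟨w, hw, rfl, rfl⟩)
    · show ψ (iterBracket _ w) ∈ rootSpace A _
      rw [map_iterBracket (map_zero ψ) (LieHom.map_lie ψ)]
      exact iterBracket_mem_rootSpace φ he hw
    · rw [map_zero]; exact hh j
    · show ψ (iterBracket _ w) ∈ rootSpace A _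
      rw [map_iterBracket (map_zero ψ) (LieHom.map_lie ψ), map_neg]
      exact iterBracket_mem_rootSpace (-φ) hf hw
  exact this hx

end Grading

/-! ### Exponentials of locally nilpotent inner derivations. -/

section Exp

theorem pow_apply_eq_zero_of_le {V : Type*} [AddCommGroup V] [Module ℂ V] {D : Module.End ℂ V}
    {x : V} {n m : ℕ} (hn : (D ^ n) x = 0) (hnm : n ≤ m) : (D ^ m) x = 0 := by
  obtain ⟨k, rfl⟩ := Nat.exists_eq_add_of_le hnm
  rw [add_comm, pow_add, Module.End.mul_apply, hn, map_zero]

theorem expLocNilp_apply {V : Type*} [AddCommGroup V] [Module ℂ V] (D : Module.End ℂ V)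
    (hD : ∀ x, ∃ n : ℕ, (D ^ n) x = 0) {x : V} {n : ℕ} (hn : (D ^ n) x = 0) :
    expLocNilp D hD x = ∑ k ∈ Finset.range n, ((k.factorial : ℂ)⁻¹) • (D ^ k) x := by
  refine finsum_eq_sum_of_support_subset _ fun k hk => ?_
  by_contra hkn
  refine hk ?_
  have hkn' : n ≤ k := by simpa using hkn
  show ((k.factorial : ℂ)⁻¹) • (D ^ k) x = 0
  rw [pow_apply_eq_zero_of_le hn hkn', smul_zero]

variable {L : Type*} [LieRing L] [LieAlgebra ℂ L]

theorem ad_pow_lie (u x y : L) (n : ℕ) :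
    ((LieAlgebra.ad ℂ L u) ^ n) ⁅x, y⁆ = ∑ p ∈ Finset.HasAntidiagonal.antidiagonal n, n.choose p.1 •
      ⁅((LieAlgebra.ad ℂ L u) ^ p.1) x, ((LieAlgebra.ad ℂ L u) ^ p.2) y⁆ := by
  have := LieDerivation.iterate_apply_lie (LieDerivation.ad ℂ L u) n x y
  have hu : ⇑(LieDerivation.ad ℂ L u) = ⇑(LieAlgebra.ad ℂ L u) := by
    funext v
    simp
  simp only [Module.End.pow_apply]
  rwa [hu] at this

/-- The exponential of a locally nilpotent inner derivation is multiplicative. -/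
theorem expLocNilp_lie (u : L) (hu : ∀ x, ∃ n : ℕ, ((LieAlgebra.ad ℂ L u) ^ n) x = 0) (x y : L) :
    expLocNilp _ hu ⁅x, y⁆ = ⁅expLocNilp _ hu x, expLocNilp _ hu y⁆ := by
  set D := LieAlgebra.ad ℂ L u with hDdef
  obtain ⟨a, ha⟩ := hu x
  obtain ⟨b, hb⟩ := hu y
  -- From `N` on, the powers of `D` kill both `x` and `y`; so every series is finite, and the
  -- product over a square can be regrouped along antidiagonals below `N + N`.
  set N := a + b
  have hxN : ∀ k, N ≤ k → (D ^ k) x = 0 :=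
    fun k hk => pow_apply_eq_zero_of_le ha (le_trans (Nat.le_add_right a b) hk)
  have hyN : ∀ k, N ≤ k → (D ^ k) y = 0 :=
    fun k hk => pow_apply_eq_zero_of_le hb (le_trans (Nat.le_add_left b a) hk)
  let F : ℕ × ℕ → L := fun p =>
    ((p.1.factorial : ℂ)⁻¹ * (p.2.factorial : ℂ)⁻¹) • ⁅(D ^ p.1) x, (D ^ p.2) y⁆
  have hterm : ∀ n, ((n.factorial : ℂ)⁻¹) • (D ^ n) ⁅x, y⁆ =
      ∑ p ∈ Finset.HasAntidiagonal.antidiagonal n, F p := by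
    intro n
    rw [hDdef, ad_pow_lie, Finset.smul_sum]
    refine Finset.sum_congr rfl fun p hp => ?_
    have hp' := Finset.HasAntidiagonal.mem_antidiagonal.1 hp
    rw [← Nat.cast_smul_eq_nsmul ℂ, smul_smul]
    congr 1
    have h1 : (((p.1 + p.2).choose p.1 : ℕ) : ℂ) * p.1.factorial * p.2.factorial =
        (p.1 + p.2).factorial := by 
      rw [Nat.choose_symm_add]
      exact_mod_cast Nat.add_choose_mul_factorial_mul_factorial p.1 p.2
    have h2 : ((p.1 + p.2).factorial : ℂ) ≠ 0 := Nat.cast_ne_zero.2 (Nat.factorial_ne_zero _)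
    have h3 : (p.1.factorial : ℂ) ≠ 0 := Nat.cast_ne_zero.2 (Nat.factorial_ne_zero _)
    have h4 : (p.2.factorial : ℂ) ≠ 0 := Nat.cast_ne_zero.2 (Nat.factorial_ne_zero _)
    rw [← hp']
    field_simp
    linear_combination h1
  have hzero : ∀ p : ℕ × ℕ, (N ≤ p.1 ∨ N ≤ p.2) → F p = 0 := by
    rintro p (hp | hp)
    · simp [F, hxN _ hp]
    · simp [F, hyN _ hp]
  have hxy : (D ^ (N + N)) ⁅x, y⁆ = 0 := by
    have h1 := hterm (N + N)
    rw [Finset.sum_eq_zero (fun p hp => hzero p (by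
      have := Finset.HasAntidiagonal.mem_antidiagonal.1 hp; omega))] at h1
    exact (smul_eq_zero.1 h1).resolve_left
      (inv_ne_zero (Nat.cast_ne_zero.2 (Nat.factorial_ne_zero _)))
  rw [expLocNilp_apply _ _ hxy, expLocNilp_apply _ _ (hxN N le_rfl),
    expLocNilp_apply _ _ (hyN N le_rfl), Finset.sum_congr rfl fun n _ => hterm n]
  have hrhs : ⁅∑ k ∈ Finset.range N, ((k.factorial : ℂ)⁻¹) • (D ^ k) x,
      ∑ k ∈ Finset.range N, ((k.factorial : ℂ)⁻¹) • (D ^ k) y⁆ =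
      ∑ p ∈ Finset.range N ×ˢ Finset.range N, F p := by
    rw [sum_lie_sum, Finset.sum_product]
    refine Finset.sum_congr rfl fun i _ => Finset.sum_congr rfl fun j _ => ?_
    rw [smul_lie, lie_smul, smul_smul]
  rw [hrhs, ← Finset.sum_fiberwise_of_maps_to (t := Finset.range (N + N)) (g := fun p : ℕ × ℕ => p.1 + p.2)
    (by intro p hp; simp only [Finset.mem_product, Finset.mem_range] at hp ⊢; omega)]
  refine Finset.sum_congr rfl fun n _ => (Finset.sum_subset ?_ ?_).symm
  · intro p hp
    exact Finset.HasAntidiagonal.mem_antidiagonal.2 (Finset.mem_filter.1 hp).2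
  · intro p hp hp'
    refine hzero p ?_
    by_contra! hlt
    exact hp' (Finset.mem_filter.2 ⟨by simpa using hlt,
      Finset.HasAntidiagonal.mem_antidiagonal.1 hp⟩)

theorem expLocNilp_mem {V : Type*} [AddCommGroup V] [Module ℂ V] {D : Module.End ℂ V}
    (hD : ∀ x, ∃ n : ℕ, (D ^ n) x = 0) {U : Submodule ℂ V} (hU : ∀ x ∈ U, D x ∈ U) {x : V}
    (hx : x ∈ U) : expLocNilp D hD x ∈ U := by
  obtain ⟨n, hn⟩ := hD x
  rw [expLocNilp_apply D hD hn]
  refine U.sum_mem fun k _ => U.smul_mem _ ?_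
  clear * - hx hU
  induction k with
  | zero => exact hx
  | succ k ih => rw [pow_succ']; exact hU _ ih

end Exp

/-! ### The operators `Ad(m_i)` and the simple reflections. -/

section AdM

variable {I : Type*} [Fintype I] [DecidableEq I] {A : Matrix I I ℤ}

theorem AdM_lie (i : I) (x y : KM A) : AdM A i ⁅x, y⁆ = ⁅AdM A i x, AdM A i y⁆ := by
  simp only [AdM, Module.End.mul_apply, expLocNilp_lie]

theorem AdM_eq_self {i : I} {x : KM A} (he : ⁅e A i, x⁆ = 0) (hf : ⁅f A i, x⁆ = 0) :
    AdM A i x = x := by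
  have h1 : expLocNilp (LieAlgebra.ad ℂ (KM A) (e A i)) (ad_e_locNilp A i) x = x := by
    rw [expLocNilp_apply _ _ (n := 1) (by simpa using he)]
    simp
  have h2 : expLocNilp (LieAlgebra.ad ℂ (KM A) (-f A i)) (ad_neg_f_locNilp A i) x = x := by
    rw [expLocNilp_apply _ _ (n := 1) (by rw [pow_one, LieAlgebra.ad_apply, neg_lie, hf, neg_zero])]
    simp
  rw [AdM, Module.End.mul_apply, Module.End.mul_apply, h1, h2, h1]

theorem AdM_h_self (hA : ∀ i, A i i = 2) (i : I) : AdM A i (h A i) = -h A i := by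
  have heh : ⁅e A i, h A i⁆ = (-2 : ℂ) • e A i := by
    rw [← lie_skew, lie_h_e_complex, hA, ← neg_smul]; norm_num
  have hfh : ⁅f A i, h A i⁆ = (2 : ℂ) • f A i := by
    rw [← lie_skew, lie_h_f_complex, hA, ← neg_smul]; norm_num
  have hfe : ⁅f A i, e A i⁆ = -h A i := by rw [lie_f_e, if_pos rfl]
  have e1 : expLocNilp (LieAlgebra.ad ℂ (KM A) (e A i)) (ad_e_locNilp A i) (h A i) =
      h A i + (-2 : ℂ) • e A i := by
    rw [expLocNilp_apply _ _ (n := 2) (by simp [pow_two, heh])]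
    simp [Finset.sum_range_succ, heh]
  have e2 : expLocNilp (LieAlgebra.ad ℂ (KM A) (e A i)) (ad_e_locNilp A i) (e A i) = e A i := by
    rw [expLocNilp_apply _ _ (n := 1) (by simp)]
    simp
  have f1 : expLocNilp (LieAlgebra.ad ℂ (KM A) (-f A i)) (ad_neg_f_locNilp A i) (h A i) =
      h A i - (2 : ℂ) • f A i := by
    rw [expLocNilp_apply _ _ (n := 2) (by simp [pow_two, hfh])]
    simp [Finset.sum_range_succ, hfh, sub_eq_add_neg]
  have f2 : expLocNilp (LieAlgebra.ad ℂ (KM A) (-f A i)) (ad_neg_f_locNilp A i) (e A i) =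
      e A i + h A i - f A i := by
    rw [expLocNilp_apply _ _ (n := 3) (by simp [pow_succ, hfh, hfe])]
    simp [Finset.sum_range_succ, pow_two, hfh, hfe, sub_eq_add_neg, Nat.factorial]
  rw [AdM, Module.End.mul_apply, Module.End.mul_apply, e1, map_add, map_smul, f1, f2]
  have : h A i - (2 : ℂ) • f A i + (-2 : ℂ) • (e A i + h A i - f A i) =
      -h A i + (-2 : ℂ) • e A i := by module
  rw [this, map_add, map_smul, map_neg, e1, e2]
  module

theorem AdM_h (hA : ∀ i, A i i = 2) (i j : I) : AdM A i (h A j) = h A j - (A j i : ℂ) • h A i := by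
  -- This is the component of `h_j` that commutes with `e_i` and `f_i`, hence is fixed; the
  -- remaining multiple of `h_i` changes sign.
  have h1 : AdM A i (h A j - ((A j i : ℂ) / 2) • h A i) = h A j - ((A j i : ℂ) / 2) • h A i := by
    apply AdM_eq_self
    · rw [lie_sub, lie_smul, ← lie_skew, lie_h_e_complex, ← lie_skew (e A i) (h A i),
        lie_h_e_complex, hA]
      push_cast
      module
    · rw [lie_sub, lie_smul, ← lie_skew, lie_h_f_complex, ← lie_skew (f A i) (h A i),
        lie_h_f_complex, hA]
      push_cast
      module
  rw [map_sub, map_smul, AdM_h_self hA, sub_eq_iff_eq_add] at h1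
  rw [h1]
  module

theorem simpleReflection_apply (i : I) (β : I → ℤ) :
    simpleReflection A i β = β - (A.mulVec β i) • simpleRoot i := by
  simp [simpleReflection]

/-- The exponentials preserve the `α_i`-string through `β`, on which `ad h_i` has the distinct
eigenvalues `⟨β, h_i⟩ + 2k`. Since `Ad(m_i)` negates `h_i`, the image has eigenvalue `-⟨β, h_i⟩`,
which forces `k = -⟨β, h_i⟩`: the weight is `r_i β`. -/
theorem AdM_mem_rootSpace (hA : ∀ i, A i i = 2) (i : I) {β : I → ℤ} {x : KM A} (hx : x ∈ rootSpace A β) :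
    AdM A i x ∈ rootSpace A (simpleReflection A i β) := by
  let U : ℤ → Submodule ℂ (KM A) := fun k => rootSpace A (β + k • simpleRoot i)
  have hshift : ∀ (u : KM A) (s : ℤ), u ∈ rootSpace A (s • simpleRoot i) → ∀ y ∈ ⨆ k, U k,
      ⁅u, y⁆ ∈ ⨆ k, U k := by
    intro u s hu y hy
    have : (⨆ k, U k) ≤ (⨆ k, U k).comap (LieAlgebra.ad ℂ (KM A) u) := by
      refine iSup_le fun k y hy => Submodule.mem_iSup_of_mem (k + s) ?_
      have h1 := lie_mem_rootSpace hu hy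
      have h2 : s • simpleRoot i + (β + k • simpleRoot i) = β + (k + s) • simpleRoot i := by
        rw [add_smul]; abel
      rw [h2] at h1
      exact h1
    exact this hy
  have he : ∀ y ∈ ⨆ k, U k, ⁅e A i, y⁆ ∈ ⨆ k, U k :=
    hshift _ 1 (by rw [one_smul]; exact e_mem_rootSpace A i)
  have hf : ∀ y ∈ ⨆ k, U k, ⁅-f A i, y⁆ ∈ ⨆ k, U k :=
    hshift _ (-1) (by rw [neg_smul, one_smul]; exact Submodule.neg_mem _ (f_mem_rootSpace A i))
  have hxU : x ∈ ⨆ k, U k := Submodule.mem_iSup_of_mem 0 (by simpa [U] using hx)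
  have hmem : AdM A i x ∈ ⨆ k, U k :=
    expLocNilp_mem (ad_e_locNilp A i) he
      (expLocNilp_mem (ad_neg_f_locNilp A i) hf (expLocNilp_mem (ad_e_locNilp A i) he hxU))
  have heig : ⁅h A i, AdM A i x⁆ = (-(A.mulVec β i : ℤ) : ℂ) • AdM A i x := by
    have h1 : AdM A i ⁅h A i, x⁆ = ⁅AdM A i (h A i), AdM A i x⁆ := AdM_lie i _ _
    rw [lie_h_of_mem_rootSpace hx, map_smul, AdM_h_self hA, neg_lie] at h1
    rw [neg_smul, h1, neg_neg]
  have hinj : Function.Injective fun k : ℤ => ((A.mulVec β i : ℤ) : ℂ) + 2 * k := by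
    intro k k' hk
    have : (2 : ℂ) * k = 2 * k' := add_left_cancel hk
    exact_mod_cast mul_left_cancel₀ two_ne_zero this
  have hE := iSupIndep.comp (Module.End.eigenspaces_iSupIndep
    (LieAlgebra.ad ℂ (KM A) (h A i))) hinj
  have hle : ∀ k, U k ≤ Module.End.eigenspace (LieAlgebra.ad ℂ (KM A) (h A i))
      (((A.mulVec β i : ℤ) : ℂ) + 2 * k) := by
    intro k y hy
    rw [Module.End.mem_eigenspace_iff, LieAlgebra.ad_apply, lie_h_of_mem_rootSpace hy,
      Matrix.mulVec_add, Matrix.mulVec_smul, simpleRoot, Matrix.mulVec_single_one]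
    simp only [Pi.add_apply, Pi.smul_apply, Matrix.col_apply, hA, smul_eq_mul]
    push_cast
    rw [mul_comm]
  have key := mem_of_mem_iSup_of_iSupIndep hE hle hmem (k := -(A.mulVec β i)) (by
    rw [Function.comp_apply, Module.End.mem_eigenspace_iff, LieAlgebra.ad_apply, heig]
    push_cast
    congr 1
    ring)
  rw [simpleReflection_apply, sub_eq_add_neg, ← neg_smul]
  exact key

theorem AdWord_cons (i : I) (l : List I) (x : KM A) :
    AdWord A (i :: l) x = AdM A i (AdWord A l x) := by
  simp [AdWord]

theorem weylProd_cons (i : I) (l : List I) (β : I → ℤ) :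
    weylProd A (i :: l) β = simpleReflection A i (weylProd A l β) := by
  simp [weylProd]

theorem AdWord_nil (x : KM A) : AdWord A [] x = x := by
  simp [AdWord]

theorem weylProd_nil (β : I → ℤ) : weylProd A [] β = β := by
  simp [weylProd]

theorem AdWord_lie (l : List I) (x y : KM A) :
    AdWord A l ⁅x, y⁆ = ⁅AdWord A l x, AdWord A l y⁆ := by
  induction l with
  | nil => simp [AdWord_nil]
  | cons i l ih => simp [AdWord_cons, ih, AdM_lie]

theorem AdWord_mem_rootSpace (hA : ∀ i, A i i = 2) (l : List I) {β : I → ℤ} {x : KM A} (hx : x ∈ rootSpace A β) :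
    AdWord A l x ∈ rootSpace A (weylProd A l β) := by
  induction l with
  | nil => simpa [AdWord_nil, weylProd_nil] using hx
  | cons i l ih =>
    rw [AdWord_cons, weylProd_cons]
    exact AdM_mem_rootSpace hA i ih

/-- On `𝔥` the operator is a reflection, so it is its own inverse. The resulting injectivity of `θ`
on `𝔥` is what shows later that `θ(f_j)` and various scalars are nonzero. -/
theorem AdM_injOn_cartan (hA : ∀ i, A i i = 2) (i : I) {x : KM A} (hx : x ∈ cartan A) :
    AdM A i x ∈ cartan A ∧ AdM A i (AdM A i x) = x := by
  induction hx using Submodule.span_induction with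
  | mem x hx =>
    obtain ⟨j, rfl⟩ := hx
    have hm : ∀ j, h A j ∈ cartan A := fun j => Submodule.subset_span ⟨j, rfl⟩
    refine ⟨?_, ?_⟩
    · rw [AdM_h hA]
      exact Submodule.sub_mem _ (hm j) (Submodule.smul_mem _ _ (hm i))
    · rw [AdM_h hA, map_sub, map_smul, AdM_h_self hA, AdM_h hA]
      module
  | zero => simp
  | add x y _ _ hx hy =>
    exact ⟨by rw [map_add]; exact Submodule.add_mem _ hx.1 hy.1,
      by rw [map_add, map_add, hx.2, hy.2]⟩
  | smul a x _ hx =>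
    exact ⟨by rw [map_smul]; exact Submodule.smul_mem _ _ hx.1, by rw [map_smul, map_smul, hx.2]⟩

theorem AdWord_cartan (hA : ∀ i, A i i = 2) (l : List I) {x : KM A} (hx : x ∈ cartan A) :
    AdWord A l x ∈ cartan A ∧ (AdWord A l x = 0 → x = 0) := by
  induction l with
  | nil => simpa [AdWord_nil] using hx
  | cons i l ih =>
    have h1 := AdM_injOn_cartan hA i ih.1
    rw [AdWord_cons]
    refine ⟨h1.1, fun h0 => ih.2 ?_⟩
    rw [← h1.2, h0, map_zero]

end AdM

/-! ### The map `θ` and its action on weights. -/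

section Theta

variable {I : Type*} [Fintype I] [DecidableEq I] {A : Matrix I I ℤ}

theorem theta_apply (τ : Equiv.Perm I) (hτ : IsDiagramAut A τ) (l : List I) (x : KM A) :
    theta A τ hτ l x = AdWord A l (diagramHom A τ hτ (chevalley A x)) := rfl

theorem theta_lie (τ : Equiv.Perm I) (hτ : IsDiagramAut A τ) (l : List I) (x y : KM A) :
    theta A τ hτ l ⁅x, y⁆ = ⁅theta A τ hτ l x, theta A τ hτ l y⁆ := by
  simp only [theta_apply, LieHom.map_lie, AdWord_lie]

theorem theta_e (τ : Equiv.Perm I) (hτ : IsDiagramAut A τ) (l : List I) (j : I) :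
    theta A τ hτ l (e A j) = -AdWord A l (f A (τ j)) := by
  rw [theta_apply, chevalley_e, map_neg, map_neg, diagramHom_f]

theorem theta_f (τ : Equiv.Perm I) (hτ : IsDiagramAut A τ) (l : List I) (j : I) :
    theta A τ hτ l (f A j) = -AdWord A l (e A (τ j)) := by
  rw [theta_apply, chevalley_f, map_neg, map_neg, diagramHom_e]

theorem funLeft_simpleRoot (τ : Equiv.Perm I) (j : I) :
    LinearMap.funLeft ℤ ℤ τ.symm (simpleRoot j) = simpleRoot (τ j) := by
  funext k
  simp [LinearMap.funLeft_apply, simpleRoot, Pi.single_apply, Equiv.symm_apply_eq]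

theorem thetaRoot_simpleRoot (τ : Equiv.Perm I) (l : List I) (j : I) :
    thetaRoot A τ l (simpleRoot j) = -weylProd A l (simpleRoot (τ j)) := by
  simp [thetaRoot, funLeft_simpleRoot]

theorem theta_mem_rootSpace (hA : ∀ i, A i i = 2) (τ : Equiv.Perm I) (hτ : IsDiagramAut A τ)
    (l : List I) {β : I → ℤ} {x : KM A} (hx : x ∈ rootSpace A β) :
    theta A τ hτ l x ∈ rootSpace A (thetaRoot A τ l β) := by
  have h1 := map_mem_rootSpace (chevalley A) (-AddMonoidHom.id (I → ℤ))
    (fun i => by rw [chevalley_e]; exact Submodule.neg_mem _ (f_mem_rootSpace A i))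
    (fun i => by
      rw [chevalley_f]
      exact Submodule.neg_mem _ (by simpa using e_mem_rootSpace A i))
    (fun i => by rw [chevalley_h]; exact Submodule.neg_mem _ (h_mem_rootSpace A i)) hx
  have h2 := map_mem_rootSpace (diagramHom A τ hτ)
    (LinearMap.funLeft ℤ ℤ τ.symm : (I → ℤ) →ₗ[ℤ] (I → ℤ)).toAddMonoidHom
    (fun i => by
      rw [diagramHom_e]
      show _ ∈ rootSpace A (LinearMap.funLeft ℤ ℤ τ.symm (simpleRoot i))
      rw [funLeft_simpleRoot]
      exact e_mem_rootSpace A _)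
    (fun i => by
      rw [diagramHom_f]
      show _ ∈ rootSpace A (-LinearMap.funLeft ℤ ℤ τ.symm (simpleRoot i))
      rw [funLeft_simpleRoot]
      exact f_mem_rootSpace A _)
    (fun i => by rw [diagramHom_h]; exact h_mem_rootSpace A _) h1
  have h3 := AdWord_mem_rootSpace hA l h2
  have h4 : weylProd A l ((LinearMap.funLeft ℤ ℤ τ.symm : (I → ℤ) →ₗ[ℤ] (I → ℤ)).toAddMonoidHom
      ((-AddMonoidHom.id (I → ℤ)) β)) = thetaRoot A τ l β := by
    show weylProd A l (LinearMap.funLeft ℤ ℤ τ.symm (-β)) = _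
    rw [map_neg, map_neg]
    rfl
  rw [h4] at h3
  exact h3

theorem theta_cartan (hA : ∀ i, A i i = 2) (τ : Equiv.Perm I) (hτ : IsDiagramAut A τ)
    (l : List I) {x : KM A} (hx : x ∈ cartan A) :
    theta A τ hτ l x ∈ cartan A ∧ (theta A τ hτ l x = 0 → x = 0) := by
  have h0 : chevalley A x = -x := by
    induction hx using Submodule.span_induction with
    | mem x hx => obtain ⟨j, rfl⟩ := hx; exact chevalley_h A j
    | zero => simp
    | add x y _ _ hx hy => rw [map_add, hx, hy, neg_add]
    | smul a x _ hx => rw [map_smul, hx, smul_neg]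
  have h1 : ∀ (σ : Equiv.Perm I) (hσ : IsDiagramAut A σ), ∀ x ∈ cartan A,
      diagramHom A σ hσ x ∈ cartan A := by
    intro σ hσ x hx
    induction hx using Submodule.span_induction with
    | mem x hx =>
      obtain ⟨j, rfl⟩ := hx
      rw [diagramHom_h]; exact Submodule.subset_span ⟨_, rfl⟩
    | zero => simp
    | add x y _ _ hx hy => rw [map_add]; exact Submodule.add_mem _ hx hy
    | smul a x _ hx => rw [map_smul]; exact Submodule.smul_mem _ _ hx
  have hτ' : IsDiagramAut A τ.symm := fun i j => by
    rw [← hτ (τ.symm i) (τ.symm j)]; simp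
  have h2 : (diagramHom A τ.symm hτ').comp (diagramHom A τ hτ) = LieHom.id := by
    refine hom_ext (fun i => ?_) (fun i => ?_) (fun i => ?_)
    · simp [LieHom.comp_apply, diagramHom_e]
    · simp [LieHom.comp_apply, diagramHom_f]
    · simp [LieHom.comp_apply, diagramHom_h]
  have h3 := AdWord_cartan hA l (h1 τ hτ (-x) (Submodule.neg_mem _ hx))
  rw [theta_apply, h0]
  refine ⟨h3.1, fun h4 => ?_⟩
  have h5 := congrArg (diagramHom A τ.symm hτ') (h3.2 h4)
  rw [← LieHom.comp_apply, h2, map_zero] at h5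
  simpa using h5

end Theta

/-! ### Serre elements and the `sl₂` computation. -/

section SerreElements

variable {I : Type*} [DecidableEq I] {A : Matrix I I ℤ} {L : Type*} [LieRing L] [LieAlgebra ℂ L]

variable (A) in
/-- The element `ad(x_i)^{1 - a_{ij}}(x_j)`. -/
def serreElt (x : I → L) (i j : I) : L :=
  ((LieAlgebra.ad ℂ L (x i)) ^ (-A i j).toNat) ⁅x i, x j⁆

theorem serreElt_self (x : I → L) (i : I) : serreElt A x i i = 0 := by
  simp [serreElt]

theorem serreElt_eq (x : I → L) (i j : I) :
    serreElt A x i j = ((LieAlgebra.ad ℂ L (x i)) ^ ((-A i j).toNat + 1)) (x j) := by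
  rw [serreElt, pow_succ, Module.End.mul_apply, LieAlgebra.ad_apply]

theorem lie_ad_pow_of_commute {t x y : L} (h : ⁅t, x⁆ = 0) (n : ℕ) :
    ⁅t, ((LieAlgebra.ad ℂ L x) ^ n) y⁆ = ((LieAlgebra.ad ℂ L x) ^ n) ⁅t, y⁆ := by
  induction n with
  | zero => simp
  | succ n ih =>
    rw [pow_succ', Module.End.mul_apply, Module.End.mul_apply, LieAlgebra.ad_apply,
      LieAlgebra.ad_apply, leibniz_lie, h, zero_lie, zero_add, ih]

theorem lie_ad_pow_of_eigen {t x y : L} {a b : ℂ} (hx : ⁅t, x⁆ = a • x) (hy : ⁅t, y⁆ = b • y)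
    (n : ℕ) : ⁅t, ((LieAlgebra.ad ℂ L x) ^ n) y⁆ =
      (n * a + b) • ((LieAlgebra.ad ℂ L x) ^ n) y := by
  induction n with
  | zero => simpa using hy
  | succ n ih =>
    rw [pow_succ', Module.End.mul_apply, LieAlgebra.ad_apply, leibniz_lie, hx, ih, smul_lie,
      lie_smul, ← add_smul]
    congr 1
    push_cast
    ring

/-- The `sl₂`-computation of `[e, ad(f)ⁿ(v)]` for a highest weight vector `v`. -/
theorem lie_ad_pow_highest {e f h v : L} {a : ℂ} (hef : ⁅e, f⁆ = h) (hhf : ⁅h, f⁆ = (-2 : ℂ) • f)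
    (hhv : ⁅h, v⁆ = a • v) (hev : ⁅e, v⁆ = 0) (n : ℕ) :
    ⁅e, ((LieAlgebra.ad ℂ L f) ^ (n + 1)) v⁆ =
      ((n + 1) * (a - n)) • ((LieAlgebra.ad ℂ L f) ^ n) v := by
  induction n with
  | zero => simp [leibniz_lie e f v, hef, hev, hhv]
  | succ n ih =>
    rw [pow_succ', Module.End.mul_apply, LieAlgebra.ad_apply, leibniz_lie, hef, ih,
      lie_ad_pow_of_eigen hhf hhv, lie_smul, ← LieAlgebra.ad_apply ℂ L f,
      ← Module.End.mul_apply, ← pow_succ', ← add_smul]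
    congr 1
    push_cast
    ring

/-- Serre elements commute with the opposite generators. -/
theorem lie_serreElt {e' f' h' : I → L} (hA : ∀ i, A i i = 2) (hA0 : ∀ i j, i ≠ j → A i j ≤ 0)
    (hAz : ∀ i j, A i j = 0 → A j i = 0)
    (hef : ∀ i j, ⁅e' i, f' j⁆ = if i = j then h' i else 0)
    (hhf : ∀ i j, ⁅h' i, f' j⁆ = (-A i j : ℂ) • f' j) (k i j : I) :
    ⁅e' k, serreElt A f' i j⁆ = 0 := by
  by_cases hij : i = j
  · subst hij; rw [serreElt_self, lie_zero]
  have hcast : ((-A i j).toNat : ℂ) = -A i j := by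
    have h1 : ((-A i j).toNat : ℤ) = -A i j := Int.toNat_of_nonneg (by linarith [hA0 i j hij])
    exact_mod_cast congrArg (Int.cast : ℤ → ℂ) h1
  rw [serreElt_eq]
  -- For `k = i` the vector `f_j` is of highest weight `-a_{ij}` for the `sl₂` of index `i`, and the
  -- factor `a - n` of `lie_ad_pow_highest` vanishes at `n = -a_{ij}`.
  by_cases hki : k = i
  · subst hki
    rw [lie_ad_pow_highest (h := h' k) (a := -A k j) (by rw [hef, if_pos rfl])
      (by rw [hhf, hA]; norm_num) (hhf k j) (by rw [hef, if_neg hij]), hcast]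
    simp
  rw [lie_ad_pow_of_commute (by rw [hef, if_neg hki]), hef]
  split_ifs with hkj
  · subst hkj
    have h1 : ⁅f' i, h' k⁆ = (A k i : ℂ) • f' i := by rw [← lie_skew, hhf]; module
    rw [pow_succ, Module.End.mul_apply, LieAlgebra.ad_apply, h1]
    -- One application of `ad f_i` turns `h_k` into `a_{ki} f_i`. Either this is zero, or `a_{ik} ≠
    -- 0` too and a second application kills `f_i`.
    by_cases h0 : A k i = 0
    · simp [h0]
    · have h2 : (-A i k).toNat ≠ 0 := by
        intro h3
        have h4 := hA0 i k hij
        exact h0 (hAz i k (by omega))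
      obtain ⟨n, hn⟩ := Nat.exists_eq_succ_of_ne_zero h2
      rw [hn, pow_succ, Module.End.mul_apply, map_smul, LieAlgebra.ad_apply, lie_self]
      simp
  · simp

end SerreElements

/-! ### Transport of brackets along an intertwining map. -/

section Intertwine

attribute [local instance] LieRing.ofAssociativeRing

variable {I : Type*} [DecidableEq I] {A : Matrix I I ℤ} {V V' : Type*} [AddCommGroup V] [Module ℂ V]
  [AddCommGroup V'] [Module ℂ V'] {q : V →ₗ[ℂ] V'}

theorem intertwine_lie {a b : Module.End ℂ V} {a' b' : Module.End ℂ V'}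
    (ha : ∀ v, q (a v) = a' (q v)) (hb : ∀ v, q (b v) = b' (q v)) (v : V) :
    q (⁅a, b⁆ v) = ⁅a', b'⁆ (q v) := by
  simp [LieRing.of_associative_ring_bracket, ha, hb]

theorem intertwine_serreElt {x : I → Module.End ℂ V} {x' : I → Module.End ℂ V'}
    (hx : ∀ i v, q (x i v) = x' i (q v)) (i j : I) (v : V) :
    q (serreElt A x i j v) = serreElt A x' i j (q v) := by
  have key : ∀ (n : ℕ) v, q ((((LieAlgebra.ad ℂ _ (x i)) ^ n) ⁅x i, x j⁆ : Module.End ℂ V) v) =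
      (((LieAlgebra.ad ℂ _ (x' i)) ^ n) ⁅x' i, x' j⁆ : Module.End ℂ V') (q v) := by
    intro n
    induction n with
    | zero => exact intertwine_lie (hx i) (hx j)
    | succ n ih =>
      intro v
      rw [pow_succ', pow_succ', Module.End.mul_apply, Module.End.mul_apply, LieAlgebra.ad_apply,
        LieAlgebra.ad_apply]
      exact intertwine_lie (hx i) ih v
  exact key _ v

theorem intertwine_iterBracket {x : I → Module.End ℂ V} {x' : I → Module.End ℂ V'}
    (hx : ∀ i v, q (x i v) = x' i (q v)) (w : List I) (v : V) :
    q (iterBracket x w v) = iterBracket x' w (q v) := by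
  by_cases hw : w = []
  · subst hw; simp [iterBracket]
  · induction w, hw using word_induction generalizing v with
    | single i => exact hx i v
    | cons i w hw ih =>
      rw [iterBracket_cons _ _ hw, iterBracket_cons _ _ hw]
      exact intertwine_lie (hx i) (fun v => ih v) v

end Intertwine

/-! ### A module on which the `f_i` act freely up to Serre relations -/

section WordModule

attribute [local instance] LieRing.ofAssociativeRing

variable {I : Type*} [DecidableEq I] (A : Matrix I I ℤ) {V : Type*} [AddCommGroup V] [Module ℂ V]
  (b : Module.Basis (List I) ℂ V)

/-- Concatenation of a letter, on a space with a basis indexed by words. -/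
def wordF (j : I) : Module.End ℂ V := b.constr ℂ fun w => b (j :: w)

/-- The diagonal action of `h_i`. -/
def wordH (i : I) : Module.End ℂ V :=
  b.constr ℂ fun w => (-(w.map fun j => (A i j : ℂ)).sum) • b w

/-- The value of `e_i` on a word. -/
def wordEAux (i : I) : List I → V
  | [] => 0
  | j :: w => wordF b j (wordEAux i w) + if i = j then wordH A b i (b w) else 0

/-- The action of `e_i`. -/
def wordE (i : I) : Module.End ℂ V := b.constr ℂ (wordEAux A b i)

theorem wordF_single (j : I) (w : List I) :
    wordF b j (b w) = b (j :: w) := by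
  simp [wordF]

theorem wordH_single (i : I) (w : List I) :
    wordH A b i (b w) =
      (-(w.map fun j => (A i j : ℂ)).sum) • b w := by
  rw [wordH, Module.Basis.constr_basis]

theorem wordE_nil (i : I) : wordE A b i (b []) = 0 := by
  rw [wordE, Module.Basis.constr_basis, wordEAux]

theorem wordE_cons (i j : I) (w : List I) : wordE A b i (b (j :: w)) =
    wordF b j (wordE A b i (b w)) +
      if i = j then wordH A b i (b w) else 0 := by
  rw [wordE, Module.Basis.constr_basis, Module.Basis.constr_basis, wordEAux]

theorem lie_wordE_wordF (i j : I) :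
    ⁅wordE A b i, wordF b j⁆ = if i = j then wordH A b i else 0 := by
  refine b.ext fun w => ?_
  rw [LieRing.of_associative_ring_bracket, LinearMap.sub_apply, Module.End.mul_apply,
    Module.End.mul_apply, wordF_single, wordE_cons, add_sub_cancel_left]
  split_ifs <;> simp

theorem lie_wordH_wordF (i j : I) : ⁅wordH A b i, wordF b j⁆ = (-A i j : ℂ) • wordF b j := by
  refine b.ext fun w => ?_
  rw [LieRing.of_associative_ring_bracket, LinearMap.sub_apply, Module.End.mul_apply,
    Module.End.mul_apply, wordF_single, wordH_single, wordH_single, map_smul,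
    LinearMap.smul_apply, wordF_single, ← sub_smul]
  congr 1
  simp

theorem lie_wordH_wordH (i j : I) : ⁅wordH A b i, wordH A b j⁆ = 0 := by
  refine b.ext fun w => ?_
  rw [LieRing.of_associative_ring_bracket, LinearMap.sub_apply, Module.End.mul_apply,
    Module.End.mul_apply, wordH_single, wordH_single, map_smul, map_smul, wordH_single,
    wordH_single, smul_comm, sub_self, LinearMap.zero_apply]

variable {A}

/-- The empty word generates the space under the letters. Thus an identity between operators can be
checked on commutators with the `wordF b k` and on the empty word. -/
theorem word_end_eq_zero {C : Module.End ℂ (V)} (hC : ∀ k : I, ⁅C, wordF b k⁆ = 0)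
    (h0 : C (b []) = 0) : C = 0 := by
  refine b.ext fun w => ?_
  induction w with
  | nil => simpa using h0
  | cons k w ih =>
    have h1 := LinearMap.congr_fun (hC k) (b w)
    rw [LieRing.of_associative_ring_bracket, LinearMap.sub_apply, Module.End.mul_apply,
      Module.End.mul_apply, wordF_single, ih] at h1
    simpa using h1

theorem wordH_nil (i : I) : wordH A b i (b []) = 0 := by
  rw [wordH_single]; simp

theorem lie_wordH_wordE (i j : I) : ⁅wordH A b i, wordE A b j⁆ = (A i j : ℂ) • wordE A b j := by
  rw [← sub_eq_zero]
  refine word_end_eq_zero b (fun k => ?_) ?_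
  · rw [sub_lie, lie_lie, smul_lie, lie_wordE_wordF, lie_wordH_wordF, lie_smul, lie_wordE_wordF]
    split_ifs with hjk
    · subst hjk
      rw [lie_wordH_wordH]
      module
    · simp
  · simp [LieRing.of_associative_ring_bracket, wordE_nil, wordH_nil b]

/-- By `lie_serreElt`, with `e` and `f` exchanged and `h` negated, these elements commute with all
letters; they also kill the empty word. No quotient is needed for the `e_i`. -/
theorem serreElt_wordE (hA : ∀ i, A i i = 2) (hA0 : ∀ i j, i ≠ j → A i j ≤ 0)
    (hAz : ∀ i j, A i j = 0 → A j i = 0) (i j : I) : serreElt A (wordE A b) i j = 0 := by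
  refine word_end_eq_zero b (fun k => ?_) ?_
  · rw [← lie_skew, neg_eq_zero]
    refine lie_serreElt (e' := wordF b) (f' := wordE A b) (h' := fun i => -wordH A b i) hA hA0 hAz ?_ ?_
      k i j
    · intro i j
      rw [← lie_skew, lie_wordE_wordF]
      split_ifs with h1 h2 h2
      · rw [h1]
      · exact absurd h1.symm h2
      · exact absurd h2.symm h1
      · simp
    · intro i j
      rw [neg_lie, lie_wordH_wordE b, neg_smul]
  · have key : ∀ n : ℕ, (((LieAlgebra.ad ℂ _ (wordE A b i)) ^ n) ⁅wordE A b i, wordE A b j⁆ :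
        Module.End ℂ (V)) (b []) = 0 := by
      intro n
      induction n with
      | zero => simp [LieRing.of_associative_ring_bracket, wordE_nil]
      | succ n ih =>
        rw [pow_succ', Module.End.mul_apply, LieAlgebra.ad_apply,
          LieRing.of_associative_ring_bracket, LinearMap.sub_apply, Module.End.mul_apply,
          Module.End.mul_apply, ih, wordE_nil, map_zero, map_zero, sub_zero]
    exact key _

variable (A) in
/-- The span of the two-sided multiples of the Serre elements. -/
def serreSubmodule : Submodule ℂ (V) :=
  Submodule.span ℂ {x | ∃ (u : List I) (i j : I) (t : V),
    x = (u.map (wordF b)).prod (serreElt A (wordF b) i j t)}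

theorem serreSubmodule_stable {C : Module.End ℂ (V)}
    (hC : ∀ (u : List I) i j t, C ((u.map (wordF b)).prod (serreElt A (wordF b) i j t)) ∈ serreSubmodule A b) :
    serreSubmodule A b ≤ (serreSubmodule A b).comap C := by
  refine Submodule.span_le.2 ?_
  rintro _ ⟨u, i, j, t, rfl⟩
  exact hC u i j t

theorem mem_serreSubmodule (u : List I) (i j : I) (t : V) :
    (u.map (wordF b)).prod (serreElt A (wordF b) i j t) ∈ serreSubmodule A b :=
  Submodule.subset_span ⟨u, i, j, t, rfl⟩

theorem wordF_stable (k : I) : serreSubmodule A b ≤ (serreSubmodule A b).comap (wordF b k) :=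
  serreSubmodule_stable b fun u i j t => by
    simpa using mem_serreSubmodule (A := A) b (k :: u) i j t

theorem wordH_stable (k : I) : serreSubmodule A b ≤ (serreSubmodule A b).comap (wordH A b k) := by
  refine serreSubmodule_stable b fun u i j t => ?_
  induction u with
  | nil =>
    have h1 := lie_ad_pow_of_eigen (lie_wordH_wordF A b k i) (lie_wordH_wordF A b k j)
      ((-A i j).toNat + 1)
    rw [← serreElt_eq, LieRing.of_associative_ring_bracket, sub_eq_iff_eq_add] at h1
    have h2 := LinearMap.congr_fun h1 t
    simp only [Module.End.mul_apply, LinearMap.add_apply, LinearMap.smul_apply] at h2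
    rw [List.map_nil, List.prod_nil, Module.End.one_apply, h2]
    exact Submodule.add_mem _ (Submodule.smul_mem _ _ (mem_serreSubmodule b [] i j t))
      (mem_serreSubmodule b [] i j _)
  | cons m u ih =>
    have h1 := lie_wordH_wordF A b k m
    rw [LieRing.of_associative_ring_bracket, sub_eq_iff_eq_add] at h1
    have h2 := LinearMap.congr_fun h1 ((u.map (wordF b)).prod (serreElt A (wordF b) i j t))
    simp only [Module.End.mul_apply, LinearMap.add_apply, LinearMap.smul_apply] at h2
    rw [List.map_cons, List.prod_cons, Module.End.mul_apply, h2]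
    exact Submodule.add_mem _
      (Submodule.smul_mem _ _ (wordF_stable b m (mem_serreSubmodule b u i j t))) (wordF_stable b m ih)

/-- The operator `e_k` commutes with the Serre elements of the `f_i`, and moving it through a letter
costs at most `h_k`, which also preserves the ideal. -/
theorem wordE_stable (hA : ∀ i, A i i = 2) (hA0 : ∀ i j, i ≠ j → A i j ≤ 0)
    (hAz : ∀ i j, A i j = 0 → A j i = 0) (k : I) :
    serreSubmodule A b ≤ (serreSubmodule A b).comap (wordE A b k) := by
  refine serreSubmodule_stable b fun u i j t => ?_
  induction u with
  | nil =>
    have h1 := lie_serreElt hA hA0 hAz (lie_wordE_wordF A b) (lie_wordH_wordF A b) k i j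
    rw [LieRing.of_associative_ring_bracket, sub_eq_zero] at h1
    have h2 := LinearMap.congr_fun h1 t
    simp only [Module.End.mul_apply] at h2
    rw [List.map_nil, List.prod_nil, Module.End.one_apply, h2]
    exact mem_serreSubmodule b [] i j _
  | cons m u ih =>
    have h1 := lie_wordE_wordF A b k m
    rw [LieRing.of_associative_ring_bracket, sub_eq_iff_eq_add] at h1
    have h2 := LinearMap.congr_fun h1 ((u.map (wordF b)).prod (serreElt A (wordF b) i j t))
    simp only [Module.End.mul_apply, LinearMap.add_apply] at h2
    rw [List.map_cons, List.prod_cons, Module.End.mul_apply, h2]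
    refine Submodule.add_mem _ ?_ (wordF_stable b m ih)
    split_ifs
    · exact wordH_stable b k (mem_serreSubmodule b u i j t)
    · exact Submodule.zero_mem _

theorem end_quotient_ext {C D : Module.End ℂ (V ⧸ serreSubmodule A b)}
    {C' D' : Module.End ℂ (V)}
    (hC : ∀ t, (serreSubmodule A b).mkQ (C' t) = C ((serreSubmodule A b).mkQ t))
    (hD : ∀ t, (serreSubmodule A b).mkQ (D' t) = D ((serreSubmodule A b).mkQ t)) (h : C' = D') :
    C = D := by
  refine LinearMap.ext fun x => ?_
  obtain ⟨t, rfl⟩ := (serreSubmodule A b).mkQ_surjective x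
  rw [← hC, ← hD, h]

/-- A linear relation between iterated brackets of the `f_i` is a consequence of the Serre
relations, inside the span of words. -/
theorem sum_wordF_mem_serreSubmodule (hA : ∀ i, A i i = 2) (hA0 : ∀ i j, i ≠ j → A i j ≤ 0)
    (hAz : ∀ i j, A i j = 0 → A j i = 0) (s : Finset (List I)) (a : List I → ℂ)
    (hs : ∑ w ∈ s, a w • iterBracket (f A) w = 0) :
    ∑ w ∈ s, a w • iterBracket (wordF b) w (b []) ∈ serreSubmodule A b := by
  set Q := serreSubmodule A b
  let E' : I → Module.End ℂ (V ⧸ Q) := fun i => Q.mapQ Q _ (wordE_stable b hA hA0 hAz i)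
  let F' : I → Module.End ℂ (V ⧸ Q) := fun i => Q.mapQ Q _ (wordF_stable b i)
  let H' : I → Module.End ℂ (V ⧸ Q) := fun i => Q.mapQ Q _ (wordH_stable b i)
  have hE : ∀ i t, Q.mkQ (wordE A b i t) = E' i (Q.mkQ t) := fun _ _ => rfl
  have hF : ∀ i t, Q.mkQ (wordF b i t) = F' i (Q.mkQ t) := fun _ _ => rfl
  have hH : ∀ i t, Q.mkQ (wordH A b i t) = H' i (Q.mkQ t) := fun _ _ => rfl
  have h0 : ∀ t, Q.mkQ ((0 : Module.End ℂ (V)) t) =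
    (0 : Module.End ℂ (V ⧸ Q)) (Q.mkQ t) := by simp
  -- The quotient is a representation of the Kac-Moody algebra; the given relation is then applied
  -- to the class of the empty word.
  let ρ : KM A →ₗ⁅ℂ⁆ Module.End ℂ (V ⧸ Q) := lift A E' F' H'
    (fun i j => end_quotient_ext b (intertwine_lie (hH i) (hH j)) h0 (lie_wordH_wordH A b i j))
    (fun i => end_quotient_ext b (intertwine_lie (hE i) (hF i)) (hH i) (by
      rw [lie_wordE_wordF, if_pos rfl]))
    (fun i j hij => end_quotient_ext b (intertwine_lie (hE i) (hF j)) h0 (by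
      rw [lie_wordE_wordF, if_neg hij]))
    (fun i j => end_quotient_ext b (intertwine_lie (hH i) (hE j)) (D' := A i j • wordE A b j)
      (fun t => by rw [LinearMap.smul_apply, map_zsmul, hE, LinearMap.smul_apply]) (by rw [lie_wordH_wordE b, Int.cast_smul_eq_zsmul]))
    (fun i j => end_quotient_ext b (intertwine_lie (hH i) (hF j)) (D' := -(A i j • wordF b j))
      (fun t => by
        rw [LinearMap.neg_apply, LinearMap.smul_apply, map_neg, map_zsmul, hF, LinearMap.neg_apply,
          LinearMap.smul_apply]) (by rw [lie_wordH_wordF, neg_smul, Int.cast_smul_eq_zsmul]))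
    (fun i j => end_quotient_ext b (intertwine_serreElt hE i j) h0
      (serreElt_wordE b hA hA0 hAz i j))
    (fun i j => by
      refine LinearMap.ext fun x => ?_
      obtain ⟨t, rfl⟩ := Q.mkQ_surjective x
      rw [LinearMap.zero_apply]
      refine (intertwine_serreElt (A := A) hF i j t).symm.trans ?_
      exact (Submodule.Quotient.mk_eq_zero Q).2 (mem_serreSubmodule b [] i j t))
  have hρ : ∀ i, ρ (f A i) = F' i := fun i => lift_f ..
  rw [← Submodule.Quotient.mk_eq_zero Q, ← Submodule.mkQ_apply, map_sum]
  have h1 := LinearMap.congr_fun (congrArg ρ hs) (Q.mkQ (b []))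
  rw [map_sum, LinearMap.sum_apply, map_zero, LinearMap.zero_apply] at h1
  rw [← h1]
  refine Finset.sum_congr rfl fun w _ => ?_
  rw [map_smul, map_smul, LinearMap.smul_apply, intertwine_iterBracket hF,
    map_iterBracket (map_zero ρ) (LieHom.map_lie ρ)]
  simp only [hρ]

end WordModule

/-! ### From associative relations back to Lie relations. -/

section Presentation

attribute [local instance] LieRing.ofAssociativeRing

variable {I : Type*} [DecidableEq I] {A : Matrix I I ℤ} {L : Type*} [LieRing L] [LieAlgebra ℂ L]

/-- The operator on `L[t] ⊕ ℂ δ` by which `v tⁿ` acts in the semidirect product of `L[t]` with the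
Euler derivation (up to sign on `δ`). -/
def shiftOp (n : ℕ) (v : L) : Module.End ℂ ((ℕ → L) × ℂ) where
  toFun p := (fun m => if n ≤ m then ⁅v, p.1 (m - n)⁆ + (if m = n then (p.2 * n) • v else 0) else 0, 0)
  map_add' p q := by
    ext m
    · simp only [Prod.fst_add, Pi.add_apply, Prod.snd_add, lie_add]
      split_ifs <;> module
    · simp
  map_smul' a p := by
    ext m
    · simp only [Prod.smul_fst, Pi.smul_apply, Prod.smul_snd, lie_smul, smul_eq_mul,
        RingHom.id_apply]
      split_ifs <;> module
    · simp

theorem shiftOp_fst (n : ℕ) (v : L) (p : (ℕ → L) × ℂ) (m : ℕ) : (shiftOp n v p).1 m =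
    if n ≤ m then ⁅v, p.1 (m - n)⁆ + (if m = n then (p.2 * n) • v else 0) else 0 := rfl

theorem shiftOp_snd (n : ℕ) (v : L) (p : (ℕ → L) × ℂ) : (shiftOp n v p).2 = 0 := rfl

/-- On `L[t]` this is the Jacobi identity. On `δ` the two orders contribute `n'` and `n` times `[v,
v']`, which add up to `n + n'`. -/
theorem lie_shiftOp (n n' : ℕ) (v v' : L) :
    ⁅shiftOp n v, shiftOp n' v'⁆ = shiftOp (n + n') ⁅v, v'⁆ := by
  refine LinearMap.ext fun p => Prod.ext (funext fun m => ?_) ?_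
  · rw [LieRing.of_associative_ring_bracket, LinearMap.sub_apply, Module.End.mul_apply,
      Module.End.mul_apply, Prod.fst_sub, Pi.sub_apply]
    simp only [shiftOp_fst, shiftOp_snd, zero_mul, zero_smul, ite_self, add_zero]
    by_cases hm : n + n' ≤ m
    · obtain ⟨k, rfl⟩ := Nat.exists_eq_add_of_le hm
      have h1 : n + n' + k - n = n' + k := by omega
      have h2 : n + n' + k - n' = n + k := by omega
      have h3 : n ≤ n + n' + k := by omega
      have h4 : n' ≤ n + n' + k := by omega
      simp only [h1, h2, h3, h4, Nat.le_add_right, Nat.add_sub_cancel_left, if_true, Nat.add_eq_left]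
      by_cases hk : k = 0
      · subst hk
        simp only [if_true, lie_add, lie_smul, lie_lie]
        rw [← lie_skew v' v]
        push_cast
        module
      · simp [hk, lie_lie]
    · rw [if_neg hm]
      have h1 : (if n ≤ m then ⁅v, if n' ≤ m - n then ⁅v', p.1 (m - n - n')⁆ +
          (if m - n = n' then (p.2 * n') • v' else 0) else 0⁆ else 0) = 0 := by
        split_ifs <;> first | omega | simp
      have h2 : (if n' ≤ m then ⁅v', if n ≤ m - n' then ⁅v, p.1 (m - n' - n)⁆ +
          (if m - n' = n then (p.2 * n) • v else 0) else 0⁆ else 0) = 0 := by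
        split_ifs <;> first | omega | simp
      rw [h1, h2, sub_zero]
  · rw [LieRing.of_associative_ring_bracket, LinearMap.sub_apply, Module.End.mul_apply,
      Module.End.mul_apply, Prod.snd_sub, shiftOp_snd, shiftOp_snd, shiftOp_snd, sub_zero]

/-- Applied to `δ`, this operator returns `w.length • iterBracket g w` in degree `w.length`; so the
Lie element can be recovered from the associative action. -/
theorem iterBracket_shiftOp (g : I → L) {w : List I} (hw : w ≠ []) :
    iterBracket (fun i => shiftOp 1 (g i)) w = shiftOp w.length (iterBracket g w) := by
  induction w, hw using word_induction with
  | single i => rfl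
  | cons i w hw ih =>
    rw [iterBracket_cons _ _ hw, iterBracket_cons _ _ hw, ih, lie_shiftOp, List.length_cons,
      add_comm]

theorem serreElt_shiftOp (g : I → L) (i j : I) :
    serreElt A (fun i => shiftOp 1 (g i)) i j =
      shiftOp ((-A i j).toNat + 2) (serreElt A g i j) := by
  have key : ∀ n : ℕ, ((LieAlgebra.ad ℂ _ (shiftOp 1 (g i))) ^ n) ⁅shiftOp 1 (g i), shiftOp 1 (g j)⁆
      = shiftOp (n + 2) (((LieAlgebra.ad ℂ L (g i)) ^ n) ⁅g i, g j⁆) := by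
    intro n
    induction n with
    | zero => rw [lie_shiftOp]; rfl
    | succ n ih =>
      rw [pow_succ', pow_succ', Module.End.mul_apply, Module.End.mul_apply, ih,
        LieAlgebra.ad_apply, LieAlgebra.ad_apply, lie_shiftOp]
      congr 1
      omega
  exact key _

/-- If the `g_i` satisfy the Serre relations up to lower order terms with respect to a filtration
`U`, then every linear relation between iterated brackets of the `f_i` holds for the `g_i`, up to
lower order terms. -/
theorem sum_iterBracket_mem (hA : ∀ i, A i i = 2) (hA0 : ∀ i j, i ≠ j → A i j ≤ 0)
    (hAz : ∀ i j, A i j = 0 → A j i = 0) (U : ℕ → Submodule ℂ L) (g : I → L)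
    (hU : ∀ a b, ∀ x ∈ U a, ∀ y ∈ U b, ⁅x, y⁆ ∈ U (a + b)) (hg : ∀ i, g i ∈ U 1)
    (hserre : ∀ i j, serreElt A g i j ∈ U ((-A i j).toNat + 1))
    (s : Finset (List I)) (a : List I → ℂ) (hne : ∀ w ∈ s, w ≠ [])
    (hs : ∑ w ∈ s, a w • iterBracket (f A) w = 0) (m : ℕ) :
    ∑ w ∈ s with w.length = m + 1, a w • iterBracket g w ∈ U m := by
  let b : Module.Basis (List I) ℂ (List I →₀ ℂ) := Finsupp.basisSingleOne
  let x : I → Module.End ℂ ((ℕ → L) × ℂ) := fun i => shiftOp 1 (g i)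
  let v₀ : (ℕ → L) × ℂ := (0, 1)
  -- The orbit map of `δ`, where a letter `f_i` acts as `g_i t`.
  let ev : (List I →₀ ℂ) →ₗ[ℂ] ((ℕ → L) × ℂ) := b.constr ℂ fun w => (w.map x).prod v₀
  have hevb : ∀ w, ev (b w) = (w.map x).prod v₀ := fun w => b.constr_basis ℂ _ w
  have hev : ∀ i t, ev (wordF b i t) = x i (ev t) := by
    intro i t
    have : ev ∘ₗ wordF b i = x i ∘ₗ ev := b.ext fun w => by
      rw [LinearMap.comp_apply, LinearMap.comp_apply, wordF_single, hevb, hevb, List.map_cons,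
        List.prod_cons, Module.End.mul_apply]
    exact LinearMap.congr_fun this t
  have hR : ∀ t m, (ev t).1 m ∈ U m := by
    let R : Submodule ℂ ((ℕ → L) × ℂ) :=
      { carrier := {p | ∀ m, p.1 m ∈ U m}
        add_mem' := fun hp hq m => (U m).add_mem (hp m) (hq m)
        zero_mem' := fun m => (U m).zero_mem
        smul_mem' := fun c p hp m => (U m).smul_mem c (hp m) }
    have hxR : ∀ i, ∀ p ∈ R, x i p ∈ R := by
      intro i p hp m
      show (shiftOp 1 (g i) p).1 m ∈ U m
      rw [shiftOp_fst]
      split_ifs with h1 h2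
      · subst h2
        exact (U 1).add_mem (hU 1 0 _ (hg i) _ (hp 0)) ((U 1).smul_mem _ (hg i))
      · have h3 := hU 1 (m - 1) _ (hg i) _ (hp (m - 1))
        rw [add_zero]
        rwa [show 1 + (m - 1) = m by omega] at h3
      · exact (U m).zero_mem
    have hb : ∀ w : List I, (w.map x).prod v₀ ∈ R := by
      intro w
      induction w with
      | nil => intro m; exact (U m).zero_mem
      | cons i w ih =>
        rw [List.map_cons, List.prod_cons, Module.End.mul_apply]
        exact hxR i _ ih
    have hle : LinearMap.range ev ≤ R := by
      rw [Module.Basis.constr_range, Submodule.span_le]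
      rintro _ ⟨w, rfl⟩
      exact hb w
    exact fun t => hle ⟨t, rfl⟩
  -- The coefficient of `t^(m+1)` is required to lie in `U m`, one step below the bound `hR` valid
  -- for all values of `ev`. The Serre ideal is shown to land here.
  let K : Submodule ℂ ((ℕ → L) × ℂ) :=
    { carrier := {p | p.2 = 0 ∧ p.1 0 = 0 ∧ ∀ m, p.1 (m + 1) ∈ U m}
      add_mem' := fun {p q} hp hq => ⟨by simp [hp.1, hq.1], by simp [hp.2.1, hq.2.1],
        fun m => (U m).add_mem (hp.2.2 m) (hq.2.2 m)⟩
      zero_mem' := ⟨rfl, rfl, fun m => (U m).zero_mem⟩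
      smul_mem' := fun c p hp => ⟨by simp [hp.1], by simp [hp.2.1],
        fun m => (U m).smul_mem c (hp.2.2 m)⟩ }
  have hxK : ∀ i, ∀ p ∈ K, x i p ∈ K := by
    intro i p hp
    refine ⟨rfl, rfl, fun m => ?_⟩
    show (shiftOp 1 (g i) p).1 (m + 1) ∈ U m
    rw [shiftOp_fst, if_pos (by omega), hp.1, Nat.add_sub_cancel]
    cases m with
    | zero => rw [hp.2.1]; simp
    | succ m =>
      rw [if_neg (by omega), add_zero, add_comm m 1]
      exact hU 1 m _ (hg i) _ (by rw [add_comm]; exact hp.2.2 m)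
  have hQ : serreSubmodule A b ≤ K.comap ev := by
    refine Submodule.span_le.2 ?_
    rintro _ ⟨u, i, j, t, rfl⟩
    show ev _ ∈ K
    induction u with
    | nil =>
      rw [List.map_nil, List.prod_nil, Module.End.one_apply, intertwine_serreElt hev,
        serreElt_shiftOp]
      refine ⟨rfl, by simp [shiftOp_fst], fun m => ?_⟩
      rw [shiftOp_fst]
      split_ifs with h1 h2
      -- The Serre element is a bracket of `-a_{ij} + 2` letters, while `hserre` places it in degree
      -- `-a_{ij} + 1`; this is the drop by one recorded in `K`.
      · have h3 : (-A i j).toNat + 1 = m := by omega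
        have h4 : m + 1 - ((-A i j).toNat + 2) = 0 := by omega
        have h5 := hU _ 0 _ (hserre i j) _ (hR t 0)
        rw [h3] at h5
        rw [h4]
        exact (U m).add_mem h5 ((U m).smul_mem _ (h3 ▸ hserre i j))
      · have h5 := hU _ _ _ (hserre i j) _ (hR t (m + 1 - ((-A i j).toNat + 2)))
        rw [add_zero]
        rwa [show (-A i j).toNat + 1 + (m + 1 - ((-A i j).toNat + 2)) = m by omega] at h5
      · exact (U m).zero_mem
    | cons k u ih =>
      rw [List.map_cons, List.prod_cons, Module.End.mul_apply, hev]
      exact hxK k _ ih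
  have key := (hQ (sum_wordF_mem_serreSubmodule b hA hA0 hAz s a hs)).2.2 m
  have hterm : ∀ w ∈ s, (ev (a w • iterBracket (wordF b) w (b []))).1 (m + 1) =
      if w.length = m + 1 then ((m : ℂ) + 1) • (a w • iterBracket g w) else 0 := by
    intro w hw
    rw [map_smul, intertwine_iterBracket hev, hevb, List.map_nil, List.prod_nil, Module.End.one_apply,
      iterBracket_shiftOp g (hne w hw), Prod.smul_fst, Pi.smul_apply, shiftOp_fst]
    have hv : ∀ k, v₀.1 k = 0 := fun _ => rfl
    have hv2 : v₀.2 = 1 := rfl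
    rw [hv, hv2]
    split_ifs with h1 h2 h3 h4 h5
    · rw [h3, lie_zero, zero_add, one_mul, smul_comm, Nat.cast_add, Nat.cast_one]
    · exact absurd h2.symm h3
    · exact absurd h4.symm h2
    · simp
    · omega
    · simp
  have hsum : (ev (∑ w ∈ s, a w • iterBracket (wordF b) w (b []))).1 (m + 1) =
      ((m : ℂ) + 1) • ∑ w ∈ s with w.length = m + 1, a w • iterBracket g w := by
    rw [map_sum, Prod.fst_sum, Finset.sum_apply, Finset.sum_congr rfl hterm, ← Finset.sum_filter,
      Finset.smul_sum]
  rw [hsum] at key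
  have hm : ((m : ℂ) + 1) ≠ 0 := Nat.cast_add_one_ne_zero m
  have := (U m).smul_mem ((m : ℂ) + 1)⁻¹ key
  rwa [smul_smul, inv_mul_cancel₀ hm, one_smul] at this

/-- The generators `f_j` do not vanish. -/
theorem f_ne_zero (hA : ∀ i, A i i = 2) (hA0 : ∀ i j, i ≠ j → A i j ≤ 0)
    (hAz : ∀ i j, A i j = 0 → A j i = 0) (j : I) : f A j ≠ 0 := by
  intro hj
  have hz : ∀ x y : ℂ, ⁅x, y⁆ = 0 := fun x y => by
    rw [LieRing.of_associative_ring_bracket, mul_comm, sub_self]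
  -- In the abelian Lie algebra `ℂ` with every `g_i = 1` and the filtration `⊥, ⊤, ⊤, …`, the
  -- relation `f_j = 0` would give `1 ∈ ⊥`.
  have := sum_iterBracket_mem (L := ℂ) hA hA0 hAz (fun m => if m = 0 then ⊥ else ⊤) (fun _ => 1)
    (fun a b x _ y _ => by rw [hz]; exact Submodule.zero_mem _) (fun _ => by simp)
    (fun _ _ => by simp) {[j]} (fun _ => 1) (by simp) (by simpa [iterBracket] using hj) 0
  simp [iterBracket, Finset.filter_singleton] at this

theorem h_ne_zero (hA : ∀ i, A i i = 2) (hA0 : ∀ i j, i ≠ j → A i j ≤ 0)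
    (hAz : ∀ i j, A i j = 0 → A j i = 0) (j : I) : h A j ≠ 0 := by
  intro hj
  have h1 := lie_h_f_complex A j j
  rw [hj, zero_lie, hA] at h1
  refine f_ne_zero hA hA0 hAz j ((smul_eq_zero.1 h1.symm).resolve_left ?_)
  norm_num

end Presentation

/-! ### The invariant form on the root lattice. -/

section Form

variable {I : Type*} [Fintype I] [DecidableEq I] {A : Matrix I I ℤ}

variable (A) in
/-- The bilinear form on the root lattice attached to a symmetrization of `A`. -/
def rootForm (d : I → ℚ) (β γ : I → ℤ) : ℚ := ∑ i, d i * β i * (A.mulVec γ i : ℤ)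

theorem rootForm_symm {d : I → ℚ} (hd : ∀ i j, d i * A i j = d j * A j i) (β γ : I → ℤ) :
    rootForm A d β γ = rootForm A d γ β := by
  simp only [rootForm, Matrix.mulVec, dotProduct, Int.cast_sum, Finset.mul_sum, Int.cast_mul]
  rw [Finset.sum_comm]
  refine Finset.sum_congr rfl fun i _ => Finset.sum_congr rfl fun j _ => ?_
  linear_combination (β j : ℚ) * (γ i : ℚ) * hd j i

theorem rootForm_simpleRoot_left (d : I → ℚ) (i : I) (γ : I → ℤ) :
    rootForm A d (simpleRoot i) γ = d i * (A.mulVec γ i : ℤ) := by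
  simp [rootForm, simpleRoot, Pi.single_apply]

theorem rootForm_sub_smul_left (d : I → ℚ) (β γ : I → ℤ) (n : ℤ) (i : I) :
    rootForm A d (β - n • simpleRoot i) γ =
      rootForm A d β γ - n * rootForm A d (simpleRoot i) γ := by
  simp only [rootForm, Finset.mul_sum, ← Finset.sum_sub_distrib]
  refine Finset.sum_congr rfl fun k _ => ?_
  simp only [Pi.sub_apply, Pi.smul_apply, smul_eq_mul, Int.cast_sub, Int.cast_mul]
  ring

theorem mulVec_simpleRoot (i j : I) : A.mulVec (simpleRoot j) i = A i j := by
  rw [simpleRoot, Matrix.mulVec_single_one, Matrix.col_apply]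

theorem rootForm_reflection {d : I → ℚ} (hd : ∀ i j, d i * A i j = d j * A j i)
    (hA : ∀ i, A i i = 2) (i : I) (β γ : I → ℤ) :
    rootForm A d (simpleReflection A i β) (simpleReflection A i γ) = rootForm A d β γ := by
  rw [simpleReflection_apply, simpleReflection_apply, rootForm_sub_smul_left,
    rootForm_symm hd β, rootForm_symm hd (simpleRoot i) (γ - _), rootForm_sub_smul_left,
    rootForm_sub_smul_left, rootForm_symm hd γ β, rootForm_symm hd γ (simpleRoot i),
    rootForm_simpleRoot_left, rootForm_simpleRoot_left, rootForm_simpleRoot_left,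
    mulVec_simpleRoot, hA]
  push_cast
  ring

theorem rootForm_weylProd {d : I → ℚ} (hd : ∀ i j, d i * A i j = d j * A j i)
    (hA : ∀ i, A i i = 2) (l : List I) (β γ : I → ℤ) :
    rootForm A d (weylProd A l β) (weylProd A l γ) = rootForm A d β γ := by
  induction l with
  | nil => rw [weylProd_nil, weylProd_nil]
  | cons i l ih => rw [weylProd_cons, weylProd_cons, rootForm_reflection hd hA, ih]

theorem weylProd_apply_of_notMem {X : Finset I} {l : List I} (hl : ∀ i ∈ l, i ∈ X) (β : I → ℤ)
    {k : I} (hk : k ∉ X) : weylProd A l β k = β k := by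
  induction l with
  | nil => rw [weylProd_nil]
  | cons i l ih =>
    have hik : k ≠ i := fun h => hk (h ▸ hl i (by simp))
    rw [weylProd_cons, simpleReflection_apply, Pi.sub_apply, ih fun j hj => hl j (by simp [hj])]
    simp [simpleRoot, hik]

end Form

/-! ### The properties of `θ` for a generalized Satake diagram. -/

section SatakeTheta

variable {I : Type*} [Fintype I] [DecidableEq I]

theorem IsSymmetrizableGCM.eq_zero_symm {A : Matrix I I ℤ} (hA : IsSymmetrizableGCM A) (i j : I)
    (hij : A i j = 0) : A j i = 0 := by
  obtain ⟨d, hd0, hd⟩ := hA.symmetrizable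
  have h1 := hd i j
  rw [hij, Int.cast_zero, mul_zero] at h1
  exact_mod_cast (mul_eq_zero.1 h1.symm).resolve_left (ne_of_gt (hd0 j))

/-- The properties of `θ` on which the structure of `𝔨_c` depends; the weight of `θ(f_j)` is
`α_{τ(j)} + γ j`. -/
structure IsSatakeTheta (A : Matrix I I ℤ) (X : Finset I) (τ : Equiv.Perm I) (γ : I → I → ℤ)
    (θ : KM A →ₗ[ℂ] KM A) : Prop where
  map_lie : ∀ x y, θ ⁅x, y⁆ = ⁅θ x, θ y⁆
  eigen : ∀ k ∈ X, ∃ s : ℂ, s ≠ 0 ∧ θ (e A k) = s • e A k ∧ θ (f A k) = s⁻¹ • f A k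
  diagramAut : ∀ i j, A (τ i) (τ j) = A i j
  involutive : ∀ i, τ (τ i) = i
  tau_notMem : ∀ i ∉ X, τ i ∉ X
  f_mem : ∀ j, θ (f A j) ∈ rootSpace A (simpleRoot (τ j) + γ j)
  nonneg : ∀ j ∉ X, ∀ k, 0 ≤ γ j k
  support : ∀ j, ∀ k ∉ X, γ j k = 0
  of_eq_zero : ∀ j ∉ X, γ j = 0 →
    (∀ k ∈ X, A k j = 0) ∧ θ (f A j) = -e A (τ j) ∧ θ (e A j) = -f A (τ j)
  tau_eq_zero : ∀ j ∉ X, γ j = 0 → γ (τ j) = 0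
  theta_theta_f : ∀ i ∉ X, τ i = i → ∃ κ : ℂ, κ ≠ 0 ∧ θ (θ (f A i)) = κ • f A i
  of_eq_simpleRoot : ∀ i ∉ X, τ i = i → ∀ j ∈ X, γ i = simpleRoot j → A j i = -1 ∧ A i j ≠ -1

theorem AdWord_eq_self {A : Matrix I I ℤ} {l : List I} {x : KM A} (he : ∀ k ∈ l, ⁅e A k, x⁆ = 0)
    (hf : ∀ k ∈ l, ⁅f A k, x⁆ = 0) : AdWord A l x = x := by
  induction l with
  | nil => exact AdWord_nil x
  | cons i l ih =>
    rw [AdWord_cons, ih (fun k hk => he k (by simp [hk])) (fun k hk => hf k (by simp [hk])),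
      AdM_eq_self (he i (by simp)) (hf i (by simp))]

variable {A : Matrix I I ℤ} {X : Finset I} {τ : Equiv.Perm I} {l : List I}

theorem tau_mem (hXτ : IsGeneralizedSatake A X τ) (hl : IsLongestWord A X l) {k : I} (hk : k ∈ X) :
    τ k ∈ X := by
  by_contra hτk
  have h1 := congrFun (hXτ.neg_longest l hl k hk) (τ k)
  have hne : τ k ≠ k := fun h => hτk (h.symm ▸ hk)
  rw [Pi.neg_apply, weylProd_apply_of_notMem hl.1 _ hτk] at h1
  simp [simpleRoot, hne] at h1

theorem thetaRoot_of_mem (hXτ : IsGeneralizedSatake A X τ) (hl : IsLongestWord A X l) {k : I}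
    (hk : k ∈ X) : thetaRoot A τ l (simpleRoot k) = simpleRoot k := by
  rw [thetaRoot_simpleRoot, hXτ.neg_longest l hl _ (tau_mem hXτ hl hk), hXτ.involutive]

theorem thetaRoot_of_support (hXτ : IsGeneralizedSatake A X τ) (hl : IsLongestWord A X l)
    {β : I → ℤ} (hβ : ∀ k ∉ X, β k = 0) : thetaRoot A τ l β = β := by
  have h1 : β = ∑ k, β k • simpleRoot k := by
    funext m
    simp [Finset.sum_apply, simpleRoot, Pi.single_apply]
  conv_lhs => rw [h1]
  conv_rhs => rw [h1]
  rw [map_sum]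
  refine Finset.sum_congr rfl fun k _ => ?_
  rw [map_smul]
  by_cases hk : k ∈ X
  · rw [thetaRoot_of_mem hXτ hl hk]
  · simp [hβ k hk]

/-- Here `γ_j = w_X(α_{τ(j)}) - α_{τ(j)}`. On simple roots in `X` the scalars exist because root
spaces of simple roots are lines, and they are nonzero because `θ` is injective on `𝔥`. Invariance
of the form under `W_X` gives the statements about entries of `A`. -/
theorem isSatakeTheta (hA : IsSymmetrizableGCM A) (hXτ : IsGeneralizedSatake A X τ)
    (hl : IsLongestWord A X l) :
    IsSatakeTheta A X τ (fun j => weylProd A l (simpleRoot (τ j)) - simpleRoot (τ j))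
      (theta A τ hXτ.diagramAut l) := by
  set θ := theta A τ hXτ.diagramAut l with hθ
  obtain ⟨d, hd0, hd⟩ := hA.symmetrizable
  have hlie : ∀ x y, θ ⁅x, y⁆ = ⁅θ x, θ y⁆ := theta_lie τ _ l
  have hwt : ∀ {β x}, x ∈ rootSpace A β → θ x ∈ rootSpace A (thetaRoot A τ l β) :=
    fun hx => theta_mem_rootSpace hA.diag τ _ l hx
  have hh : ∀ j, h A j ≠ 0 := h_ne_zero hA.diag hA.offDiag hA.eq_zero_symm
  have hcartan : ∀ j, h A j ∈ cartan A := fun j => Submodule.subset_span ⟨j, rfl⟩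
  have hθh : ∀ j, θ (h A j) ≠ 0 := fun j h0 =>
    hh j ((theta_cartan hA.diag τ hXτ.diagramAut l (hcartan j)).2 h0)
  have hθθh : ∀ j, θ (θ (h A j)) ≠ 0 := fun j h0 =>
    hθh j ((theta_cartan hA.diag τ hXτ.diagramAut l
      (theta_cartan hA.diag τ hXτ.diagramAut l (hcartan j)).1).2 h0)
  have hτX : ∀ k ∈ X, τ k ∈ X := fun k => tau_mem hXτ hl
  have hτX' : ∀ k ∉ X, τ k ∉ X := fun k hk h1 => hk (hXτ.involutive k ▸ hτX _ h1)
  have hfmem : ∀ j, θ (f A j) ∈ rootSpace A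
      (simpleRoot (τ j) + (weylProd A l (simpleRoot (τ j)) - simpleRoot (τ j))) := by
    intro j
    rw [add_sub_cancel]
    have h1 := hwt (f_mem_rootSpace A j)
    rwa [map_neg, thetaRoot_simpleRoot, neg_neg] at h1
  have hsupp : ∀ j, ∀ k ∉ X, (weylProd A l (simpleRoot (τ j)) - simpleRoot (τ j)) k = 0 := by
    intro j k hk
    rw [Pi.sub_apply, weylProd_apply_of_notMem hl.1 _ hk, sub_self]
  -- Pairing `α_k` with the fixed vector `α_{τ(j)}` gives `d_k a_{k,τ(j)} = -d_{τ(k)}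
  -- a_{τ(k),τ(j)}`; the left side is at most 0 and the right side at least 0.
  have hk0 : ∀ j ∉ X, weylProd A l (simpleRoot (τ j)) - simpleRoot (τ j) = 0 →
      ∀ k ∈ X, A k (τ j) = 0 := by
    intro j hj hγ k hk
    have hfix : weylProd A l (simpleRoot (τ j)) = simpleRoot (τ j) := sub_eq_zero.1 hγ
    have h1 := rootForm_weylProd hd hA.diag l (simpleRoot k) (simpleRoot (τ j))
    have h2 : weylProd A l (simpleRoot k) = 0 - (1 : ℤ) • simpleRoot (τ k) := by
      rw [← hXτ.neg_longest l hl k hk]; simp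
    have h3 : rootForm A d 0 (simpleRoot (τ j)) = 0 := by simp [rootForm]
    rw [hfix, h2, rootForm_sub_smul_left, h3, rootForm_simpleRoot_left,
      rootForm_simpleRoot_left, mulVec_simpleRoot, mulVec_simpleRoot] at h1
    have hkne : k ≠ τ j := fun h => hτX' j hj (h ▸ hk)
    have hkne' : τ k ≠ τ j := fun h => hj (τ.injective h ▸ hk)
    have h4 : (A k (τ j) : ℚ) ≤ 0 := by exact_mod_cast hA.offDiag _ _ hkne
    have h5 : (A (τ k) (τ j) : ℚ) ≤ 0 := by exact_mod_cast hA.offDiag _ _ hkne'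
    have h6 := mul_nonneg_of_nonpos_of_nonpos (neg_nonpos.2 (hd0 (τ k)).le) h5
    have h7 : d k * (A k (τ j) : ℚ) = 0 := by
      have := mul_nonpos_of_nonneg_of_nonpos (hd0 k).le h4
      push_cast at h1
      linarith
    exact_mod_cast (mul_eq_zero.1 h7).resolve_left (hd0 k).ne'
  refine
    { map_lie := hlie
      diagramAut := hXτ.diagramAut
      involutive := hXτ.involutive
      tau_notMem := hτX'
      f_mem := hfmem
      support := hsupp
      eigen := ?_
      nonneg := ?_
      of_eq_zero := ?_
      tau_eq_zero := ?_
      theta_theta_f := ?_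
      of_eq_simpleRoot := ?_ }
  · intro k hk
    have he := hwt (e_mem_rootSpace A k)
    have hf := hwt (f_mem_rootSpace A k)
    rw [map_neg] at hf
    rw [thetaRoot_of_mem hXτ hl hk] at he hf
    obtain ⟨s, hs⟩ := mem_rootSpace_simpleRoot he
    obtain ⟨s', hs'⟩ := mem_rootSpace_neg_simpleRoot hf
    have h1 : θ (h A k) = (s * s') • h A k := by
      rw [← lie_e_f_same, hlie, hs, hs', smul_lie, lie_smul, smul_smul]
    have hs0 : s ≠ 0 := by
      rintro rfl
      exact hθh k (by rw [h1]; simp)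
    have he0 : e A k ≠ 0 := by
      intro h0
      exact hh k (by rw [← lie_e_f_same, h0, zero_lie])
    -- Comparing the two sides yields `2s = 2s · ss'`, whence `ss' = 1`.
    have h2 : θ ⁅h A k, e A k⁆ = ⁅θ (h A k), θ (e A k)⁆ := hlie _ _
    rw [lie_h_e_complex, map_smul, h1, hs, hA.diag, smul_lie, lie_smul, lie_h_e_complex, hA.diag,
      smul_smul, smul_smul, smul_smul, ← sub_eq_zero, ← sub_smul] at h2
    have h3 := (smul_eq_zero.1 h2).resolve_right he0
    have h4 : s * s' = 1 := by
      have h5 : (2 * s) * (1 - s * s') = 0 := by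
        push_cast at h3
        linear_combination h3
      have h6 := (mul_eq_zero.1 h5).resolve_left (mul_ne_zero two_ne_zero hs0)
      linear_combination -h6
    exact ⟨s, hs0, hs, by rw [hs', eq_inv_of_mul_eq_one_right h4]⟩
  · intro j hj k
    by_contra hneg
    -- The weight of `θ(f_j)` has coordinate 1 at `τ(j) ∉ X`, so a negative coordinate would
    -- annihilate it, and then `θ(h_j) = 0`.
    have h0 : θ (f A j) = 0 := by
      refine eq_zero_of_mixed (hfmem j) (i := τ j) (j := k) ?_ ?_
      · rw [Pi.add_apply, hsupp j _ (hτX' j hj)]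
        simp [simpleRoot]
      · have hkX : k ∈ X := by
          by_contra hk
          exact hneg (hsupp j k hk).ge
        have hkj : k ≠ τ j := fun h => hτX' j hj (h ▸ hkX)
        rw [Pi.add_apply]
        simp only [simpleRoot, Pi.single_eq_of_ne hkj, zero_add] at hneg ⊢
        exact not_le.1 hneg
    exact hθh j (by rw [← lie_e_f_same, hlie, h0, lie_zero])
  · intro j hj hγ
    have hk0 := hk0 j hj hγ
    have hse : ∀ k ∈ l, ⁅e A k, e A (τ j)⁆ = 0 ∧ ⁅f A k, f A (τ j)⁆ = 0 ∧
        ⁅f A k, e A (τ j)⁆ = 0 ∧ ⁅e A k, f A (τ j)⁆ = 0 := by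
      intro k hk
      have hkX := hl.1 k hk
      have hkne : k ≠ τ j := fun h => hτX' j hj (h ▸ hkX)
      refine ⟨?_, ?_, ?_, lie_e_f_ne A hkne⟩
      · simpa [hk0 k hkX] using serre_e A k (τ j)
      · simpa [hk0 k hkX] using serre_f A k (τ j)
      · rw [lie_f_e, if_neg hkne]
    refine ⟨fun k hk => ?_, ?_, ?_⟩
    · rw [← hXτ.diagramAut]; exact hk0 _ (hτX k hk)
    · rw [hθ, theta_f, AdWord_eq_self (fun k hk => (hse k hk).1) fun k hk => (hse k hk).2.2.1]
    · rw [hθ, theta_e, AdWord_eq_self (fun k hk => (hse k hk).2.2.2) fun k hk => (hse k hk).2.1]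
  · intro j hj hγ
    have hk1 : ∀ k ∈ X, A k j = 0 := fun k hk => by
      rw [← hXτ.diagramAut]; exact hk0 j hj hγ _ (hτX k hk)
    have hfix : ∀ l' : List I, (∀ k ∈ l', k ∈ X) →
        weylProd A l' (simpleRoot j) = simpleRoot j := by
      intro l' hl'
      induction l' with
      | nil => rw [weylProd_nil]
      | cons k l' ih =>
        rw [weylProd_cons, ih fun m hm => hl' m (by simp [hm]), simpleReflection_apply,
          mulVec_simpleRoot, hk1 k (hl' k (by simp)), zero_smul, sub_zero]
    rw [hXτ.involutive, hfix l hl.1, sub_self]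
  · intro i hi hτi
    have h1 := hwt (hfmem i)
    have h2 : thetaRoot A τ l
        (simpleRoot (τ i) + (weylProd A l (simpleRoot (τ i)) - simpleRoot (τ i))) =
        -simpleRoot i := by
      rw [map_add, thetaRoot_of_support hXτ hl (hsupp i), hτi, thetaRoot_simpleRoot, hτi]
      abel
    rw [h2] at h1
    obtain ⟨κ, hκ⟩ := mem_rootSpace_neg_simpleRoot h1
    refine ⟨κ, ?_, hκ⟩
    rintro rfl
    refine hθθh i ?_
    rw [← lie_e_f_same, hlie, hlie, hκ, zero_smul, lie_zero]
  · intro i hi hτi j hj hγ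
    have hw : weylProd A l (simpleRoot (τ i)) = simpleRoot i - (-1 : ℤ) • simpleRoot j := by
      rw [sub_eq_iff_eq_add] at hγ
      rw [hγ, hτi]; module
    refine ⟨?_, ?_⟩
    -- The vectors `α_i + α_j` and `α_i` have equal norm; expanding gives `d_j (a_{ji} + 1) = 0`.
    · have h1 := rootForm_weylProd hd hA.diag l (simpleRoot (τ i)) (simpleRoot (τ i))
      rw [hw, rootForm_sub_smul_left, rootForm_simpleRoot_left, rootForm_simpleRoot_left,
        rootForm_simpleRoot_left, Matrix.mulVec_sub, Matrix.mulVec_smul] at h1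
      simp only [Pi.sub_apply, Pi.smul_apply, mulVec_simpleRoot, hA.diag, hτi, smul_eq_mul] at h1
      push_cast at h1
      have h2 : d j * ((A j i : ℚ) + 1) = 0 := by
        linear_combination h1 / 2 - hd i j / 2
      have h3 := (mul_eq_zero.1 h2).resolve_left (hd0 j).ne'
      have h4 : (A j i : ℚ) = -1 := by linarith
      exact_mod_cast h4
    · refine hXτ.no_obstruction l hl j hj i hi ?_
      rw [thetaRoot_simpleRoot, hw]
      module

end SatakeTheta

/-! ### The multiplicative filtration of `𝔨_c` by word length. -/

section Filtration

variable {I : Type*} [Fintype I] [DecidableEq I] {A : Matrix I I ℤ} {X : Finset I}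
  {τ : Equiv.Perm I} {γ : I → I → ℤ} {θ : KM A →ₗ[ℂ] KM A} {c : I → ℂ}

theorem lie_eq_zero_of_mem_lieSpan {L : Type*} [LieRing L] [LieAlgebra ℂ L] {S : Set L} {y : L}
    (hS : ∀ s ∈ S, ⁅s, y⁆ = 0) {x : L} (hx : x ∈ LieSubalgebra.lieSpan ℂ L S) : ⁅x, y⁆ = 0 := by
  induction hx using LieSubalgebra.lieSpan_induction with
  | mem x hx => exact hS x hx
  | zero => exact zero_lie _
  | add x z _ _ hx hz => rw [add_lie, hx, hz, add_zero]
  | smul a x _ hx => rw [smul_lie, hx, smul_zero]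
  | lie x z _ _ hx hz => rw [lie_lie, hx, hz, lie_zero, lie_zero, sub_zero]

theorem exists_lie_eq_smul_of_mem_cartan {t x : KM A} (ht : t ∈ cartan A) {β : I → ℤ}
    (hx : x ∈ rootSpace A β) : ∃ a : ℂ, ⁅t, x⁆ = a • x := by
  induction ht using Submodule.span_induction with
  | mem t ht => obtain ⟨i, rfl⟩ := ht; exact ⟨_, lie_h_of_mem_rootSpace hx i⟩
  | zero => exact ⟨0, by simp⟩
  | add s t _ _ hs ht =>
    obtain ⟨a, ha⟩ := hs
    obtain ⟨b, hb⟩ := ht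
    exact ⟨a + b, by rw [add_lie, ha, hb, add_smul]⟩
  | smul r t _ ht =>
    obtain ⟨a, ha⟩ := ht
    exact ⟨r * a, by rw [smul_lie, ha, smul_smul]⟩

theorem lie_cartan_cartan {s t : KM A} (hs : s ∈ cartan A) (ht : t ∈ cartan A) : ⁅s, t⁆ = 0 := by
  induction ht using Submodule.span_induction with
  | mem t ht =>
    obtain ⟨j, rfl⟩ := ht
    induction hs using Submodule.span_induction with
    | mem s hs => obtain ⟨i, rfl⟩ := hs; exact lie_h_h A i j
    | zero => simp
    | add x y _ _ hx hy => rw [add_lie, hx, hy, add_zero]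
    | smul a x _ hx => rw [smul_lie, hx, smul_zero]
  | zero => simp
  | add x y _ _ hx hy => rw [lie_add, hx, hy, add_zero]
  | smul a x _ hx => rw [lie_smul, hx, smul_zero]

namespace IsSatakeTheta

theorem theta_h (hθ : IsSatakeTheta A X τ γ θ) {k : I} (hk : k ∈ X) : θ (h A k) = h A k := by
  obtain ⟨s, hs, he, hf⟩ := hθ.eigen k hk
  rw [← lie_e_f_same, hθ.map_lie, he, hf, smul_lie, lie_smul, smul_smul, mul_inv_cancel₀ hs,
    one_smul]

theorem h_mem_fixed (hθ : IsSatakeTheta A X τ γ θ) {k : I} (hk : k ∈ X) :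
    h A k ∈ fixedIn (cartan A) θ :=
  ⟨Submodule.subset_span ⟨k, rfl⟩, hθ.theta_h hk⟩

theorem lie_nPlus_f {x : KM A} (hx : x ∈ nPlus A X) {j : I} (hj : j ∉ X) : ⁅x, f A j⁆ = 0 := by
  refine lie_eq_zero_of_mem_lieSpan ?_ hx
  rintro _ ⟨k, hk, rfl⟩
  exact lie_e_f_ne A fun h => hj (h ▸ hk)

/-- For `k ∈ X`, applying `θ` to `[e_k, f_j] = 0` only rescales `e_k`. -/
theorem lie_nPlus_theta_f (hθ : IsSatakeTheta A X τ γ θ) {x : KM A} (hx : x ∈ nPlus A X) {j : I}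
    (hj : j ∉ X) : ⁅x, θ (f A j)⁆ = 0 := by
  refine lie_eq_zero_of_mem_lieSpan ?_ hx
  rintro _ ⟨k, hk, rfl⟩
  obtain ⟨s, hs, he, -⟩ := hθ.eigen k hk
  have h1 : θ ⁅e A k, f A j⁆ = ⁅θ (e A k), θ (f A j)⁆ := hθ.map_lie _ _
  have hkj : k ≠ j := fun h => hj (h ▸ hk)
  rw [lie_e_f_ne A hkj, map_zero, he, smul_lie] at h1
  exact (smul_eq_zero.1 h1.symm).resolve_left hs

end IsSatakeTheta

theorem gGen_of_mem {j : I} (hj : j ∈ X) : gGen A X θ c j = f A j := if_pos hj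

theorem gGen_of_notMem {j : I} (hj : j ∉ X) : gGen A X θ c j = f A j + c j • θ (f A j) := if_neg hj

namespace IsSatakeTheta

theorem lie_nPlus_gGen (hθ : IsSatakeTheta A X τ γ θ) {x : KM A} (hx : x ∈ nPlus A X) {j : I}
    (hj : j ∉ X) : ⁅x, gGen A X θ c j⁆ = 0 := by
  rw [gGen_of_notMem hj, lie_add, lie_smul, lie_nPlus_f hx hj, hθ.lie_nPlus_theta_f hx hj]
  simp

theorem lie_e_gGen (hθ : IsSatakeTheta A X τ γ θ) {k : I} (hk : k ∈ X) (j : I) :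
    ⁅e A k, gGen A X θ c j⁆ = if k = j then h A k else 0 := by
  by_cases hj : j ∈ X
  · rw [gGen_of_mem hj, lie_e_f]
  · have hkj : k ≠ j := fun h => hj (h ▸ hk)
    rw [hθ.lie_nPlus_gGen (LieSubalgebra.subset_lieSpan ⟨k, hk, rfl⟩) hj, if_neg hkj]

/-- As `θ(t) = t`, the element `t` acts on `f_j` and on `θ(f_j)` by the same scalar. -/
theorem lie_fixed_gGen (hθ : IsSatakeTheta A X τ γ θ) {t : KM A} (ht : t ∈ fixedIn (cartan A) θ)
    (j : I) : ∃ a : ℂ, ⁅t, gGen A X θ c j⁆ = a • gGen A X θ c j := by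
  obtain ⟨a, ha⟩ := exists_lie_eq_smul_of_mem_cartan ht.1 (f_mem_rootSpace A j)
  refine ⟨a, ?_⟩
  by_cases hj : j ∈ X
  · rw [gGen_of_mem hj, ha]
  · have h1 : θ ⁅t, f A j⁆ = ⁅θ t, θ (f A j)⁆ := hθ.map_lie _ _
    have h2 : θ t = t := ht.2
    rw [ha, map_smul, h2] at h1
    rw [gGen_of_notMem hj, lie_add, lie_smul, ha, ← h1]
    module

end IsSatakeTheta

variable (A X θ c) in
/-- The filtration of `𝔨_c` by the length of words in the generators `g_i`. -/
def kFiltration (m : ℕ) : Submodule ℂ (KM A) :=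
  ((nPlus A X).toSubmodule ⊔ fixedIn (cartan A) θ) ⊔
    Submodule.span ℂ (iterBracket (gGen A X θ c) '' {w | w ≠ [] ∧ w.length ≤ m})

theorem kFiltration_mono {m n : ℕ} (hmn : m ≤ n) :
    kFiltration A X θ c m ≤ kFiltration A X θ c n :=
  sup_le_sup_left (Submodule.span_mono (Set.image_mono (fun w hw => by
    exact ⟨hw.1, hw.2.trans hmn⟩))) _

theorem nPlus_le_kFiltration (m : ℕ) : (nPlus A X).toSubmodule ≤ kFiltration A X θ c m :=
  le_sup_of_le_left le_sup_left

theorem fixed_le_kFiltration (m : ℕ) : fixedIn (cartan A) θ ≤ kFiltration A X θ c m :=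
  le_sup_of_le_left le_sup_right

theorem iterBracket_mem_kFiltration {w : List I} (hw : w ≠ []) {m : ℕ} (hm : w.length ≤ m) :
    iterBracket (gGen A X θ c) w ∈ kFiltration A X θ c m :=
  Submodule.mem_sup_right (Submodule.subset_span ⟨w, ⟨hw, hm⟩, rfl⟩)

theorem gGen_mem_kFiltration (j : I) : gGen A X θ c j ∈ kFiltration A X θ c 1 :=
  iterBracket_mem_kFiltration (w := [j]) (by simp) le_rfl

theorem lie_mem_of_mem_kFiltration {m : ℕ} {x : KM A} {V : Submodule ℂ (KM A)}
    (h1 : ∀ y ∈ nPlus A X, ⁅x, y⁆ ∈ V) (h2 : ∀ y ∈ fixedIn (cartan A) θ, ⁅x, y⁆ ∈ V)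
    (h3 : ∀ w, w ≠ [] → w.length ≤ m → ⁅x, iterBracket (gGen A X θ c) w⁆ ∈ V) {y : KM A}
    (hy : y ∈ kFiltration A X θ c m) : ⁅x, y⁆ ∈ V := by
  have : kFiltration A X θ c m ≤ V.comap (LieAlgebra.ad ℂ (KM A) x) := by
    refine sup_le (sup_le h1 h2) (Submodule.span_le.2 ?_)
    rintro _ ⟨w, ⟨hw, hwm⟩, rfl⟩
    exact h3 w hw hwm
  exact this hy

theorem lie_mem_nPlus_of_mem_cartan {t x : KM A} (ht : t ∈ cartan A) (hx : x ∈ nPlus A X) :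
    ⁅t, x⁆ ∈ nPlus A X := by
  have hx' : x ∈ (nPlus A X).toSubmodule := hx
  rw [nPlus_eq_span] at hx'
  refine lie_mem_of_mem_span (V := (nPlus A X).toSubmodule) ?_ hx'
  rintro _ ⟨w, ⟨hw, hwX⟩, rfl⟩
  obtain ⟨a, ha⟩ := exists_lie_eq_smul_of_mem_cartan ht (iterBracket_e_mem_rootSpace hw)
  rw [ha]
  exact Submodule.smul_mem _ _ (iterBracket_mem_lieSpan hw fun i hi =>
    LieSubalgebra.subset_lieSpan ⟨i, hwX i hi, rfl⟩)

theorem e_mem_nPlus {k : I} (hk : k ∈ X) : e A k ∈ nPlus A X :=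
  LieSubalgebra.subset_lieSpan ⟨k, hk, rfl⟩

namespace IsSatakeTheta

theorem lie_fixed_mem_kFiltration (hθ : IsSatakeTheta A X τ γ θ) {t : KM A}
    (ht : t ∈ fixedIn (cartan A) θ) {m : ℕ} {y : KM A} (hy : y ∈ kFiltration A X θ c m) :
    ⁅t, y⁆ ∈ kFiltration A X θ c m := by
  refine lie_mem_of_mem_kFiltration (fun y hy => ?_) (fun y hy => ?_) (fun w hw hwm => ?_) hy
  · exact nPlus_le_kFiltration m (lie_mem_nPlus_of_mem_cartan ht.1 hy)
  · rw [lie_cartan_cartan ht.1 hy.1]; exact Submodule.zero_mem _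
  · choose a ha using hθ.lie_fixed_gGen (c := c) ht
    rw [lie_iterBracket_of_eigen ha hw]
    exact Submodule.smul_mem _ _ (iterBracket_mem_kFiltration hw hwm)

/-- For `j ∈ X`, `ad f_j` maps `𝔫⁺_X` to `𝔫⁺_X + 𝔥^θ`. -/
theorem lie_f_nPlus (hθ : IsSatakeTheta A X τ γ θ) {j : I} {x : KM A} (hj : j ∈ X)
    (hx : x ∈ nPlus A X) : ⁅f A j, x⁆ ∈ (nPlus A X).toSubmodule ⊔ fixedIn (cartan A) θ := by
  have hx' : x ∈ (nPlus A X).toSubmodule := hx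
  rw [nPlus_eq_span] at hx'
  refine lie_mem_of_mem_span ?_ hx'
  rintro _ ⟨w, ⟨hw, hwX⟩, rfl⟩
  have hh : -h A j ∈ fixedIn (cartan A) θ := Submodule.neg_mem _ (hθ.h_mem_fixed hj)
  induction w, hw using word_induction with
  | single k =>
    show ⁅f A j, e A k⁆ ∈ _
    rw [lie_f_e]
    split_ifs
    · exact Submodule.mem_sup_right hh
    · exact Submodule.zero_mem _
  | cons k w hw ih =>
    have hk : k ∈ X := hwX k (by simp)
    have hwX' : ∀ i ∈ w, i ∈ (X : Set I) := fun i hi => hwX i (by simp [hi])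
    have hew : iterBracket (e A) w ∈ nPlus A X := iterBracket_mem_lieSpan hw fun i hi =>
      e_mem_nPlus (hwX' i hi)
    rw [iterBracket_cons _ _ hw, leibniz_lie]
    refine Submodule.add_mem _ ?_ ?_
    · rw [lie_f_e]
      split_ifs
      · exact Submodule.mem_sup_left (lie_mem_nPlus_of_mem_cartan hh.1 hew)
      · rw [zero_lie]; exact Submodule.zero_mem _
    · obtain ⟨a, ha, b, hb, hab⟩ := Submodule.mem_sup.1 (ih hwX')
      rw [← hab, lie_add]
      refine Submodule.mem_sup_left (Submodule.add_mem _ ((nPlus A X).lie_mem (e_mem_nPlus hk) ha) ?_)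
      obtain ⟨r, hr⟩ := exists_lie_eq_smul_of_mem_cartan hb.1 (e_mem_rootSpace A k)
      rw [← lie_skew, hr]
      exact Submodule.neg_mem _ (Submodule.smul_mem _ _ (e_mem_nPlus hk))

theorem lie_gGen_mem_kFiltration (hθ : IsSatakeTheta A X τ γ θ) (j : I) {m : ℕ} {y : KM A}
    (hy : y ∈ kFiltration A X θ c m) : ⁅gGen A X θ c j, y⁆ ∈ kFiltration A X θ c (m + 1) := by
  refine lie_mem_of_mem_kFiltration (fun y hy => ?_) (fun y hy => ?_) (fun w hw hwm => ?_) hy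
  · by_cases hj : j ∈ X
    · rw [gGen_of_mem hj]
      exact Submodule.mem_sup_left (hθ.lie_f_nPlus hj hy)
    · rw [← lie_skew, hθ.lie_nPlus_gGen hy hj, neg_zero]
      exact Submodule.zero_mem _
  · obtain ⟨a, ha⟩ := hθ.lie_fixed_gGen (c := c) hy j
    rw [← lie_skew, ha]
    exact Submodule.neg_mem _ (Submodule.smul_mem _ _
      (kFiltration_mono (by omega) (gGen_mem_kFiltration j)))
  · rw [← iterBracket_cons _ _ hw]
    exact iterBracket_mem_kFiltration (by simp) (by simpa using hwm)

/-- Passing `e_k` through a word, the only nonzero bracket is `[e_k, g_k] = h_k`, which rescales the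
remaining letters; so the length does not grow. -/
theorem lie_e_mem_kFiltration (hθ : IsSatakeTheta A X τ γ θ) {k : I} (hk : k ∈ X) {m : ℕ} {y : KM A}
    (hy : y ∈ kFiltration A X θ c m) : ⁅e A k, y⁆ ∈ kFiltration A X θ c m := by
  refine lie_mem_of_mem_kFiltration (fun y hy => ?_) (fun y hy => ?_) (fun w hw hwm => ?_) hy
  · exact nPlus_le_kFiltration m ((nPlus A X).lie_mem (e_mem_nPlus hk) hy)
  · obtain ⟨r, hr⟩ := exists_lie_eq_smul_of_mem_cartan hy.1 (e_mem_rootSpace A k)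
    rw [← lie_skew, hr]
    exact Submodule.neg_mem _ (Submodule.smul_mem _ _ (nPlus_le_kFiltration m (e_mem_nPlus hk)))
  · refine kFiltration_mono hwm ?_
    clear hwm
    induction w, hw using word_induction with
    | single j =>
      show ⁅e A k, gGen A X θ c j⁆ ∈ _
      rw [hθ.lie_e_gGen hk]
      split_ifs
      · exact fixed_le_kFiltration _ (hθ.h_mem_fixed hk)
      · exact Submodule.zero_mem _
    | cons j w hw ih =>
      rw [iterBracket_cons _ _ hw, leibniz_lie]
      refine Submodule.add_mem _ ?_ (hθ.lie_gGen_mem_kFiltration j ih)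
      rw [hθ.lie_e_gGen hk]
      split_ifs
      · exact hθ.lie_fixed_mem_kFiltration (hθ.h_mem_fixed hk)
          (iterBracket_mem_kFiltration hw (by simp))
      · rw [zero_lie]; exact Submodule.zero_mem _

theorem lie_nPlus_mem_kFiltration (hθ : IsSatakeTheta A X τ γ θ) {x : KM A} (hx : x ∈ nPlus A X)
    {m : ℕ} {y : KM A} (hy : y ∈ kFiltration A X θ c m) : ⁅x, y⁆ ∈ kFiltration A X θ c m := by
  induction hx using LieSubalgebra.lieSpan_induction generalizing y with
  | mem x hx => obtain ⟨k, hk, rfl⟩ := hx; exact hθ.lie_e_mem_kFiltration hk hy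
  | zero => rw [zero_lie]; exact Submodule.zero_mem _
  | add x z _ _ hx hz => rw [add_lie]; exact Submodule.add_mem _ (hx hy) (hz hy)
  | smul a x _ hx => rw [smul_lie]; exact Submodule.smul_mem _ _ (hx hy)
  | lie x z _ _ hx hz => rw [lie_lie]; exact Submodule.sub_mem _ (hx (hz hy)) (hz (hx hy))

/-- A bracket word acts through commutators of the operators `ad g_i`, each of which raises the
degree by at most one. -/
theorem lie_mem_kFiltration (hθ : IsSatakeTheta A X τ γ θ) {a b : ℕ} {x y : KM A}
    (hx : x ∈ kFiltration A X θ c a) (hy : y ∈ kFiltration A X θ c b) :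
    ⁅x, y⁆ ∈ kFiltration A X θ c (a + b) := by
  have key : ∀ w, w ≠ [] → ∀ b, ∀ y ∈ kFiltration A X θ c b,
      ⁅iterBracket (gGen A X θ c) w, y⁆ ∈ kFiltration A X θ c (w.length + b) := by
    intro w hw
    induction w, hw using word_induction with
    | single i =>
      intro b y hy
      exact kFiltration_mono (by simp [add_comm]) (hθ.lie_gGen_mem_kFiltration i hy)
    | cons i w hw ih =>
      intro b y hy
      rw [iterBracket_cons _ _ hw, lie_lie]
      refine Submodule.sub_mem _ ?_ ?_
      · exact kFiltration_mono (by rw [List.length_cons]; omega) (hθ.lie_gGen_mem_kFiltration i (ih b y hy))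
      · exact kFiltration_mono (by rw [List.length_cons]; omega)
          (ih (b + 1) _ (hθ.lie_gGen_mem_kFiltration i hy))
  rw [← lie_skew]
  refine Submodule.neg_mem _
    (lie_mem_of_mem_kFiltration (fun x hx => ?_) (fun x hx => ?_) (fun w hw hwm => ?_) hx)
  · rw [← lie_skew]
    exact Submodule.neg_mem _ (kFiltration_mono (by omega) (hθ.lie_nPlus_mem_kFiltration hx hy))
  · rw [← lie_skew]
    exact Submodule.neg_mem _ (kFiltration_mono (by omega) (hθ.lie_fixed_mem_kFiltration hx hy))
  · rw [← lie_skew]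
    exact Submodule.neg_mem _ (kFiltration_mono (by omega) (key w hw b y hy))

end IsSatakeTheta

end Filtration

/-! ### Powers of `ad (x + y)` for commuting `x` and `y`. -/

section LieAux

variable {L : Type*} [LieRing L] [LieAlgebra ℂ L]

theorem commute_ad {x y : L} (hxy : ⁅x, y⁆ = 0) :
    Commute (LieAlgebra.ad ℂ L x) (LieAlgebra.ad ℂ L y) := by
  refine LinearMap.ext fun v => ?_
  show ⁅x, ⁅y, v⁆⁆ = ⁅y, ⁅x, v⁆⁆
  rw [leibniz_lie, hxy, zero_lie, zero_add]

/-- The binomial theorem for the commuting operators `ad x` and `ad y`: it is enough to control each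
mixed term. -/
theorem ad_add_pow_mem {x y v : L} (hxy : ⁅x, y⁆ = 0) {n : ℕ} {V : Submodule ℂ L}
    (hV : ∀ m ≤ n, ((LieAlgebra.ad ℂ L x) ^ m) (((LieAlgebra.ad ℂ L y) ^ (n - m)) v) ∈ V) :
    ((LieAlgebra.ad ℂ L (x + y)) ^ n) v ∈ V := by
  rw [map_add, (commute_ad hxy).add_pow, LinearMap.sum_apply]
  refine V.sum_mem fun m hm => ?_
  rw [← Nat.cast_comm, ← nsmul_eq_mul, LinearMap.smul_apply, Module.End.mul_apply]
  exact V.smul_of_tower_mem _ (hV m (by simpa [Nat.lt_succ_iff] using hm))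

theorem ad_pow_comm {x y v : L} (hxy : ⁅x, y⁆ = 0) (m n : ℕ) :
    ((LieAlgebra.ad ℂ L x) ^ m) (((LieAlgebra.ad ℂ L y) ^ n) v) =
      ((LieAlgebra.ad ℂ L y) ^ n) (((LieAlgebra.ad ℂ L x) ^ m) v) :=
  LinearMap.congr_fun ((commute_ad hxy).pow_pow m n).eq v

theorem ad_pow_mem {x v : L} {V : Submodule ℂ L} (hv : v ∈ V) (hx : ⁅x, v⁆ = 0) (n : ℕ) :
    ((LieAlgebra.ad ℂ L x) ^ n) v ∈ V ∧ (n ≠ 0 → ((LieAlgebra.ad ℂ L x) ^ n) v = 0) := by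
  cases n with
  | zero => simpa using hv
  | succ n =>
    have : ((LieAlgebra.ad ℂ L x) ^ (n + 1)) v = 0 := by
      rw [pow_succ, Module.End.mul_apply, LieAlgebra.ad_apply, hx, map_zero]
    exact ⟨by rw [this]; exact V.zero_mem, fun _ => this⟩

theorem ad_pow_apply_succ (x v : L) (n : ℕ) :
    ((LieAlgebra.ad ℂ L x) ^ (n + 1)) v = ⁅x, ((LieAlgebra.ad ℂ L x) ^ n) v⁆ := by
  rw [pow_succ', Module.End.mul_apply, LieAlgebra.ad_apply]

end LieAux

/-! ### Serre relations for `i ∈ X`, and for `τ(i) ≠ i` by commuting summands. -/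

section Serre

variable {I : Type*} [Fintype I] [DecidableEq I] {A : Matrix I I ℤ} {X : Finset I}
  {τ : Equiv.Perm I} {γ : I → I → ℤ} {θ : KM A →ₗ[ℂ] KM A} {c : I → ℂ}

theorem ad_pow_mem_rootSpace {β δ : I → ℤ} {x y : KM A} (hx : x ∈ rootSpace A β)
    (hy : y ∈ rootSpace A δ) (n : ℕ) :
    ((LieAlgebra.ad ℂ (KM A) x) ^ n) y ∈ rootSpace A ((n : ℤ) • β + δ) := by
  induction n with
  | zero => simpa using hy
  | succ n ih =>
    rw [ad_pow_apply_succ]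
    have := lie_mem_rootSpace hx ih
    rwa [← add_assoc, show β + (n : ℤ) • β = ((n + 1 : ℕ) : ℤ) • β by push_cast; module] at this

theorem serre_f_pow (i j : I) :
    ((LieAlgebra.ad ℂ (KM A) (f A i)) ^ ((-A i j).toNat + 1)) (f A j) = 0 := by
  rw [← serreElt_eq (A := A) (f A) i j]
  exact serre_f A i j

namespace IsSatakeTheta

theorem map_ad_pow (hθ : IsSatakeTheta A X τ γ θ) (x y : KM A) (n : ℕ) :
    θ (((LieAlgebra.ad ℂ (KM A) x) ^ n) y) = ((LieAlgebra.ad ℂ (KM A) (θ x)) ^ n) (θ y) := by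
  induction n with
  | zero => rfl
  | succ n ih => rw [ad_pow_apply_succ, ad_pow_apply_succ, hθ.map_lie, ih]

theorem theta_serre (hθ : IsSatakeTheta A X τ γ θ) (i j : I) :
    ((LieAlgebra.ad ℂ (KM A) (θ (f A i))) ^ ((-A i j).toNat + 1)) (θ (f A j)) = 0 := by
  rw [← hθ.map_ad_pow, serre_f_pow, map_zero]

theorem f_eq_smul (hθ : IsSatakeTheta A X τ γ θ) {k : I} (hk : k ∈ X) :
    ∃ s : ℂ, f A k = s • θ (f A k) := by
  obtain ⟨s, hs, -, hf⟩ := hθ.eigen k hk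
  exact ⟨s, by rw [hf, smul_smul, mul_inv_cancel₀ hs, one_smul]⟩

theorem theta_serre_of_mem (hθ : IsSatakeTheta A X τ γ θ) (i : I) {j : I} (hj : j ∈ X) (a : ℂ) :
    ((LieAlgebra.ad ℂ (KM A) (a • θ (f A i))) ^ ((-A i j).toNat + 1)) (f A j) = 0 := by
  obtain ⟨s, hs⟩ := hθ.f_eq_smul hj
  rw [hs, map_smul, ad_smul_pow, hθ.theta_serre, smul_zero, smul_zero]

/-- The Serre relations with `i ∈ X` hold for the `g_i`. -/
theorem serreElt_gGen_of_mem (hθ : IsSatakeTheta A X τ γ θ) {i : I} (hi : i ∈ X) (j : I) :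
    serreElt A (gGen A X θ c) i j = 0 := by
  rw [serreElt_eq, gGen_of_mem hi]
  by_cases hj : j ∈ X
  · rw [gGen_of_mem hj, serre_f_pow]
  · obtain ⟨s, hs⟩ := hθ.f_eq_smul hi
    rw [gGen_of_notMem hj, map_add, serre_f_pow, zero_add, map_smul, hs, ad_smul_pow,
      hθ.theta_serre, smul_zero, smul_zero]

theorem z_mem (hθ : IsSatakeTheta A X τ γ θ) (i : I) (a : ℂ) :
    a • θ (f A i) ∈ rootSpace A (simpleRoot (τ i) + γ i) :=
  Submodule.smul_mem _ _ (hθ.f_mem i)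

theorem lie_f_z (hθ : IsSatakeTheta A X τ γ θ) {i : I} (hi : i ∉ X) (hτi : τ i ≠ i) (a : ℂ) :
    ⁅f A i, a • θ (f A i)⁆ = 0 := by
  refine eq_zero_of_mixed (lie_mem_rootSpace (f_mem_rootSpace A i) (hθ.z_mem i a)) (i := τ i)
    (j := i) ?_ ?_
  · simp [simpleRoot, hτi, hθ.support i _ (hθ.tau_notMem i hi)]
  · simp [simpleRoot, hτi.symm, hθ.support i _ hi]

/-- The Serre relation for `i ∉ X`, `τ(i) ≠ i`, `j ≠ τ(i)`. -/
theorem serreElt_gGen_of_tau_ne (hθ : IsSatakeTheta A X τ γ θ) {i j : I} (hi : i ∉ X)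
    (hτi : τ i ≠ i) (hji : j ≠ i) (hjτ : j ≠ τ i) : serreElt A (gGen A X θ c) i j = 0 := by
  have hτiX := hθ.tau_notMem i hi
  have hγi := hθ.support i _ hi
  have hγτ := hθ.support i _ hτiX
  rw [serreElt_eq, gGen_of_notMem hi]
  set n := (-A i j).toNat + 1 with hn
  have hxy := hθ.lie_f_z hi hτi (c i)
  -- Mixed terms are positive at `τ(i)` and negative at `i`, and for `m = 0`, `j ∉ X` the sign
  -- change is between `τ(i)` and `j`. What is left is the Serre relation for the `f`'s or, when `j
  -- ∈ X`, its image under `θ` up to a scalar.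
  have hf : ((LieAlgebra.ad ℂ (KM A) (f A i + c i • θ (f A i))) ^ n) (f A j) = 0 := by
    refine (Submodule.mem_bot ℂ).1 (ad_add_pow_mem hxy fun m hm => (Submodule.mem_bot ℂ).2 ?_)
    rcases Nat.eq_or_lt_of_le hm with rfl | hlt
    · rw [Nat.sub_self, pow_zero, Module.End.one_apply, hn, serre_f_pow]
    have hwt := ad_pow_mem_rootSpace (f_mem_rootSpace A i)
      (ad_pow_mem_rootSpace (hθ.z_mem i (c i)) (f_mem_rootSpace A j) (n - m)) m
    have hpos : (0 : ℤ) < ((n - m : ℕ) : ℤ) := by omega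
    rcases Nat.eq_zero_or_pos m with rfl | hm0
    · by_cases hj : j ∈ X
      · rw [pow_zero, Module.End.one_apply, Nat.sub_zero, hn, hθ.theta_serre_of_mem i hj]
      · refine eq_zero_of_mixed hwt (i := τ i) (j := j) ?_ ?_
        · simpa [simpleRoot, Pi.single_apply, hτi, hjτ.symm, hγτ] using hpos
        · simp [simpleRoot, hjτ, hθ.support i _ hj]
    · refine eq_zero_of_mixed hwt (i := τ i) (j := i) ?_ ?_
      · simpa [simpleRoot, Pi.single_apply, hτi, hjτ.symm, hγτ] using hpos
      · simpa [simpleRoot, Pi.single_apply, hτi.symm, hji.symm, hγi] using hm0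
  by_cases hj : j ∈ X
  · rw [gGen_of_mem hj, hf]
  rw [gGen_of_notMem hj, map_add, hf, zero_add, map_smul]
  refine smul_eq_zero_of_right _ ?_
  refine (Submodule.mem_bot ℂ).1 (ad_add_pow_mem hxy fun m hm => (Submodule.mem_bot ℂ).2 ?_)
  rcases Nat.eq_zero_or_pos m with rfl | hm0
  · rw [pow_zero, Module.End.one_apply, Nat.sub_zero, ad_smul_pow, hn, hθ.theta_serre, smul_zero]
  have hτji : τ j ≠ i := fun h => hjτ (by rw [← h, hθ.involutive])
  have hτij : τ i ≠ τ j := fun h => hji (τ.injective h).symm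
  have hwt := ad_pow_mem_rootSpace (f_mem_rootSpace A i)
    (ad_pow_mem_rootSpace (hθ.z_mem i (c i)) (hθ.f_mem j) (n - m)) m
  refine eq_zero_of_mixed hwt (i := τ j) (j := i) ?_ ?_
  · simp [simpleRoot, hτji, hτij.symm, hθ.support i _ (hθ.tau_notMem j hj),
      hθ.support j _ (hθ.tau_notMem j hj)]
  · simpa [simpleRoot, Pi.single_apply, hτi.symm, hτji.symm, hγi, hθ.support j _ hi] using hm0

theorem exists_pos (hθ : IsSatakeTheta A X τ γ θ) {i : I} (hi : i ∉ X) (hγ : γ i ≠ 0) :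
    ∃ k ∈ X, 0 < γ i k := by
  by_contra! hle
  refine hγ (funext fun k => ?_)
  by_cases hk : k ∈ X
  · exact le_antisymm (hle k hk) (hθ.nonneg i hi k)
  · exact hθ.support i k hk

theorem mem_nPlus_of_weight (hθ : IsSatakeTheta A X τ γ θ) {i : I} (hi : i ∉ X) (hγ : γ i ≠ 0)
    {x : KM A} (hx : x ∈ rootSpace A (γ i)) : x ∈ nPlus A X := by
  obtain ⟨k, -, hk⟩ := hθ.exists_pos hi hγ
  exact mem_nPlus_of_support hx hk (hθ.support i)

theorem lie_f_nPlus_eq_zero {i : I} (hi : i ∉ X) {x : KM A} (hx : x ∈ nPlus A X) :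
    ⁅f A i, x⁆ = 0 := by
  rw [← lie_skew, lie_nPlus_f hx hi, neg_zero]

theorem lie_z_nPlus_eq_zero (hθ : IsSatakeTheta A X τ γ θ) {i : I} (hi : i ∉ X) (a : ℂ) {x : KM A}
    (hx : x ∈ nPlus A X) : ⁅a • θ (f A i), x⁆ = 0 := by
  rw [← lie_skew, lie_smul, hθ.lie_nPlus_theta_f hx hi, smul_zero, neg_zero]

/-- The Serre relation for `j = τ(i) ≠ i` when `X(i)` is nonempty. -/
theorem serreElt_gGen_tau_mem_nPlus (hθ : IsSatakeTheta A X τ γ θ) {i : I} (hi : i ∉ X)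
    (hτi : τ i ≠ i) (hγ : γ i ≠ 0) : serreElt A (gGen A X θ c) i (τ i) ∈ nPlus A X := by
  have hτiX := hθ.tau_notMem i hi
  have hγ' : γ (τ i) ≠ 0 := fun h => hγ (by
    have := hθ.tau_eq_zero _ hτiX h
    rwa [hθ.involutive] at this)
  rw [serreElt_eq, gGen_of_notMem hi, gGen_of_notMem hτiX]
  set n := (-A i (τ i)).toNat + 1 with hn
  have hxy := hθ.lie_f_z hi hτi (c i)
  rw [map_add]
  refine (nPlus A X).add_mem ?_ ?_
  · refine ad_add_pow_mem (V := (nPlus A X).toSubmodule) hxy fun m hm => ?_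
    rcases Nat.eq_or_lt_of_le hm with rfl | hlt
    · rw [Nat.sub_self, pow_zero, Module.End.one_apply, hn, serre_f_pow]
      exact Submodule.zero_mem _
    -- The weight is `γ_i`, supported on `X`. Both `ad f_i` and `ad θ(f_i)` annihilate `𝔫⁺_X`, so
    -- further applications stay inside it.
    have hu : ⁅c i • θ (f A i), f A (τ i)⁆ ∈ nPlus A X := by
      refine hθ.mem_nPlus_of_weight hi hγ ?_
      have := lie_mem_rootSpace (hθ.z_mem i (c i)) (f_mem_rootSpace A (τ i))
      rwa [show simpleRoot (τ i) + γ i + -simpleRoot (τ i) = γ i by abel] at this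
    obtain ⟨p, hp⟩ := Nat.exists_eq_add_of_lt hlt
    have hp' : n - m = p + 1 := by omega
    rw [hp', pow_succ, Module.End.mul_apply, LieAlgebra.ad_apply]
    have h1 := (ad_pow_mem (V := (nPlus A X).toSubmodule) hu
      (hθ.lie_z_nPlus_eq_zero hi (c i) hu) p).1
    exact (ad_pow_mem h1 (lie_f_nPlus_eq_zero hi h1) m).1
  · rw [map_smul]
    refine (nPlus A X).smul_mem _ ?_
    refine ad_add_pow_mem (V := (nPlus A X).toSubmodule) hxy fun m hm => ?_
    rw [ad_pow_comm hxy]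
    rcases Nat.eq_zero_or_pos m with rfl | hm0
    · rw [pow_zero, Module.End.one_apply, Nat.sub_zero, ad_smul_pow, hn, hθ.theta_serre, smul_zero]
      exact Submodule.zero_mem _
    have hv : ⁅f A i, θ (f A (τ i))⁆ ∈ nPlus A X := by
      refine hθ.mem_nPlus_of_weight hτiX hγ' ?_
      have := lie_mem_rootSpace (f_mem_rootSpace A i) (hθ.f_mem (τ i))
      rwa [hθ.involutive, neg_add_cancel_left] at this
    obtain ⟨p, rfl⟩ := Nat.exists_eq_add_of_lt hm0
    rw [zero_add, pow_succ, Module.End.mul_apply, LieAlgebra.ad_apply]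
    have h1 := (ad_pow_mem (V := (nPlus A X).toSubmodule) hv (lie_f_nPlus_eq_zero hi hv) p).1
    exact (ad_pow_mem h1 (hθ.lie_z_nPlus_eq_zero hi (c i) h1) _).1

end IsSatakeTheta

end Serre

/-! ### Serre relations with `X(i)` empty, or with `τ(i) = i` and `j ∉ X`. -/

section Serre

variable {I : Type*} [Fintype I] [DecidableEq I] {A : Matrix I I ℤ} {X : Finset I}
  {τ : Equiv.Perm I} {γ : I → I → ℤ} {θ : KM A →ₗ[ℂ] KM A} {c : I → ℂ}

theorem neighbourComponent_eq_empty {i : I} (hi : ∀ k ∈ X, A k i = 0) :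
    neighbourComponent A X i = ∅ := by
  refine Set.eq_empty_iff_forall_notMem.2 fun k hk => ?_
  have := hk ∅ ⟨by simp, by simp⟩ fun m hm hmi => absurd (hi m hm) hmi
  simp at this

theorem lie_f_h (i j : I) : ⁅f A i, h A j⁆ = (A j i : ℂ) • f A i := by
  rw [← lie_skew, lie_h_f_complex]
  module

theorem lie_e_h (i j : I) : ⁅e A i, h A j⁆ = (-A j i : ℂ) • e A i := by
  rw [← lie_skew, lie_h_e_complex]
  module

theorem ad_add_pow_apply {L : Type*} [LieRing L] [LieAlgebra ℂ L] {y z v : L}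
    (hz : ∀ k : ℕ, ⁅z, ((LieAlgebra.ad ℂ L y) ^ k) v⁆ = 0) (n : ℕ) :
    ((LieAlgebra.ad ℂ L (y + z)) ^ n) v = ((LieAlgebra.ad ℂ L y) ^ n) v := by
  induction n with
  | zero => rfl
  | succ n ih => rw [ad_pow_apply_succ, ih, add_lie, hz, add_zero, ← ad_pow_apply_succ]

theorem lie_e_ad_pow_f {i j : I} (hij : i ≠ j) (hA : A i i = 2) (k : ℕ) :
    ⁅e A i, ((LieAlgebra.ad ℂ (KM A) (f A i)) ^ (k + 1)) (f A j)⁆ =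
      ((k + 1) * (-(A i j : ℂ) - k)) • ((LieAlgebra.ad ℂ (KM A) (f A i)) ^ k) (f A j) :=
  lie_ad_pow_highest (lie_e_f_same A i) (by rw [lie_h_f_complex, hA]; norm_num)
    (by rw [lie_h_f_complex]) (lie_e_f_ne A hij) k

/-- Up to `x k`, the vector `x (k + 2)` is `T (x (k + 1))`, so inductively `T^k (x 0)` and `x k`
differ by an element of `U k`, one step below the expected `U (k + 1)`. Where `x` vanishes, the
power of `T` itself drops by one step. -/
theorem pow_apply_mem_of_three_term {V : Type*} [AddCommGroup V] [Module ℂ V] {T : Module.End ℂ V}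
    {U : ℕ → Submodule ℂ V} (hmono : Monotone U) (hT : ∀ m, ∀ u ∈ U m, T u ∈ U (m + 1))
    {x : ℕ → V} {a : ℕ → ℂ} (h0 : x 0 ∈ U 1) (h1 : T (x 0) = x 1)
    (h2 : ∀ k, T (x (k + 1)) = x (k + 2) + a k • x k) {n : ℕ} (hn : x n = 0) :
    (T ^ n) (x 0) ∈ U n := by
  have hpow : ∀ k, (T ^ k) (x 0) ∈ U (k + 1) := by
    intro k
    induction k with
    | zero => exact h0
    | succ k ih => rw [pow_succ']; exact hT _ _ ih
  have key : ∀ k, x k - (T ^ k) (x 0) ∈ U k ∧ x (k + 1) - (T ^ (k + 1)) (x 0) ∈ U (k + 1) := by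
    intro k
    induction k with
    | zero => simp [h1]
    | succ k ih =>
      refine ⟨ih.2, ?_⟩
      have hx : x k ∈ U (k + 1) := by
        have := (U (k + 1)).add_mem (hmono (Nat.le_succ k) ih.1) (hpow k)
        rwa [sub_add_cancel] at this
      have h3 : x (k + 1 + 1) - (T ^ (k + 1 + 1)) (x 0) =
          T (x (k + 1) - (T ^ (k + 1)) (x 0)) - a k • x k := by
        rw [map_sub, h2, pow_succ' T (k + 1), Module.End.mul_apply]
        abel
      rw [h3]
      exact (U _).sub_mem (hT _ _ ih.2) (Submodule.smul_mem _ _ (hmono (Nat.le_succ _) hx))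
  have := (key n).1
  rwa [hn, zero_sub, Submodule.neg_mem_iff] at this

namespace IsSatakeTheta

theorem gGen_of_eq_zero (hθ : IsSatakeTheta A X τ γ θ) {i : I} (hi : i ∉ X) (hγ : γ i = 0) :
    gGen A X θ c i = f A i + (-c i) • e A (τ i) := by
  rw [gGen_of_notMem hi, (hθ.of_eq_zero i hi hγ).2.1, smul_neg, neg_smul]

theorem lie_gGen_tau (hθ : IsSatakeTheta A X τ γ θ) {i : I} (hi : i ∉ X)
    (hγ : γ i = 0) : ⁅gGen A X θ c i, gGen A X θ c (τ i)⁆ = ⁅f A i, f A (τ i)⁆ +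
      c (τ i) • h A i - c i • h A (τ i) + (c i * c (τ i)) • ⁅e A (τ i), e A i⁆ := by
  rw [hθ.gGen_of_eq_zero hi hγ, hθ.gGen_of_eq_zero (hθ.tau_notMem i hi) (hθ.tau_eq_zero i hi hγ),
    hθ.involutive]
  simp only [add_lie, lie_add, smul_lie, lie_smul, lie_e_f_same, lie_f_e, if_true]
  module

/-- The Serre relation for `j = τ(i) ≠ i` with `X(i)` empty and `a_{ij} = 0`. -/
theorem serreElt_gGen_tau_mem_fixed (hθ : IsSatakeTheta A X τ γ θ) {i : I} (hi : i ∉ X)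
    (hγ : γ i = 0) (hAi : A i (τ i) = 0) (hc : c i = c (τ i)) :
    serreElt A (gGen A X θ c) i (τ i) ∈ fixedIn (cartan A) θ := by
  have hAi' : A (τ i) i = 0 := by
    have := hθ.diagramAut i (τ i)
    rwa [hθ.involutive, hAi] at this
  have h1 : ⁅f A i, f A (τ i)⁆ = 0 := by simpa [hAi] using serre_f A i (τ i)
  have h2 : ⁅e A (τ i), e A i⁆ = 0 := by simpa [hAi'] using serre_e A (τ i) i
  obtain ⟨-, hfi, hei⟩ := hθ.of_eq_zero i hi hγ
  obtain ⟨-, hfj, hej⟩ := hθ.of_eq_zero _ (hθ.tau_notMem i hi) (hθ.tau_eq_zero i hi hγ)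
  rw [hθ.involutive] at hfj hej
  -- Equality of the two parameters leaves a multiple of `h_i - h_{τ(i)}`, which is fixed since `θ`
  -- sends `h_i` to `-h_{τ(i)}`.
  rw [serreElt, hAi, neg_zero, Int.toNat_zero, pow_zero, Module.End.one_apply,
    hθ.lie_gGen_tau hi hγ, h1, h2, ← hc, smul_zero, zero_add, add_zero, ← smul_sub]
  refine Submodule.smul_mem _ _ ⟨Submodule.sub_mem _ (Submodule.subset_span ⟨_, rfl⟩)
    (Submodule.subset_span ⟨_, rfl⟩), ?_⟩
  show θ (h A i - h A (τ i)) = h A i - h A (τ i)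
  rw [map_sub, ← lie_e_f_same A i, ← lie_e_f_same A (τ i), hθ.map_lie, hθ.map_lie, hfi, hei, hfj,
    hej, neg_lie, lie_neg, neg_lie, lie_neg, neg_neg, neg_neg, ← lie_skew, ← lie_skew (f A i)]
  abel

/-- The Serre relation for `j = τ(i) ≠ i` with `X(i)` empty and `a_{ij} = -1`. -/
theorem serreElt_gGen_tau_of_eq_neg_one (hA : ∀ i, A i i = 2) (hθ : IsSatakeTheta A X τ γ θ) {i : I}
    (hi : i ∉ X) (hτi : τ i ≠ i) (hγ : γ i = 0) (hAi : A i (τ i) = -1) :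
    serreElt A (gGen A X θ c) i (τ i) = (2 * (c i + c (τ i))) • gGen A X θ c i := by
  have hAi' : A (τ i) i = -1 := by
    have := hθ.diagramAut i (τ i)
    rwa [hθ.involutive, hAi] at this
  have h1 : ⁅f A i, ⁅f A i, f A (τ i)⁆⁆ = 0 := by simpa [hAi] using serre_f A i (τ i)
  have h2 : ⁅e A (τ i), ⁅e A (τ i), e A i⁆⁆ = 0 := by simpa [hAi'] using serre_e A (τ i) i
  have h3 : ⁅f A i, ⁅e A (τ i), e A i⁆⁆ = -e A (τ i) := by
    rw [leibniz_lie, lie_f_e, if_neg hτi.symm, zero_lie, zero_add, lie_f_e, if_pos rfl, lie_neg,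
      lie_e_h, hAi]
    simp
  have h4 : ⁅e A (τ i), ⁅f A i, f A (τ i)⁆⁆ = -f A i := by
    rw [leibniz_lie, lie_e_f_ne A hτi, zero_lie, zero_add, lie_e_f_same, lie_f_h, hAi']
    simp
  have ht : (-A i (τ i)).toNat = 1 := by rw [hAi]; rfl
  rw [serreElt, ht, pow_one, LieAlgebra.ad_apply, hθ.lie_gGen_tau hi hγ,
    hθ.gGen_of_eq_zero hi hγ]
  simp only [add_lie, lie_add, lie_sub, smul_lie, lie_smul, h1, h2, h3, h4, lie_f_h, lie_e_h, hA,
    hAi, hAi']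
  push_cast
  module

/-- The Serre relation for `j = τ(i) ≠ i` with `X(i)` empty and `a_{ij} ≤ -2`. -/
theorem serreElt_gGen_tau_of_le_neg_two (hθ : IsSatakeTheta A X τ γ θ) {i : I} (hi : i ∉ X)
    (hτi : τ i ≠ i) (hγ : γ i = 0) (hAi : A i (τ i) ≤ -2) :
    serreElt A (gGen A X θ c) i (τ i) = 0 := by
  have hτiX := hθ.tau_notMem i hi
  have hz := (hθ.of_eq_zero _ hτiX (hθ.tau_eq_zero i hi hγ)).2.1
  rw [hθ.involutive] at hz
  rw [serreElt_eq, gGen_of_notMem hi, gGen_of_notMem hτiX]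
  set n := (-A i (τ i)).toNat + 1 with hn
  -- With at least three factors, every term not covered by a Serre relation has mixed weight or
  -- weight a multiple, by at least 2 in absolute value, of one simple root.
  have hn3 : 3 ≤ n := by omega
  have hxy := hθ.lie_f_z hi hτi (c i)
  have hzm : c i • θ (f A i) ∈ rootSpace A (simpleRoot (τ i)) := by
    have := hθ.z_mem i (c i)
    rwa [hγ, add_zero] at this
  rw [map_add, map_smul]
  have h1 : ((LieAlgebra.ad ℂ (KM A) (f A i + c i • θ (f A i))) ^ n) (f A (τ i)) = 0 := by
    refine (Submodule.mem_bot ℂ).1 (ad_add_pow_mem hxy fun m hm => (Submodule.mem_bot ℂ).2 ?_)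
    have hwt := ad_pow_mem_rootSpace (f_mem_rootSpace A i)
      (ad_pow_mem_rootSpace hzm (f_mem_rootSpace A (τ i)) (n - m)) m
    rcases Nat.eq_or_lt_of_le hm with rfl | hlt
    · rw [Nat.sub_self, pow_zero, Module.End.one_apply, hn, serre_f_pow]
    rcases Nat.eq_zero_or_pos m with rfl | hm0
    · refine eq_zero_of_two_le hwt (j := τ i) (fun k hk => ?_) ?_
      · simp [simpleRoot, hk]
      · simp [simpleRoot]; omega
    by_cases hm1 : m + 1 = n
    · refine eq_zero_of_le_neg_two hwt (j := i) (fun k hk => ?_) ?_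
      · have : n - m = 1 := by omega
        simp [simpleRoot, this, hk]
      · simp [simpleRoot, hτi.symm]; omega
    · refine eq_zero_of_mixed hwt (i := τ i) (j := i) ?_ ?_
      · simp [simpleRoot, hτi]; omega
      · simp [simpleRoot, hτi.symm]; omega
  have h2 : ((LieAlgebra.ad ℂ (KM A) (f A i + c i • θ (f A i))) ^ n) (θ (f A (τ i))) = 0 := by
    refine (Submodule.mem_bot ℂ).1 (ad_add_pow_mem hxy fun m hm => (Submodule.mem_bot ℂ).2 ?_)
    have hwt := ad_pow_mem_rootSpace (f_mem_rootSpace A i)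
      (ad_pow_mem_rootSpace hzm (e_mem_rootSpace A i) (n - m)) m
    rcases Nat.eq_zero_or_pos m with rfl | hm0
    · rw [pow_zero, Module.End.one_apply, Nat.sub_zero, ad_smul_pow, hn, hθ.theta_serre, smul_zero]
    rw [hz, map_neg, map_neg, neg_eq_zero]
    rcases Nat.eq_or_lt_of_le hm with rfl | hlt
    · refine eq_zero_of_le_neg_two hwt (j := i) (fun k hk => ?_) ?_
      · simp [simpleRoot, hk]
      · simp [simpleRoot]; omega
    by_cases hm1 : m = 1
    · refine eq_zero_of_two_le hwt (j := τ i) (fun k hk => ?_) ?_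
      · simp [simpleRoot, hm1, hk]
      · simp [simpleRoot, hτi]; omega
    · refine eq_zero_of_mixed hwt (i := τ i) (j := i) ?_ ?_
      · simp [simpleRoot, hτi]; omega
      · simp [simpleRoot, hτi.symm]; omega
  rw [h1, h2, smul_zero, add_zero]

/-- The Serre relation for `τ(i) = i` with `X(i)` empty and `j ∉ X`. -/
theorem serreElt_gGen_mem_of_eq_zero (hA : ∀ i, A i i = 2) (hθ : IsSatakeTheta A X τ γ θ)
    {i j : I} (hi : i ∉ X) (hτi : τ i = i) (hγ : γ i = 0) (hij : i ≠ j) (hj : j ∉ X) :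
    serreElt A (gGen A X θ c) i j ∈ kFiltration A X θ c ((-A i j).toNat + 1) := by
  obtain ⟨-, hfi, hei⟩ := hθ.of_eq_zero i hi hγ
  rw [hτi] at hfi hei
  have hhi : θ (h A i) = -h A i := by
    rw [← lie_e_f_same, hθ.map_lie, hfi, hei, neg_lie, lie_neg, neg_neg, ← lie_skew]
  have hfv : ⁅f A i, θ (f A j)⁆ = 0 := by
    have := hθ.map_lie (e A i) (f A j)
    rw [lie_e_f_ne A hij, map_zero, hei, neg_lie] at this
    exact neg_eq_zero.1 this.symm
  have hhv : ⁅-h A i, θ (f A j)⁆ = (-A i j : ℂ) • θ (f A j) := by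
    rw [← hhi, ← hθ.map_lie, lie_h_f_complex, map_smul]
  have hup : ∀ k : ℕ, ⁅f A i, ((LieAlgebra.ad ℂ (KM A) (e A i)) ^ (k + 1)) (θ (f A j))⁆ =
      ((k + 1) * (-(A i j : ℂ) - k)) • ((LieAlgebra.ad ℂ (KM A) (e A i)) ^ k) (θ (f A j)) :=
    lie_ad_pow_highest (by rw [lie_f_e, if_pos rfl])
      (by rw [neg_lie, lie_h_e_complex, hA]; norm_num) hhv hfv
  have hdown := lie_e_ad_pow_f hij (hA i)
  rw [serreElt_eq]
  set n := (-A i j).toNat + 1 with hn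
  -- The two pure terms in the expansion of `ad(f_i - c_i e_i)^k(g_j)`. The cross terms are governed
  -- by `sl₂` and produce the three-term recursion; both pure terms vanish at `k = n`, by the Serre
  -- relation and its image under `θ`.
  let x : ℕ → KM A := fun k => ((LieAlgebra.ad ℂ (KM A) (f A i)) ^ k) (f A j) +
    ((-c i) ^ k * c j) • ((LieAlgebra.ad ℂ (KM A) (e A i)) ^ k) (θ (f A j))
  have hx0 : x 0 = gGen A X θ c j := by simp [x, gGen_of_notMem hj]
  rw [← hx0]
  have hgi : gGen A X θ c i = f A i + (-c i) • e A i := by rw [hθ.gGen_of_eq_zero hi hγ, hτi]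
  refine pow_apply_mem_of_three_term (U := kFiltration A X θ c) (x := x)
    (a := fun k => -c i * ((k + 1) * (-(A i j : ℂ) - k))) (fun _ _ => kFiltration_mono)
    (fun m u hu => hθ.lie_gGen_mem_kFiltration i hu) ?_ ?_ ?_ ?_
  · rw [hx0]; exact gGen_mem_kFiltration j
  · rw [LieAlgebra.ad_apply, hgi]
    simp only [x, pow_zero, pow_one, Module.End.one_apply, LieAlgebra.ad_apply, add_lie, lie_add,
      smul_lie, lie_smul, hfv, lie_e_f_ne A hij]
    module
  · intro k
    rw [LieAlgebra.ad_apply, hgi]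
    simp only [x, add_lie, lie_add, smul_lie, lie_smul, hup, hdown, ← ad_pow_apply_succ]
    module
  · have h1 := hθ.theta_serre i j
    rw [hfi, ← neg_one_smul ℂ, ad_smul_pow, ← hn] at h1
    have h2 := (smul_eq_zero.1 h1).resolve_left (pow_ne_zero _ (by norm_num))
    simp only [x]
    rw [h2, hn, serre_f_pow, smul_zero, add_zero]

/-- The Serre relation for `τ(i) = i` with `X(i)` empty and `j ∈ X`. -/
theorem serreElt_gGen_eq_zero_of_mem (hθ : IsSatakeTheta A X τ γ θ) {i j : I} (hi : i ∉ X)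
    (hτi : τ i = i) (hγ : γ i = 0) (hj : j ∈ X) (hij : A i j = 0) :
    serreElt A (gGen A X θ c) i j = 0 := by
  have h1 : ⁅f A i, f A j⁆ = 0 := by simpa [hij] using serre_f A i j
  have hne : i ≠ j := fun h => hi (h ▸ hj)
  rw [serreElt, hθ.gGen_of_eq_zero hi hγ, gGen_of_mem hj, hτi, add_lie, h1, smul_lie,
    lie_e_f_ne A hne, smul_zero, add_zero, map_zero]

/-- The Serre relation for `τ(i) = i` with `X(i)` nonempty and `j ∉ X`. -/
theorem serreElt_gGen_eq_zero_of_notMem (hθ : IsSatakeTheta A X τ γ θ) {i j : I} (hi : i ∉ X)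
    (hτi : τ i = i) (hγ : γ i ≠ 0) (hij : i ≠ j) (hj : j ∉ X) :
    serreElt A (gGen A X θ c) i j = 0 := by
  have h1 : ∀ k : ℕ, ⁅θ (f A i), ((LieAlgebra.ad ℂ (KM A) (f A i)) ^ k) (f A j)⁆ = 0 := by
    intro k
    obtain ⟨m, hm, hpos⟩ := hθ.exists_pos hi hγ
    have hmi : m ≠ i := fun h => hi (h ▸ hm)
    have hmj : m ≠ j := fun h => hj (h ▸ hm)
    refine eq_zero_of_mixed (lie_mem_rootSpace (hθ.f_mem i)
      (ad_pow_mem_rootSpace (f_mem_rootSpace A i) (f_mem_rootSpace A j) k)) (i := m) (j := j) ?_ ?_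
    · simpa [simpleRoot, hτi, hmi, hmj] using hpos
    · simp [simpleRoot, hτi, hij.symm, hθ.support i j hj]
  -- This is the image of `h1` under `θ`, because `θ²` rescales `f_i` by a nonzero scalar.
  have h2 : ∀ k : ℕ, ⁅f A i, ((LieAlgebra.ad ℂ (KM A) (θ (f A i))) ^ k) (θ (f A j))⁆ = 0 := by
    intro k
    obtain ⟨κ, hκ, hκf⟩ := hθ.theta_theta_f i hi hτi
    have := congrArg θ (h1 k)
    rw [hθ.map_lie, hθ.map_ad_pow, hκf, smul_lie, map_zero] at this
    exact (smul_eq_zero.1 this).resolve_left hκ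
  rw [serreElt_eq, gGen_of_notMem hi, gGen_of_notMem hj, map_add,
    ad_add_pow_apply (fun k => by rw [smul_lie, h1, smul_zero]), serre_f_pow, map_smul,
    add_comm (f A i), ad_add_pow_apply (fun k => by rw [ad_smul_pow, lie_smul, h2, smul_zero]),
    ad_smul_pow, hθ.theta_serre]
  simp

end IsSatakeTheta

end Serre

/-! ### Binomial expansion of `ad (y + z)` without commutativity. -/

section MixedPow

variable {L : Type*} [LieRing L] [LieAlgebra ℂ L]

/-- The part of `ad(y + z)^{p+q} v` of degree `p` in `y` and degree `q` in `z`. -/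
def mixedPow (y z v : L) : ℕ → ℕ → L
  | 0, 0 => v
  | p + 1, 0 => ⁅y, mixedPow y z v p 0⁆
  | 0, q + 1 => ⁅z, mixedPow y z v 0 q⁆
  | p + 1, q + 1 => ⁅y, mixedPow y z v p (q + 1)⁆ + ⁅z, mixedPow y z v (p + 1) q⁆
termination_by p q => p + q

theorem mixedPow_succ_zero (y z v : L) (p : ℕ) :
    mixedPow y z v (p + 1) 0 = ⁅y, mixedPow y z v p 0⁆ := by rw [mixedPow]

theorem mixedPow_zero_succ (y z v : L) (q : ℕ) :
    mixedPow y z v 0 (q + 1) = ⁅z, mixedPow y z v 0 q⁆ := by rw [mixedPow]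

theorem mixedPow_succ_succ (y z v : L) (p q : ℕ) : mixedPow y z v (p + 1) (q + 1) =
    ⁅y, mixedPow y z v p (q + 1)⁆ + ⁅z, mixedPow y z v (p + 1) q⁆ := by rw [mixedPow]

theorem mixedPow_zero_right (y z v : L) (p : ℕ) :
    mixedPow y z v p 0 = ((LieAlgebra.ad ℂ L y) ^ p) v := by
  induction p with
  | zero => simp [mixedPow]
  | succ p ih => rw [mixedPow, ih, ad_pow_apply_succ]

theorem ad_add_pow_eq_sum_mixedPow (y z v : L) (n : ℕ) :
    ((LieAlgebra.ad ℂ L (y + z)) ^ n) v =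
      ∑ p ∈ Finset.HasAntidiagonal.antidiagonal n, mixedPow y z v p.1 p.2 := by
  induction n with
  | zero => simp [mixedPow]
  | succ n ih =>
    rw [ad_pow_apply_succ, ih, add_lie, lie_sum, lie_sum]
    cases n with
    | zero => simp [Finset.Nat.antidiagonal_succ, mixedPow, add_comm]
    | succ n =>
      rw [Finset.Nat.antidiagonal_succ_succ', Finset.sum_cons, Finset.sum_cons, Finset.sum_map]
      conv_lhs => rw [Finset.Nat.sum_antidiagonal_succ', Finset.Nat.sum_antidiagonal_succ]
      simp only [Function.Embedding.coe_prodMap, Function.Embedding.coeFn_mk, Prod.map_fst,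
        Prod.map_snd, mixedPow, Finset.sum_add_distrib, Nat.succ_eq_add_one]
      abel

/-- Exchanging `y` and `z` up to scalars, `θ` exchanges the bidegrees `(p, q)` and `(q, p)`; hence
vanishing for `q < p` gives vanishing for `q > p`. -/
theorem map_mixedPow {θ : L →ₗ[ℂ] L} (hθ : ∀ x y, θ ⁅x, y⁆ = ⁅θ x, θ y⁆) {y z v : L} {a b d : ℂ}
    (hy : θ y = a • z) (hz : θ z = b • y) (hv : θ v = d • v) (p q : ℕ) :
    θ (mixedPow y z v p q) = (d * a ^ p * b ^ q) • mixedPow y z v q p := by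
  induction p, q using mixedPow.induct with
  | case1 => simp [mixedPow, hv]
  | case2 p ih =>
    simp only [Nat.succ_eq_add_one]
    rw [mixedPow_succ_zero, hθ, ih, hy, mixedPow_zero_succ, smul_lie, lie_smul]
    module
  | case3 q ih =>
    simp only [Nat.succ_eq_add_one]
    rw [mixedPow_zero_succ, hθ, ih, hz, mixedPow_succ_zero, smul_lie, lie_smul]
    module
  | case4 p q ih1 ih2 =>
    simp only [Nat.succ_eq_add_one]
    rw [mixedPow_succ_succ, map_add, hθ, hθ, ih1, ih2, hy, hz, mixedPow_succ_succ, smul_lie,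
      smul_lie, lie_smul, lie_smul]
    module

end MixedPow

/-! ### Serre relations for `τ(i) = i`, `j ∈ X`, and all cases together. -/

section Serre

variable {I : Type*} [Fintype I] [DecidableEq I] {A : Matrix I I ℤ} {X : Finset I}
  {τ : Equiv.Perm I} {γ : I → I → ℤ} {θ : KM A →ₗ[ℂ] KM A} {c : I → ℂ}

theorem mixedPow_mem_rootSpace {β δ ε : I → ℤ} {y z v : KM A} (hy : y ∈ rootSpace A β)
    (hz : z ∈ rootSpace A δ) (hv : v ∈ rootSpace A ε) (p q : ℕ) :
    mixedPow y z v p q ∈ rootSpace A ((p : ℤ) • β + (q : ℤ) • δ + ε) := by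
  induction p, q using mixedPow.induct with
  | case1 => simpa [mixedPow] using hv
  | case2 p ih =>
    rw [mixedPow]
    convert lie_mem_rootSpace hy ih using 2
    push_cast
    module
  | case3 q ih =>
    rw [mixedPow]
    convert lie_mem_rootSpace hz ih using 2
    push_cast
    module
  | case4 p q ih1 ih2 =>
    rw [mixedPow]
    refine Submodule.add_mem _ ?_ ?_
    · convert lie_mem_rootSpace hy ih1 using 2
      push_cast
      module
    · convert lie_mem_rootSpace hz ih2 using 2
      push_cast
      module

/-- The exceptional case: the weight `-2α_i + (α_i + α_j) - α_j = -α_i` is a root, so weights do not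
suffice. The terms cancel by a direct computation in rank two with `a_{ij} = -2` and `a_{ji} = -1`.
-/
theorem mixedPow_two_one_eq_zero (hA : ∀ i, A i i = 2) {i j : I} (hne : i ≠ j) (hij : A i j = -2)
    (hji : A j i = -1) {z : KM A} (hz : z ∈ rootSpace A (simpleRoot i + simpleRoot j)) :
    mixedPow (f A i) z (f A j) 2 1 = 0 := by
  obtain ⟨κ, rfl⟩ := mem_rootSpace_add hne hz
  have h1 : ⁅⁅e A j, e A i⁆, f A j⁆ = -e A i := by
    rw [lie_lie, lie_e_f_ne A hne, lie_zero, lie_e_f_same, lie_e_h, hji]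
    push_cast
    module
  have h2 : ⁅⁅e A j, e A i⁆, f A i⁆ = (2 : ℂ) • e A j := by
    rw [lie_lie, lie_e_f_ne A hne.symm, lie_zero, lie_e_f_same, lie_e_h, hij]
    push_cast
    module
  have h3 : ⁅e A j, ⁅f A i, f A j⁆⁆ = -f A i := by
    rw [leibniz_lie, lie_e_f_ne A hne.symm, zero_lie, zero_add, lie_e_f_same, lie_f_h, hji]
    push_cast
    module
  have h4 : ⁅⁅e A j, e A i⁆, ⁅f A i, f A j⁆⁆ = (2 : ℂ) • h A j + h A i := by
    rw [leibniz_lie, h1, h2, smul_lie, lie_e_f_same, lie_neg, lie_f_e, if_pos rfl, neg_neg]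
  have h5 : ⁅f A i, (2 : ℂ) • h A j + h A i⁆ = 0 := by
    rw [lie_add, lie_smul, lie_f_h, lie_f_h, hji, hA]
    push_cast
    module
  have h6 : ⁅⁅e A j, e A i⁆, ⁅f A i, ⁅f A i, f A j⁆⁆⁆ = (-2 : ℂ) • f A i := by
    rw [leibniz_lie, h2, h4, h5, smul_lie, h3]
    module
  simp only [mixedPow, smul_lie, lie_add, lie_smul, h1, h4, h5, h6, lie_neg, lie_f_e, if_true,
    lie_f_h, hA]
  push_cast
  module

namespace IsSatakeTheta

/-- Since `γ_i` is nonzero, nonnegative and supported on `X`, subtracting `α_j` from `q γ_i` leaves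
a positive coordinate unless it leaves nothing. -/
theorem exists_pos_or_eq (hθ : IsSatakeTheta A X τ γ θ) {i j : I} (hi : i ∉ X) (hγ : γ i ≠ 0)
    {q : ℕ} (hq : 0 < q) : (∃ k ∈ X, 0 < (q : ℤ) * γ i k - simpleRoot j k) ∨
      q = 1 ∧ γ i = simpleRoot j := by
  by_contra! hle
  obtain ⟨hle, hne⟩ := hle
  have hz : ∀ k, k ≠ j → γ i k = 0 := by
    intro k hkj
    by_cases hk : k ∈ X
    · have h1 := hle k hk
      have h2 := hθ.nonneg i hi k
      simp only [simpleRoot, Pi.single_apply, hkj, if_false, sub_zero] at h1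
      nlinarith
    · exact hθ.support i k hk
  obtain ⟨k, hk, hpos⟩ := hθ.exists_pos hi hγ
  have hkj : k = j := by
    by_contra hkj
    exact hpos.ne' (hz k hkj)
  subst hkj
  have h1 := hle k hk
  simp only [simpleRoot, Pi.single_eq_same] at h1
  have hq1 : q = 1 := by
    by_contra hq1
    have : (2 : ℤ) ≤ q := by omega
    nlinarith
  subst hq1
  refine hne rfl (funext fun m => ?_)
  by_cases hm : m = k
  · subst hm
    simp [simpleRoot]
    push_cast at h1
    omega
  · rw [hz m hm]
    simp [simpleRoot, hm]

/-- The weight is `(q - p) α_i + q γ_i - α_j`, negative at `i`. If `q γ_i - α_j` has a positive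
coordinate, the weight is mixed. Otherwise `q = 1` and the weight is `(1 - p) α_i`, which is a root
only for `p = 2`. -/
theorem mixedPow_eq_zero (hA : ∀ i, A i i = 2) (hθ : IsSatakeTheta A X τ γ θ) {i j : I}
    (hi : i ∉ X) (hτi : τ i = i) (hγ : γ i ≠ 0) (hj : j ∈ X) (a : ℂ) {p q : ℕ} (hqp : q < p)
    (hpq : p + q = (-A i j).toNat + 1) :
    mixedPow (f A i) (a • θ (f A i)) (f A j) p q = 0 := by
  have hne : i ≠ j := fun h => hi (h ▸ hj)
  rcases Nat.eq_zero_or_pos q with rfl | hq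
  · rw [mixedPow_zero_right, show p = (-A i j).toNat + 1 by omega, serre_f_pow]
  have hz := hθ.z_mem i a
  rw [hτi] at hz
  have hwt := mixedPow_mem_rootSpace (f_mem_rootSpace A i) hz (f_mem_rootSpace A j) p q
  have hwi : ((p : ℤ) • -simpleRoot i + (q : ℤ) • (simpleRoot i + γ i) + -simpleRoot j) i =
      (q : ℤ) - p := by
    simp [simpleRoot, hne, hθ.support i i hi]
    ring
  rcases hθ.exists_pos_or_eq (j := j) hi hγ hq with ⟨k, hk, hpos⟩ | ⟨rfl, hγj⟩
  · have hki : k ≠ i := fun h => hi (h ▸ hk)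
    refine eq_zero_of_mixed hwt (i := k) (j := i) ?_ ?_
    · simpa [simpleRoot, Pi.single_apply, hki, sub_eq_add_neg] using hpos
    · rw [hwi]; omega
  · by_cases hp : p = 2
    · subst hp
      rw [hγj] at hz
      exact mixedPow_two_one_eq_zero hA hne (by omega) (hθ.of_eq_simpleRoot i hi hτi j hj hγj).1 hz
    · refine eq_zero_of_le_neg_two hwt (j := i) (fun k hk => ?_) ?_
      · simp [hγj, simpleRoot, hk]
      · rw [hwi]; push_cast; omega

/-- The Serre relation for `τ(i) = i` with `X(i)` nonempty and `j ∈ X`. -/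
theorem serreElt_gGen_mem_nPlus (hA : ∀ i, A i i = 2) (hθ : IsSatakeTheta A X τ γ θ) {i j : I}
    (hi : i ∉ X) (hτi : τ i = i) (hγ : γ i ≠ 0) (hj : j ∈ X) (hA0 : A i j ≤ 0) (hc : c i ≠ 0) :
    serreElt A (gGen A X θ c) i j ∈ nPlus A X := by
  have hne : i ≠ j := fun h => hi (h ▸ hj)
  rw [serreElt_eq, gGen_of_notMem hi, gGen_of_mem hj, ad_add_pow_eq_sum_mixedPow]
  refine Submodule.sum_mem (nPlus A X).toSubmodule fun ⟨p, q⟩ hpq => ?_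
  rw [Finset.HasAntidiagonal.mem_antidiagonal] at hpq
  dsimp only at hpq ⊢
  rcases lt_trichotomy q p with hlt | rfl | hlt
  · rw [hθ.mixedPow_eq_zero hA hi hτi hγ hj _ hlt hpq]
    exact Submodule.zero_mem _
  -- In the middle term `α_i` cancels and the weight `q γ_i - α_j` is supported on `X`. It could
  -- vanish only for `q = 1` and `γ_i = α_j`, which means `a_{ij} = -1`: the case excluded by the
  -- generalized Satake condition.
  · have hz := hθ.z_mem i (c i)
    rw [hτi] at hz
    have hwt := mixedPow_mem_rootSpace (f_mem_rootSpace A i) hz (f_mem_rootSpace A j) q q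
    rcases hθ.exists_pos_or_eq (j := j) hi hγ (q := q) (by omega) with ⟨k, hk, hpos⟩ | ⟨rfl, hγj⟩
    · refine mem_nPlus_of_support hwt (i := k) ?_ ?_
      · have hki : k ≠ i := fun h => hi (h ▸ hk)
        simpa [simpleRoot, Pi.single_apply, hki, sub_eq_add_neg] using hpos
      · intro m hm
        have hmj : m ≠ j := fun h => hm (h ▸ hj)
        simp [hθ.support i m hm, simpleRoot, hmj]
    · exact absurd (by omega) (hθ.of_eq_simpleRoot i hi hτi j hj hγj).2
  · obtain ⟨κ, hκ, hκf⟩ := hθ.theta_theta_f i hi hτi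
    obtain ⟨s, hs, -, hsf⟩ := hθ.eigen j hj
    have h1 := map_mixedPow hθ.map_lie (y := f A i) (z := c i • θ (f A i)) (v := f A j)
      (a := (c i)⁻¹) (b := c i * κ) (by rw [smul_smul, inv_mul_cancel₀ hc, one_smul])
      (by rw [map_smul, hκf, smul_smul]) hsf q p
    rw [hθ.mixedPow_eq_zero hA hi hτi hγ hj _ hlt (by omega), map_zero] at h1
    have h2 := (smul_eq_zero.1 h1.symm).resolve_left (by positivity)
    rw [h2]
    exact Submodule.zero_mem _

/-- The Serre relations hold for the `g_i` up to terms of lower filtration degree. -/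
theorem serreElt_gGen_mem_kFiltration (hA : IsSymmetrizableGCM A) (hθ : IsSatakeTheta A X τ γ θ)
    (hc : ∀ i ∉ X, c i ≠ 0)
    (hdiff : ∀ j ∉ X, A j (τ j) = 0 → neighbourComponent A X j = ∅ → c j = c (τ j)) (i j : I) :
    serreElt A (gGen A X θ c) i j ∈ kFiltration A X θ c ((-A i j).toNat + 1) := by
  by_cases hij : i = j
  · subst hij; rw [serreElt_self]; exact Submodule.zero_mem _
  by_cases hi : i ∈ X
  · rw [hθ.serreElt_gGen_of_mem hi]; exact Submodule.zero_mem _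
  have hA0 := hA.offDiag i j hij
  by_cases hτi : τ i = i
  · by_cases hγ : γ i = 0
    · by_cases hj : j ∈ X
      · have hji : A j i = 0 := (hθ.of_eq_zero i hi hγ).1 j hj
        rw [hθ.serreElt_gGen_eq_zero_of_mem hi hτi hγ hj (hA.eq_zero_symm _ _ hji)]
        exact Submodule.zero_mem _
      · exact hθ.serreElt_gGen_mem_of_eq_zero hA.diag hi hτi hγ hij hj
    · by_cases hj : j ∈ X
      · exact nPlus_le_kFiltration _
          (hθ.serreElt_gGen_mem_nPlus hA.diag hi hτi hγ hj hA0 (hc i hi))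
      · rw [hθ.serreElt_gGen_eq_zero_of_notMem hi hτi hγ hij hj]
        exact Submodule.zero_mem _
  · by_cases hj : j = τ i
    · subst hj
      by_cases hγ : γ i = 0
      · by_cases h0 : A i (τ i) = 0
        · exact fixed_le_kFiltration _ (hθ.serreElt_gGen_tau_mem_fixed hi hγ h0
            (hdiff i hi h0 (neighbourComponent_eq_empty (hθ.of_eq_zero i hi hγ).1)))
        by_cases h1 : A i (τ i) = -1
        · rw [hθ.serreElt_gGen_tau_of_eq_neg_one hA.diag hi hτi hγ h1]
          exact Submodule.smul_mem _ _ (kFiltration_mono (by omega) (gGen_mem_kFiltration i))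
        · rw [hθ.serreElt_gGen_tau_of_le_neg_two hi hτi hγ (by omega)]
          exact Submodule.zero_mem _
      · exact nPlus_le_kFiltration _ (hθ.serreElt_gGen_tau_mem_nPlus hi hτi hγ)
    · rw [hθ.serreElt_gGen_of_tau_ne hi hτi (Ne.symm hij) hj]
      exact Submodule.zero_mem _

end IsSatakeTheta

end Serre

/-! ### Outer degree, independence and spanning. -/

section WeightSpan

variable {I : Type*} [Fintype I] [DecidableEq I] {A : Matrix I I ℤ} {X : Finset I}
  {τ : Equiv.Perm I} {γ : I → I → ℤ} {θ : KM A →ₗ[ℂ] KM A} {c : I → ℂ}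

variable (A) in
/-- The sum of the root spaces with weights in `S`. -/
def weightSpan (S : Set (I → ℤ)) : Submodule ℂ (KM A) := ⨆ μ ∈ S, rootSpace A μ

theorem rootSpace_le_weightSpan {S : Set (I → ℤ)} {μ : I → ℤ} (hμ : μ ∈ S) :
    rootSpace A μ ≤ weightSpan A S :=
  le_iSup₂_of_le μ hμ le_rfl

theorem weightSpan_mono {S T : Set (I → ℤ)} (hST : S ⊆ T) : weightSpan A S ≤ weightSpan A T :=
  biSup_mono hST

theorem eq_zero_of_mem_weightSpan {S T : Set (I → ℤ)} (hST : Disjoint S T) {x : KM A}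
    (hS : x ∈ weightSpan A S) (hT : x ∈ weightSpan A T) : x = 0 :=
  Submodule.disjoint_def.1 (iSupIndep_rootSpace.disjoint_biSup_biSup hST) x hS hT

theorem lie_mem_weightSpan {S T R : Set (I → ℤ)} (hR : ∀ μ ∈ S, ∀ ν ∈ T, μ + ν ∈ R) {x y : KM A}
    (hx : x ∈ weightSpan A S) (hy : y ∈ weightSpan A T) : ⁅x, y⁆ ∈ weightSpan A R := by
  have h1 : ∀ μ ∈ S, ∀ z ∈ rootSpace A μ, ⁅z, y⁆ ∈ weightSpan A R := by
    intro μ hμ z hz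
    have : weightSpan A T ≤ (weightSpan A R).comap (LieAlgebra.ad ℂ (KM A) z) :=
      iSup₂_le fun ν hν u hu => rootSpace_le_weightSpan (hR μ hμ ν hν) (lie_mem_rootSpace hz hu)
    exact this hy
  have h2 : weightSpan A S ≤ (weightSpan A R).comap (LieAlgebra.ad ℂ (KM A) y) := by
    refine iSup₂_le fun μ hμ z hz => ?_
    rw [Submodule.mem_comap, LieAlgebra.ad_apply, ← lie_skew]
    exact Submodule.neg_mem _ (h1 μ hμ z hz)
  have h3 := h2 hx
  rw [Submodule.mem_comap, LieAlgebra.ad_apply, ← lie_skew] at h3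
  exact (Submodule.neg_mem_iff _).1 h3

theorem nPlus_le_weightSpan : (nPlus A X).toSubmodule ≤ weightSpan A {μ | 0 ≤ μ ∧ μ ≠ 0} := by
  rw [nPlus_eq_span, Submodule.span_le]
  rintro _ ⟨w, ⟨hw, -⟩, rfl⟩
  exact rootSpace_le_weightSpan (S := {μ | 0 ≤ μ ∧ μ ≠ 0})
    ⟨wordWeight_nonneg w, fun h => hw (wordWeight_eq_zero h)⟩
    (iterBracket_e_mem_rootSpace hw)

theorem cartan_le_rootSpace : cartan A ≤ rootSpace A 0 := by
  rw [cartan, Submodule.span_le]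
  rintro _ ⟨i, rfl⟩
  exact h_mem_rootSpace A i

variable (X) in
/-- The total degree of a weight in the simple roots outside `X`. -/
def outerDegree : (I → ℤ) →+ ℤ where
  toFun μ := ∑ k ∈ Xᶜ, μ k
  map_zero' := by simp
  map_add' μ ν := by simp [Finset.sum_add_distrib]

theorem outerDegree_simpleRoot (i : I) :
    outerDegree X (simpleRoot i) = if i ∈ X then 0 else 1 := by
  simp only [outerDegree, AddMonoidHom.coe_mk, ZeroHom.coe_mk, simpleRoot]
  by_cases hi : i ∈ X <;> simp [Pi.single_apply, hi]

theorem outerDegree_nonneg {μ : I → ℤ} (hμ : 0 ≤ μ) : 0 ≤ outerDegree X μ :=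
  Finset.sum_nonneg fun k _ => hμ k

variable (A X) in
/-- The sum of the root spaces of outer degree at least `k`. -/
def outerFiltration (k : ℤ) : Submodule ℂ (KM A) := weightSpan A {μ | k ≤ outerDegree X μ}

theorem outerFiltration_anti {k m : ℤ} (hkm : k ≤ m) :
    outerFiltration A X m ≤ outerFiltration A X k :=
  weightSpan_mono fun _ hμ => hkm.trans hμ

theorem mem_outerFiltration {μ : I → ℤ} {x : KM A} (hx : x ∈ rootSpace A μ) {k : ℤ}
    (hk : k ≤ outerDegree X μ) : x ∈ outerFiltration A X k :=
  rootSpace_le_weightSpan (S := {μ | k ≤ outerDegree X μ}) hk hx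

theorem lie_mem_outerFiltration {a b : ℤ} {x y : KM A} (hx : x ∈ outerFiltration A X a)
    (hy : y ∈ outerFiltration A X b) : ⁅x, y⁆ ∈ outerFiltration A X (a + b) :=
  lie_mem_weightSpan (fun μ hμ ν hν => by
    rw [Set.mem_ofPred_eq] at hμ hν ⊢
    rw [map_add]
    exact add_le_add hμ hν) hx hy

theorem iterBracket_f_mem_outerFiltration {w : List I} (hw : w ≠ []) :
    iterBracket (f A) w ∈ outerFiltration A X (-outerDegree X (wordWeight w)) :=
  mem_outerFiltration (iterBracket_f_mem_rootSpace hw) (by rw [map_neg])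

namespace IsSatakeTheta

theorem gGen_sub_f_mem (hθ : IsSatakeTheta A X τ γ θ) (i : I) :
    gGen A X θ c i - f A i ∈ outerFiltration A X (-outerDegree X (simpleRoot i) + 1) := by
  by_cases hi : i ∈ X
  · rw [gGen_of_mem hi, sub_self]; exact Submodule.zero_mem _
  · rw [gGen_of_notMem hi, add_sub_cancel_left]
    refine mem_outerFiltration (hθ.z_mem i (c i)) ?_
    rw [map_add, outerDegree_simpleRoot, outerDegree_simpleRoot, if_neg hi,
      if_neg (hθ.tau_notMem i hi)]
    have := outerDegree_nonneg (X := X) (hθ.nonneg i hi)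
    omega

/-- The component of lowest outer degree of `g_w` is `f_w`. -/
theorem iterBracket_gGen_sub_mem (hθ : IsSatakeTheta A X τ γ θ) {w : List I} (hw : w ≠ []) :
    iterBracket (gGen A X θ c) w - iterBracket (f A) w ∈
      outerFiltration A X (-outerDegree X (wordWeight w) + 1) := by
  induction w, hw using word_induction with
  | single i => rw [wordWeight_singleton]; exact hθ.gGen_sub_f_mem i
  | cons i w hw ih =>
    have hg : iterBracket (gGen A X θ c) w ∈
        outerFiltration A X (-outerDegree X (wordWeight w)) := by
      have := Submodule.add_mem _ (outerFiltration_anti (by omega) ih)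
        (iterBracket_f_mem_outerFiltration (A := A) (X := X) hw)
      rwa [sub_add_cancel] at this
    have hf : f A i ∈ outerFiltration A X (-outerDegree X (simpleRoot i)) :=
      mem_outerFiltration (f_mem_rootSpace A i) (by rw [map_neg])
    have h1 : iterBracket (gGen A X θ c) (i :: w) - iterBracket (f A) (i :: w) =
        ⁅gGen A X θ c i - f A i, iterBracket (gGen A X θ c) w⁆ +
          ⁅f A i, iterBracket (gGen A X θ c) w - iterBracket (f A) w⁆ := by
      rw [iterBracket_cons _ _ hw, iterBracket_cons _ _ hw, sub_lie, lie_sub]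
      abel
    rw [h1, wordWeight_cons, map_add]
    exact Submodule.add_mem _
      (outerFiltration_anti (by omega) (lie_mem_outerFiltration (hθ.gGen_sub_f_mem i) hg))
      (outerFiltration_anti (by omega) (lie_mem_outerFiltration hf ih))

theorem iterBracket_gGen_mem (hθ : IsSatakeTheta A X τ γ θ) {w : List I} (hw : w ≠ []) :
    iterBracket (gGen A X θ c) w ∈ outerFiltration A X (-outerDegree X (wordWeight w)) := by
  have := Submodule.add_mem _ (outerFiltration_anti (by omega) (hθ.iterBracket_gGen_sub_mem (c := c) hw))
    (iterBracket_f_mem_outerFiltration (A := A) (X := X) hw)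
  rwa [sub_add_cancel] at this

end IsSatakeTheta

theorem iterBracket_gGen_of_outerDegree_eq_zero {w : List I} (hw : w ≠ [])
    (h0 : outerDegree X (wordWeight w) = 0) :
    iterBracket (gGen A X θ c) w = iterBracket (f A) w := by
  induction w, hw using word_induction with
  | single i =>
    rw [wordWeight_singleton, outerDegree_simpleRoot] at h0
    exact gGen_of_mem (by by_contra hi; simp [hi] at h0)
  | cons i w hw ih =>
    rw [wordWeight_cons, map_add, outerDegree_simpleRoot] at h0
    have h1 := outerDegree_nonneg (X := X) (wordWeight_nonneg w)
    have hi : i ∈ X := by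
      by_contra hi
      rw [if_neg hi] at h0
      omega
    rw [if_pos hi, zero_add] at h0
    rw [iterBracket_cons _ _ hw, iterBracket_cons _ _ hw, gGen_of_mem hi, ih h0]

namespace IsSatakeTheta

/-- The elements `g_w`, for words `w` such that the `f_w` are linearly independent, are linearly
independent modulo `𝔫⁺_X + 𝔥`. -/
theorem eq_zero_of_add_sum_eq_zero (hθ : IsSatakeTheta A X τ γ θ) {J : Set (List I)}
    (hJ : ∀ w ∈ J, w ≠ []) (hJind : LinearIndependent ℂ fun w : J => iterBracket (f A) w)
    {x t : KM A} (hx : x ∈ nPlus A X) (ht : t ∈ cartan A) (s : Finset J) (a : J → ℂ)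
    (h0 : x + t + ∑ w ∈ s, a w • iterBracket (gGen A X θ c) w = 0) :
    x = 0 ∧ t = 0 ∧ ∀ w ∈ s, a w = 0 := by
  have hx' := nPlus_le_weightSpan hx
  have ht' := cartan_le_rootSpace ht
  have hind := linearIndependent_iff'.1 hJind
  have hnn : ∀ w : J, 0 ≤ outerDegree X (wordWeight (w : List I)) :=
    fun w => outerDegree_nonneg (wordWeight_nonneg _)
  have hxt : x + t ∈ weightSpan A {μ | 0 ≤ μ} := Submodule.add_mem _
    (weightSpan_mono (fun μ hμ => hμ.1) hx')
    (rootSpace_le_weightSpan (S := {μ | 0 ≤ μ}) (le_refl (0 : I → ℤ)) ht')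
  -- Induction on a bound for the outer degrees that occur. At `N = 0` each `g_w` in play equals
  -- `f_w`, and negative weights are compared with `x + t` of nonnegative weight.
  have key : ∀ N : ℕ, (∀ w ∈ s, a w ≠ 0 → outerDegree X (wordWeight (w : List I)) ≤ N) →
      ∀ w ∈ s, a w = 0 := by
    intro N
    induction N with
    | zero =>
      intro hN
      refine hind s a (eq_zero_of_mem_weightSpan (S := {μ | μ ≤ 0 ∧ μ ≠ 0}) (T := {μ | 0 ≤ μ})
        (Set.disjoint_left.2 fun μ h1 h2 => h1.2 (le_antisymm h1.1 h2)) ?_ ?_)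
      · refine Submodule.sum_mem _ fun w _ => Submodule.smul_mem _ _ ?_
        refine rootSpace_le_weightSpan ?_ (iterBracket_f_mem_rootSpace (hJ w w.2))
        exact ⟨neg_nonpos.2 (wordWeight_nonneg _),
          fun h => hJ w w.2 (wordWeight_eq_zero (neg_eq_zero.1 h))⟩
      · have h1 : ∑ w ∈ s, a w • iterBracket (f A) w = -(x + t) := by
          rw [← add_eq_zero_iff_eq_neg', ← h0]
          congr 1
          refine Finset.sum_congr rfl fun w hw => ?_
          by_cases haw : a w = 0
          · rw [haw, zero_smul, zero_smul]
          · rw [iterBracket_gGen_of_outerDegree_eq_zero (hJ w w.2)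
              (le_antisymm (by simpa using hN w hw haw) (hnn w))]
        rw [h1]
        exact Submodule.neg_mem _ hxt
    | succ N ih =>
      intro hN
      let P : J → Prop := fun w => outerDegree X (wordWeight (w : List I)) = (N + 1 : ℕ)
      -- The `f_w` with `w` of outer degree `N + 1` live in degree `-(N + 1)`, but the relation
      -- expresses their sum by terms of degree at least `-N`; so this sum is zero.
      have htop : ∀ w ∈ s.filter P, a w = 0 := by
        refine hind _ a (eq_zero_of_mem_weightSpan
          (S := {μ | outerDegree X μ = -(N + 1 : ℕ)})
          (T := {μ | -(N : ℤ) ≤ outerDegree X μ})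
          (Set.disjoint_left.2 fun μ h1 h2 => ?_) ?_ ?_)
        · rw [Set.mem_ofPred_eq] at h1 h2
          push_cast at h1
          omega
        · refine Submodule.sum_mem _ fun w hw => Submodule.smul_mem _ _ ?_
          refine rootSpace_le_weightSpan ?_ (iterBracket_f_mem_rootSpace (hJ w w.2))
          rw [Set.mem_ofPred_eq, map_neg, (Finset.mem_filter.1 hw).2]
        · have h1 : ∑ w ∈ s.filter P, a w • iterBracket (f A) w = -((x + t) +
              ∑ w ∈ s.filter P, a w •
                (iterBracket (gGen A X θ c) w - iterBracket (f A) w) +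
              ∑ w ∈ s.filter (fun w => ¬P w), a w • iterBracket (gGen A X θ c) w) := by
            rw [← Finset.sum_filter_add_sum_filter_not s P] at h0
            rw [eq_neg_iff_add_eq_zero, ← h0]
            simp only [smul_sub, Finset.sum_sub_distrib]
            abel
          rw [h1]
          show _ ∈ outerFiltration A X (-(N : ℤ))
          refine Submodule.neg_mem _ (Submodule.add_mem _ (Submodule.add_mem _ ?_ ?_) ?_)
          · exact weightSpan_mono (fun μ hμ =>
              (neg_nonpos.2 (Int.natCast_nonneg N)).trans (outerDegree_nonneg hμ)) hxt
          · refine Submodule.sum_mem _ fun w hw => Submodule.smul_mem _ _ ?_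
            refine outerFiltration_anti ?_ (hθ.iterBracket_gGen_sub_mem (hJ w w.2))
            have : outerDegree X (wordWeight (w : List I)) = (N + 1 : ℕ) :=
              (Finset.mem_filter.1 hw).2
            push_cast at this
            omega
          · refine Submodule.sum_mem _ fun w hw => ?_
            obtain ⟨hws, hwP⟩ := Finset.mem_filter.1 hw
            by_cases haw : a w = 0
            · rw [haw, zero_smul]; exact Submodule.zero_mem _
            refine Submodule.smul_mem _ _ (outerFiltration_anti ?_ (hθ.iterBracket_gGen_mem (hJ w w.2)))
            have h2 := hN w hws haw
            have h3 : outerDegree X (wordWeight (w : List I)) ≠ (N + 1 : ℕ) := hwP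
            push_cast at h2 h3
            omega
      refine ih fun w hw haw => ?_
      have h2 := hN w hw haw
      have h3 : outerDegree X (wordWeight (w : List I)) ≠ (N + 1 : ℕ) :=
        fun h => haw (htop w (Finset.mem_filter.2 ⟨hw, h⟩))
      push_cast at h2 h3
      omega
  have ha : ∀ w ∈ s, a w = 0 := by
    refine key (s.sup fun w => (outerDegree X (wordWeight (w : List I))).toNat) fun w hw _ => ?_
    have := Finset.le_sup (f := fun w : J => (outerDegree X (wordWeight (w : List I))).toNat) hw
    have h2 := hnn w
    omega
  rw [Finset.sum_eq_zero (fun w hw => by rw [ha w hw, zero_smul]), add_zero] at h0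
  have hx0 : x = 0 := by
    refine eq_zero_of_mem_weightSpan (S := {μ | 0 ≤ μ ∧ μ ≠ 0}) (T := {0})
      (Set.disjoint_left.2 fun μ h1 h2 => h1.2 h2) hx' ?_
    rw [eq_neg_of_add_eq_zero_left h0]
    exact Submodule.neg_mem _ (rootSpace_le_weightSpan (Set.mem_singleton _) ht')
  rw [hx0, zero_add] at h0
  exact ⟨hx0, h0, ha⟩

theorem iSupIndep_summand (hθ : IsSatakeTheta A X τ γ θ) {J : Set (List I)}
    (hJ : ∀ w ∈ J, w ≠ []) (hJind : LinearIndependent ℂ fun w : J => iterBracket (f A) w) :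
    iSupIndep (summand A X θ c J) := by
  rw [iSupIndep_iff_finsetSum_eq_zero_imp_eq_zero]
  classical
  intro s v hv hsum
  -- Extension by zero, so that the two special summands are always present in the relation.
  let v' : Fin 2 ⊕ J → KM A := fun i => if i ∈ s then v i else 0
  have hv' : ∀ i, v' i ∈ summand A X θ c J i := by
    intro i
    by_cases hi : i ∈ s
    · simpa [v', hi] using hv i hi
    · simp [v', hi]
  have hsum' : ∑ i ∈ (Finset.univ : Finset (Fin 2)).disjSum s.toRight, v' i = 0 := by
    rw [← hsum]
    symm
    refine (Finset.sum_congr rfl fun i hi => (if_pos hi).symm).trans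
      (Finset.sum_subset (f := v') ?_ fun i _ hi => if_neg hi)
    rintro (i | w) hi
    · simp
    · simpa using hi
  rw [Finset.sum_disjSum, Fin.sum_univ_two] at hsum'
  have hsp : ∀ w : J, ∃ a : ℂ, a • iterBracket (gGen A X θ c) w = v' (.inr w) :=
    fun w => Submodule.mem_span_singleton.1 (hv' (.inr w))
  choose a ha using hsp
  simp only [← ha] at hsum'
  obtain ⟨h1, h2, h3⟩ := hθ.eq_zero_of_add_sum_eq_zero hJ hJind (hv' (.inl 0)) (hv' (.inl 1)).1
    _ _ hsum'
  intro i hi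
  have hvi : v i = v' i := (if_pos hi).symm
  rw [hvi]
  rcases i with i | w
  · fin_cases i
    · exact h1
    · exact h2
  · rw [← ha, h3 w (by simpa using hi), zero_smul]

theorem iterBracket_gGen_ne_zero (hθ : IsSatakeTheta A X τ γ θ) {J : Set (List I)}
    (hJ : ∀ w ∈ J, w ≠ []) (hJind : LinearIndependent ℂ fun w : J => iterBracket (f A) w)
    {w : List I} (hw : w ∈ J) : iterBracket (gGen A X θ c) w ≠ 0 := by
  intro h
  have := (hθ.eq_zero_of_add_sum_eq_zero (c := c) hJ hJind (nPlus A X).zero_mem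
    (cartan A).zero_mem {⟨w, hw⟩} (fun _ => 1) (by simp [h])).2.2 _ (Finset.mem_singleton_self _)
  exact one_ne_zero this

/-- Expand `f_w` in the basis indexed by `J` and transfer the relation to the `g`'s by
`sum_iterBracket_mem`. The error has lower degree and is covered by induction on `m`. -/
theorem kFiltration_le (hA : IsSymmetrizableGCM A) (hθ : IsSatakeTheta A X τ γ θ)
    (hc : ∀ i ∉ X, c i ≠ 0)
    (hdiff : ∀ j ∉ X, A j (τ j) = 0 → neighbourComponent A X j = ∅ → c j = c (τ j))
    {J : Set (List I)} (hJ : ∀ w ∈ J, w ≠ [])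
    (hJspan : Submodule.span ℂ (Set.range fun w : J => iterBracket (f A) w) =
      (nMinus A).toSubmodule) (m : ℕ) :
    kFiltration A X θ c m ≤ ((nPlus A X).toSubmodule ⊔ fixedIn (cartan A) θ) ⊔
      Submodule.span ℂ (Set.range fun w : J => iterBracket (gGen A X θ c) w) := by
  induction m with
  | zero =>
    refine sup_le_sup_left (Submodule.span_le.2 ?_) _
    rintro _ ⟨w, ⟨hw, hw0⟩, rfl⟩
    exact absurd (List.length_eq_zero_iff.1 (Nat.le_zero.1 hw0)) hw
  | succ m ih =>
    refine sup_le le_sup_left (Submodule.span_le.2 ?_)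
    rintro _ ⟨w, ⟨hw, hwm⟩, rfl⟩
    rcases Nat.lt_or_ge m w.length with hlt | hle
    swap
    · exact ih (iterBracket_mem_kFiltration hw hle)
    have hlen : w.length = m + 1 := by omega
    have hfw : iterBracket (f A) w ∈
        Submodule.span ℂ (Set.range fun w : J => iterBracket (f A) w) := by
      rw [hJspan]
      exact iterBracket_mem_lieSpan (S := nMinus A) hw fun i _ =>
        LieSubalgebra.subset_lieSpan ⟨i, rfl⟩
    obtain ⟨a, ha⟩ := (Finsupp.mem_span_range_iff_exists_finsupp).1 hfw
    -- The relation `f_w - ∑ a_u f_u = 0` as a function on words; coefficients are merged, since `w`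
    -- may itself belong to `J`.
    let b : List I →₀ ℂ := Finsupp.single w 1 - a.mapDomain Subtype.val
    have hb : ∀ {M : Type _} [AddCommGroup M] [Module ℂ M] (g : List I → M),
        Finsupp.linearCombination ℂ g b = g w - a.sum fun u r => r • g u := by
      intro M _ _ g
      rw [map_sub, Finsupp.linearCombination_single, one_smul, Finsupp.linearCombination_mapDomain]
      rfl
    have hbs : ∀ u ∈ b.support, u ≠ [] := by
      intro u hu
      have h1 := Finsupp.support_sub hu
      rcases Finset.mem_union.1 h1 with h2 | h2
      · rw [Finset.mem_singleton.1 (Finsupp.support_single_subset h2)]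
        exact hw
      · obtain ⟨j, -, rfl⟩ := Finset.mem_image.1 (Finsupp.mapDomain_support h2)
        exact hJ j j.2
    have hb0 : ∑ u ∈ b.support, b u • iterBracket (f A) u = 0 := by
      have := hb (iterBracket (f A))
      rw [ha, sub_self] at this
      exact this
    -- Only words of length `m + 1` enter, so the words of `J` of other lengths in the expansion of
    -- `f_w` drop out.
    have h1 := sum_iterBracket_mem hA.diag hA.offDiag hA.eq_zero_symm (kFiltration A X θ c)
      (gGen A X θ c) (fun _ _ _ hx _ hy => hθ.lie_mem_kFiltration hx hy) gGen_mem_kFiltration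
      (hθ.serreElt_gGen_mem_kFiltration hA hc hdiff) b.support b hbs hb0 m
    have h2 := hb fun u => if u.length = m + 1 then iterBracket (gGen A X θ c) u else 0
    have h3 : ∑ u ∈ b.support with u.length = m + 1, b u • iterBracket (gGen A X θ c) u =
        Finsupp.linearCombination ℂ
          (fun u => if u.length = m + 1 then iterBracket (gGen A X θ c) u else 0) b := by
      rw [Finset.sum_filter, Finsupp.linearCombination_apply, Finsupp.sum]
      refine Finset.sum_congr rfl fun u _ => ?_
      split_ifs <;> simp
    rw [h3, h2, if_pos hlen] at h1
    have h4 : (a.sum fun u r => r • if (u : List I).length = m + 1 then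
        iterBracket (gGen A X θ c) u else 0) ∈
        Submodule.span ℂ (Set.range fun w : J => iterBracket (gGen A X θ c) w) := by
      refine Submodule.sum_mem _ fun u _ => Submodule.smul_mem _ _ ?_
      split_ifs
      · exact Submodule.subset_span ⟨u, rfl⟩
      · exact Submodule.zero_mem _
    have h5 := Submodule.add_mem _ (ih h1) (Submodule.mem_sup_right h4)
    rwa [sub_add_cancel] at h5

theorem toSubmodule_kSub_le (hθ : IsSatakeTheta A X τ γ θ) :
    (kSub A X θ c).toSubmodule ≤ ⨆ m, kFiltration A X θ c m := by
  have hdir : Directed (· ≤ ·) (kFiltration A X θ c) :=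
    directed_of_isDirected_le fun _ _ => kFiltration_mono
  refine lieSpan_le_of_stable ?_ ?_
  · rintro x ((hx | hx) | ⟨i, rfl⟩)
    · exact Submodule.mem_iSup_of_mem 0 (nPlus_le_kFiltration 0 hx)
    · exact Submodule.mem_iSup_of_mem 0 (fixed_le_kFiltration 0 hx)
    · exact Submodule.mem_iSup_of_mem 1 (gGen_mem_kFiltration i)
  · intro x hx v hv
    obtain ⟨m, hm⟩ := (Submodule.mem_iSup_of_directed _ hdir).1 hv
    rcases hx with (hx | hx) | ⟨i, rfl⟩
    · exact Submodule.mem_iSup_of_mem m (hθ.lie_nPlus_mem_kFiltration hx hm)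
    · exact Submodule.mem_iSup_of_mem m (hθ.lie_fixed_mem_kFiltration hx hm)
    · exact Submodule.mem_iSup_of_mem (m + 1) (hθ.lie_gGen_mem_kFiltration i hm)

theorem iSup_summand (hA : IsSymmetrizableGCM A) (hθ : IsSatakeTheta A X τ γ θ)
    (hc : ∀ i ∉ X, c i ≠ 0)
    (hdiff : ∀ j ∉ X, A j (τ j) = 0 → neighbourComponent A X j = ∅ → c j = c (τ j))
    {J : Set (List I)} (hJ : ∀ w ∈ J, w ≠ [])
    (hJspan : Submodule.span ℂ (Set.range fun w : J => iterBracket (f A) w) =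
      (nMinus A).toSubmodule) :
    (⨆ s, summand A X θ c J s) = (kSub A X θ c).toSubmodule := by
  apply le_antisymm
  · refine iSup_le ?_
    rintro (i | w)
    · fin_cases i
      · exact fun x hx => LieSubalgebra.subset_lieSpan (Or.inl (Or.inl hx))
      · exact fun x hx => LieSubalgebra.subset_lieSpan (Or.inl (Or.inr hx))
    · refine Submodule.span_le.2 (Set.singleton_subset_iff.2 ?_)
      exact iterBracket_mem_lieSpan (S := kSub A X θ c) (hJ w w.2) fun i _ =>
        LieSubalgebra.subset_lieSpan (Or.inr ⟨i, rfl⟩)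
  · refine hθ.toSubmodule_kSub_le.trans (iSup_le fun m => ?_)
    refine (hθ.kFiltration_le hA hc hdiff hJ hJspan m).trans (sup_le (sup_le ?_ ?_) ?_)
    · exact le_iSup (summand A X θ c J) (.inl 0)
    · exact le_iSup (summand A X θ c J) (.inl 1)
    · refine Submodule.span_le.2 ?_
      rintro _ ⟨w, rfl⟩
      exact Submodule.mem_iSup_of_mem (.inr w) (Submodule.mem_span_singleton_self _)

end IsSatakeTheta

end WeightSpan

end KacMoody

end

open KacMoody in
/-- `c` is a family of nonzero scalars indexed by the complement of `X` (its values on `X` are never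
used); `l` is any reduced expression of the longest element of `W_X`; `J` is any set of nonempty
words whose iterated brackets of the `f_i` form a basis of `𝔫⁻`. -/
theorem mainTheorem2 {I : Type*} [Fintype I] [DecidableEq I] (A : Matrix I I ℤ)
    (hA : IsSymmetrizableGCM A) (hind : IsIndecomposable A)
    (X : Finset I) (τ : Equiv.Perm I) (hXτ : IsGeneralizedSatake A X τ)
    (l : List I) (hl : IsLongestWord A X l)
    (θ : KM A →ₗ[ℂ] KM A) (hθ : θ = theta A τ hXτ.diagramAut l)
    (c : I → ℂ) (hc : ∀ i ∉ X, c i ≠ 0)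
    (hdiff : ∀ j ∉ X, A j (τ j) = 0 → neighbourComponent A X j = ∅ → c j = c (τ j))
    (J : Set (List I)) (hJ : ∀ w ∈ J, w ≠ [])
    (hJind : LinearIndependent ℂ fun w : J => iterBracket (f A) w)
    (hJspan : Submodule.span ℂ (Set.range fun w : J => iterBracket (f A) w) =
      (nMinus A).toSubmodule) :
    iSupIndep (summand A X θ c J) ∧
      (⨆ s, summand A X θ c J s) = (kSub A X θ c).toSubmodule ∧
      ∀ w ∈ J, iterBracket (gGen A X θ c) w ≠ 0 := by
  subst hθ
  have hS := isSatakeTheta hA hXτ hl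
  exact ⟨hS.iSupIndep_summand hJ hJind, hS.iSup_summand hA hc hdiff hJ hJspan,
    fun w hw => hS.iterBracket_gGen_ne_zero hJ hJind hw⟩
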